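/- Let $\theta\in\mathbb R$ be irrational and $\lambda=e^{2\pi i\theta}$. Let $A$ be the universal unital $C^*$-algebra generated by two isometries $u,v$ with $uv=\lambda vu$, and let $B=C(S^1)*_{\mathbb C}\mathbb C^2$ be the unital free product, i.e. the universal unital $C^*$-algebra generated by a unitary $\bar u$ and a projection $\bar p$. Let $\mathcal K$ be the $C^*$-algebra of compact operators on $\ell^2(\mathbb N_0)$ and let $x_i\in\mathcal K$ $(i\in\mathbb N_0)$ be the rank one operator $\xi\mapsto\langle e_0,\xi\rangle e_i$. Write $\langle S\rangle$ for the closed two-sided ideal generated by $S$, and let $J=\langle 1-uu^*,1-vv^*\rangle\lhd A$. Then there is a $*$-isomorphism $\Phi:J\to B\otimes\mathcal K$ with $$\Phi\big((uv)^i(u(1-vv^*)+(1-uu^*)v^*)\big)=\bar u\otimes x_i,\qquad \Phi\big((uv)^i\,v(1-uu^*)v^*\big)=\bar p\otimes x_i\qquad(i\in\mathbb N_0).$$ Say that a closed ideal $I\lhd A$ corresponds to a closed ideal $I'\lhd B$ if $I\subseteq J$ and $\Phi(I)=I'\otimes\mathcal K$, the closed linear span of all $a\otimes k$ with $a\in I'$,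 $k\in\mathcal K$. For every such $\Phi$: (a) $\langle 1-uu^*\rangle\lhd A$ corresponds to $\langle\bar p\rangle\lhd B$, and $\langle 1-vv^*\rangle\lhd A$ corresponds to $\langle 1-\bar p\rangle\lhd B$; (b) $\langle u^*v-\bar\lambda vu^*\rangle\lhd A$ corresponds to $\langle\bar p\bar u(1-\bar p)\rangle\lhd B$, and $\langle(1-uu^*)(1-vv^*)\rangle\lhd A$ corresponds to $\langle(1-\bar p)\bar u\bar p\rangle\lhd B$; (c) $\langle u^*v-\bar\lambda vu^*,\ (1-uu^*)(1-vv^*)\rangle\lhd A$ corresponds to $\langle\bar u\bar p-\bar p\bar u\rangle\lhd B$. -/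

import Mathlib

open scoped TensorProduct InnerProductSpace

namespace FreeTwist

noncomputable section

/-- A representation of a complex star algebra by bounded operators on a Hilbert space. -/
structure Rep (R : Type) [NonUnitalRing R] [StarRing R] [Module ℂ R] where
  H : Type
  [normed : NormedAddCommGroup H]
  [inner : InnerProductSpace ℂ H]
  [complete : CompleteSpace H]
  π : R →⋆ₙₐ[ℂ] (H →L[ℂ] H)

attribute [instance] Rep.normed Rep.inner Rep.complete

/-- A class of Hilbert space representations of `R` which is pointwise norm bounded. -/
structure RepFamily (R : Type) [NonUnitalRing R] [StarRing R] [Module ℂ R] where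
  reps : Set (Rep R)
  bdd : ∀ x : R, ∃ C : ℝ, ∀ ρ ∈ reps, ‖ρ.π x‖ ≤ C

section Env

variable {R : Type} [NonUnitalRing R] [StarRing R] [Module ℂ R]

/-- The C*-seminorm `‖x‖ = sup ‖π x‖` over all representations `π` in the family. -/
def RepFamily.sup (F : RepFamily R) (x : R) : ℝ := ⨆ ρ : F.reps, ‖ρ.1.π x‖

theorem RepFamily.le_sup (F : RepFamily R) {ρ : Rep R} (h : ρ ∈ F.reps) (x : R) :
    ‖ρ.π x‖ ≤ F.sup x := by
  obtain ⟨C, hC⟩ := F.bdd x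
  exact le_ciSup (f := fun ρ : F.reps => ‖ρ.1.π x‖)
    ⟨C, by rintro _ ⟨ρ, rfl⟩; exact hC _ ρ.2⟩ ⟨ρ, h⟩

theorem RepFamily.sup_le (F : RepFamily R) {x : R} {C : ℝ} (h0 : 0 ≤ C)
    (h : ∀ ρ ∈ F.reps, ‖ρ.π x‖ ≤ C) : F.sup x ≤ C :=
  Real.iSup_le (fun ρ => h _ ρ.2) h0

theorem RepFamily.sup_nonneg (F : RepFamily R) (x : R) : 0 ≤ F.sup x :=
  Real.iSup_nonneg fun _ => norm_nonneg _

/-- The algebra `R`, to be equipped with the seminorm `F.sup`. -/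
def Pre (_F : RepFamily R) : Type := R

variable (F : RepFamily R)

instance : NonUnitalRing (Pre F) := inferInstanceAs (NonUnitalRing R)
instance : StarRing (Pre F) := inferInstanceAs (StarRing R)
instance : Module ℂ (Pre F) := inferInstanceAs (Module ℂ R)
instance [IsScalarTower ℂ R R] : IsScalarTower ℂ (Pre F) (Pre F) :=
  inferInstanceAs (IsScalarTower ℂ R R)
instance [SMulCommClass ℂ R R] : SMulCommClass ℂ (Pre F) (Pre F) :=
  inferInstanceAs (SMulCommClass ℂ R R)
instance [StarModule ℂ R] : StarModule ℂ (Pre F) := inferInstanceAs (StarModule ℂ R)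

instance : SeminormedAddCommGroup (Pre F) :=
  AddGroupSeminorm.toSeminormedAddCommGroup (E := Pre F)
    { toFun := F.sup
      map_zero' := le_antisymm (F.sup_le le_rfl fun ρ _ => by
        have : ρ.π (0 : R) = 0 := map_zero _
        exact ((congrArg norm this).trans norm_zero).le) (F.sup_nonneg _)
      add_le' := fun x y => F.sup_le (add_nonneg (F.sup_nonneg _) (F.sup_nonneg _)) fun ρ h => by
        have : ρ.π ((x : R) + (y : R)) = ρ.π x + ρ.π y := map_add _ _ _
        exact (congrArg norm this).trans_le
          ((norm_add_le _ _).trans (add_le_add (F.le_sup h x) (F.le_sup h y)))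
      neg' := fun x => congrArg iSup <| funext fun ρ => by
        have : ρ.1.π (-(x : R)) = -ρ.1.π x := map_neg _ _
        exact (congrArg norm this).trans (norm_neg _) }

theorem Pre.norm_eq (x : R) : ‖(show Pre F from x)‖ = F.sup x := rfl

instance : NonUnitalSeminormedRing (Pre F) :=
  { (inferInstance : SeminormedAddCommGroup (Pre F)), (inferInstance : NonUnitalRing (Pre F)) with
    norm_mul_le := fun x y =>
      F.sup_le (mul_nonneg (F.sup_nonneg _) (F.sup_nonneg _)) fun ρ h => by
        have : ρ.π ((x : R) * (y : R)) = ρ.π x * ρ.π y := map_mul _ _ _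
        exact (congrArg norm this).trans_le ((norm_mul_le _ _).trans
          (mul_le_mul (F.le_sup h x) (F.le_sup h y) (norm_nonneg _) (F.sup_nonneg _))) }

instance : NormedSpace ℂ (Pre F) where
  norm_smul_le := fun c x =>
    F.sup_le (mul_nonneg (norm_nonneg _) (F.sup_nonneg _)) fun ρ h => by
      have : ρ.π (c • (x : R)) = c • ρ.π x := map_smul _ _ _
      exact (congrArg norm this).trans_le ((norm_smul_le _ _).trans
        (mul_le_mul_of_nonneg_left (F.le_sup h x) (norm_nonneg _)))

instance : NormedStarGroup (Pre F) where
  norm_star_le := fun x => F.sup_le (F.sup_nonneg _) fun ρ h => by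
    have : ρ.π (star (x : R)) = star (ρ.π x) := map_star _ _
    exact (congrArg norm this).trans_le ((norm_star _).trans_le (F.le_sup h x))

theorem Pre.norm_mul_self_le (x : Pre F) : ‖x‖ * ‖x‖ ≤ ‖star x * x‖ := by
  have h0 : 0 ≤ ‖star x * x‖ := norm_nonneg _
  have h : ‖x‖ ≤ √‖star x * x‖ := F.sup_le (Real.sqrt_nonneg _) fun ρ h => by
    refine Real.le_sqrt_of_sq_le ?_
    have e : ρ.π (star (show R from x) * (show R from x)) = star (ρ.π x) * ρ.π x := by
      rw [map_mul, map_star]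
    have := F.le_sup h (star (show R from x) * (show R from x))
    rw [e, CStarRing.norm_star_mul_self, ← sq] at this
    exact this
  calc ‖x‖ * ‖x‖ ≤ √‖star x * x‖ * √‖star x * x‖ := by gcongr
    _ = _ := Real.mul_self_sqrt h0

/-- The enveloping C*-algebra of `R` with respect to a family of representations: the Hausdorff
completion of `R` in the C*-seminorm `x ↦ sup ‖π x‖`. -/
def Env : Type := UniformSpace.Completion (Pre F)

namespace Env
open UniformSpace UniformSpace.Completion Function

instance : NormedAddCommGroup (Env F) := inferInstanceAs (NormedAddCommGroup (Completion (Pre F)))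
instance : NormedSpace ℂ (Env F) := inferInstanceAs (NormedSpace ℂ (Completion (Pre F)))
instance : CompleteSpace (Env F) := inferInstanceAs (CompleteSpace (Completion (Pre F)))

/-- The canonical map with dense range from `R` to its enveloping C*-algebra. -/
def of (x : R) : Env F := ((show Pre F from x : Pre F) : Completion (Pre F))

instance : Mul (Env F) :=
  ⟨curry <| (isDenseInducing_coe.prodMap isDenseInducing_coe).extend
    (fun p : Pre F × Pre F => of F (p.1 * p.2))⟩

instance : Star (Env F) := ⟨Completion.map (star : Pre F → Pre F)⟩

theorem continuous_of : Continuous (fun x : Pre F => of F x) := continuous_coe (Pre F)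

theorem norm_of (x : R) : ‖of F x‖ = F.sup x := norm_coe (E := Pre F) x

theorem of_add (x y : R) : of F (x + y) = of F x + of F y := coe_add (α := Pre F) x y

theorem of_zero : of F (0 : R) = 0 := coe_zero (α := Pre F)

theorem of_smul (c : ℂ) (x : R) : of F (c • x) = c • of F x := coe_smul (X := Pre F) c x

theorem of_mul (x y : R) : of F (x * y) = of F x * of F y :=
  ((isDenseInducing_coe.prodMap isDenseInducing_coe).extend_eq
    ((continuous_of F).comp (continuous_mul (M := Pre F))) (x, y)).symm

theorem of_star (x : R) : of F (star x) = star (of F x) :=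
  (map_coe (f := (star : Pre F → Pre F))
    (star_isometry (E := Pre F)).uniformContinuous x).symm

theorem ind {p : Env F → Prop} (hc : IsClosed {x | p x}) (h : ∀ x : R, p (of F x)) (x : Env F) :
    p x := Completion.induction_on (α := Pre F) x hc h

theorem ind₂ {p : Env F → Env F → Prop} (hc : IsClosed {x : Env F × Env F | p x.1 x.2})
    (h : ∀ x y : R, p (of F x) (of F y)) (x y : Env F) :
    p x y := Completion.induction_on₂ (α := Pre F) (β := Pre F) x y hc h

theorem ind₃ {p : Env F → Env F → Env F → Prop}
    (hc : IsClosed {x : Env F × Env F × Env F | p x.1 x.2.1 x.2.2})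
    (h : ∀ x y z : R, p (of F x) (of F y) (of F z)) (x y z : Env F) :
    p x y z := Completion.induction_on₃ (α := Pre F) (β := Pre F) (γ := Pre F) x y z hc h

instance : ContinuousMul (Env F) where
  continuous_mul := by
    let m := (AddMonoidHom.mul : Pre F →+ Pre F →+ Pre F).compr₂ toCompl
    have : Continuous fun p : Pre F × Pre F => m p.1 p.2 :=
      (continuous_coe (Pre F)).comp continuous_mul
    have di : IsDenseInducing (toCompl : Pre F → Completion (Pre F)) := isDenseInducing_coe
    exact (di.extend_Z_bilin di this :)

instance : ContinuousStar (Env F) := ⟨continuous_map⟩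

instance : NonUnitalNormedRing (Env F) :=
  { (inferInstance : NormedAddCommGroup (Env F)), (inferInstance : Mul (Env F)) with
    zero_mul := ind F (isClosed_eq (by fun_prop) continuous_const) fun a => by
      rw [← of_zero, ← of_mul, zero_mul]
    mul_zero := ind F (isClosed_eq (by fun_prop) continuous_const) fun a => by
      rw [← of_zero, ← of_mul, mul_zero]
    mul_assoc := ind₃ F (isClosed_eq (by fun_prop) (by fun_prop)) fun a b c => by
      simp only [← of_mul, mul_assoc]
    left_distrib := ind₃ F (isClosed_eq (by fun_prop) (by fun_prop)) fun a b c => by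
      simp only [← of_mul, ← of_add, mul_add]
    right_distrib := ind₃ F (isClosed_eq (by fun_prop) (by fun_prop)) fun a b c => by
      simp only [← of_mul, ← of_add, add_mul]
    norm_mul_le := ind₂ F (isClosed_le (by fun_prop) (by fun_prop)) fun a b => by
      rw [← of_mul, norm_of, norm_of, norm_of]; exact norm_mul_le (α := Pre F) a b }

theorem star_star' (x : Env F) : star (star x) = x :=
  ind F (p := fun x => star (star x) = x)
    (isClosed_eq (continuous_star.comp continuous_star) continuous_id)
    (fun a => by rw [← of_star, ← of_star, star_star]) x

theorem star_mul' (x y : Env F) : star (x * y) = star y * star x :=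
  ind₂ F (p := fun x y => star (x * y) = star y * star x)
    (isClosed_eq (by fun_prop) (by fun_prop))
    (fun a b => by rw [← of_mul, ← of_star, ← of_star, ← of_star, ← of_mul, star_mul]) x y

theorem star_add' (x y : Env F) : star (x + y) = star x + star y :=
  ind₂ F (p := fun x y => star (x + y) = star x + star y)
    (isClosed_eq (by fun_prop) (by fun_prop))
    (fun a b => by rw [← of_add, ← of_star, ← of_star, ← of_star, ← of_add, star_add]) x y

instance : StarRing (Env F) where
  star_involutive := star_star' F
  star_mul := star_mul' F
  star_add := star_add' F

theorem smul_mul' [IsScalarTower ℂ R R] (c : ℂ) (x y : Env F) : (c • x) * y = c • (x * y) :=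
  ind₂ F (p := fun x y => (c • x) * y = c • (x * y))
    (isClosed_eq ((continuous_fst.const_smul c).mul continuous_snd)
      ((continuous_fst.mul continuous_snd).const_smul c))
    (fun a b => by
      rw [← of_smul, ← of_mul, ← of_mul, ← of_smul]
      exact congrArg (of F) (smul_mul_assoc c a b)) x y

theorem mul_smul' [SMulCommClass ℂ R R] (c : ℂ) (x y : Env F) : x * (c • y) = c • (x * y) :=
  ind₂ F (p := fun x y => x * (c • y) = c • (x * y))
    (isClosed_eq (continuous_fst.mul (continuous_snd.const_smul c))
      ((continuous_fst.mul continuous_snd).const_smul c))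
    (fun a b => by
      rw [← of_smul, ← of_mul, ← of_mul, ← of_smul]
      exact congrArg (of F) (mul_smul_comm c a b)) x y

theorem star_smul' [StarModule ℂ R] (c : ℂ) (x : Env F) : star (c • x) = star c • star x :=
  ind F (p := fun x => star (c • x) = star c • star x)
    (isClosed_eq (continuous_star.comp (continuous_id.const_smul c))
      (continuous_star.const_smul (star c)))
    (fun a => by
      rw [← of_smul, ← of_star, ← of_star, ← of_smul]
      exact congrArg (of F) (star_smul c a)) x

theorem norm_mul_self_le' (x : Env F) : ‖x‖ * ‖x‖ ≤ ‖star x * x‖ :=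
  ind F (p := fun x => ‖x‖ * ‖x‖ ≤ ‖star x * x‖)
    (isClosed_le (by fun_prop) (by fun_prop))
    (fun a => by
      rw [← of_star, ← of_mul, norm_of, norm_of]; exact Pre.norm_mul_self_le F a) x

instance [IsScalarTower ℂ R R] [SMulCommClass ℂ R R] [StarModule ℂ R] :
    NonUnitalCStarAlgebra (Env F) where
  smul_assoc := smul_mul' F
  smul_comm c x y := (mul_smul' F c x y).symm
  star_smul := star_smul' F
  norm_mul_self_le := norm_mul_self_le' F

end Env

end Env

section Unital

variable {R : Type} [Ring R] [StarRing R] [Algebra ℂ R] (F : RepFamily R)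

theorem Env.one_mul' (x : Env F) : Env.of F 1 * x = x :=
  Env.ind F (p := fun x => Env.of F 1 * x = x) (isClosed_eq (by fun_prop) (by fun_prop))
    (fun a => by rw [← Env.of_mul, one_mul]) x

theorem Env.mul_one' (x : Env F) : x * Env.of F 1 = x :=
  Env.ind F (p := fun x => x * Env.of F 1 = x) (isClosed_eq (by fun_prop) (by fun_prop))
    (fun a => by rw [← Env.of_mul, mul_one]) x

instance : Ring (Env F) :=
  { (inferInstance : NonUnitalRing (Env F)) with
    one := Env.of F 1
    one_mul := Env.one_mul' F
    mul_one := Env.mul_one' F }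

instance : Algebra ℂ (Env F) :=
  Algebra.ofModule (Env.smul_mul' F) (Env.mul_smul' F)

instance [StarModule ℂ R] : CStarAlgebra (Env F) :=
  { (inferInstance : NonUnitalCStarAlgebra (Env F)), (inferInstance : Ring (Env F)),
    (inferInstance : Algebra ℂ (Env F)) with }

end Unital

section FreeStar

/-- The unital free complex star algebra on a set of generators, i.e. the noncommutative polynomials
in the letters `(g, false)`, standing for a generator, and `(g, true)`, standing for its adjoint. -/
abbrev StarPoly (G : Type) : Type := MonoidAlgebra ℂ (FreeMonoid (G × Bool))

namespace StarPoly
variable {G : Type}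

/-- The monomial given by a word. -/
def word (w : FreeMonoid (G × Bool)) : StarPoly G := MonoidAlgebra.single w 1

/-- The adjoint of a word: reverse it and replace each letter by its adjoint. -/
def revHom : FreeMonoid (G × Bool) →* (FreeMonoid (G × Bool))ᵐᵒᵖ :=
  FreeMonoid.lift fun y : G × Bool => MulOpposite.op (FreeMonoid.of (y.1, !y.2))

theorem revHom_revHom (w : FreeMonoid (G × Bool)) : (revHom (revHom w).unop).unop = w := by
  induction w using FreeMonoid.inductionOn' with
  | one => simp
  | of_mul a w ih => 
    rw [map_mul, MulOpposite.unop_mul, map_mul, MulOpposite.unop_mul, ih]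
    simp [revHom]

/-- The involution as an additive map: `c w ↦ conj c w*`. -/
def starHom : StarPoly G →+ StarPoly G :=
  MonoidAlgebra.liftNC
    (((algebraMap ℂ (StarPoly G)).comp (starRingEnd ℂ) : ℂ →+* StarPoly G) : ℂ →+ StarPoly G)
    (fun w => word (revHom w).unop)

instance : Star (StarPoly G) := ⟨starHom⟩

theorem star_single (w : FreeMonoid (G × Bool)) (c : ℂ) :
    star (MonoidAlgebra.single w c : StarPoly G) =
      MonoidAlgebra.single (revHom w).unop (starRingEnd ℂ c) := by
  change starHom (MonoidAlgebra.single w c) = _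
  rw [starHom, MonoidAlgebra.liftNC_single]
  simp [word, MonoidAlgebra.single_mul_single]

theorem star_add' (a b : StarPoly G) : star (a + b) = star a + star b := map_add starHom a b

theorem star_zero' : star (0 : StarPoly G) = 0 := map_zero starHom

theorem star_mul' (a b : StarPoly G) : star (a * b) = star b * star a := by
  induction a using MonoidAlgebra.induction_linear with
  | zero => rw [zero_mul, star_zero', mul_zero]
  | add f g hf hg => rw [add_mul, star_add', star_add', mul_add, hf, hg]
  | single v c =>
    induction b using MonoidAlgebra.induction_linear with
    | zero => rw [mul_zero, star_zero', zero_mul]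
    | add f g hf hg => rw [mul_add, star_add', star_add', add_mul, hf, hg]
    | single w d =>
      rw [MonoidAlgebra.single_mul_single, star_single, star_single, star_single,
        MonoidAlgebra.single_mul_single, map_mul, map_mul, MulOpposite.unop_mul, mul_comm]

instance : StarRing (StarPoly G) where
  star_involutive a := by
    induction a using MonoidAlgebra.induction_linear with
    | zero => rw [star_zero', star_zero']
    | add f g hf hg => rw [star_add', star_add', hf, hg]
    | single w c => rw [star_single, star_single, revHom_revHom, Complex.conj_conj]
  star_mul := star_mul'
  star_add := star_add'

instance : StarModule ℂ (StarPoly G) where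
  star_smul c a := by
    induction a using MonoidAlgebra.induction_linear with
    | zero => rw [smul_zero, star_zero', smul_zero]
    | add f g hf hg => rw [smul_add, star_add', star_add', smul_add, hf, hg]
    | single w d =>
      rw [MonoidAlgebra.smul_single, star_single, star_single, MonoidAlgebra.smul_single]
      simp

end StarPoly

/-- The unital free complex star algebra on a set of generators. -/
def FreeStar (G : Type) : Type := StarPoly G

namespace FreeStar
variable {G : Type}

instance : Ring (FreeStar G) := inferInstanceAs (Ring (StarPoly G))
instance : StarRing (FreeStar G) := inferInstanceAs (StarRing (StarPoly G))
instance : Algebra ℂ (FreeStar G) := inferInstanceAs (Algebra ℂ (StarPoly G))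
instance : StarModule ℂ (FreeStar G) := inferInstanceAs (StarModule ℂ (StarPoly G))

/-- The generators. -/
def x (g : G) : FreeStar G := StarPoly.word (FreeMonoid.of (g, false))

/-- Induction on star polynomials in the generators. -/
theorem ind {p : FreeStar G → Prop} (hx : ∀ g, p (x g)) (h1 : p 1)
    (hs : ∀ (c : ℂ) a, p a → p (c • a)) (ha : ∀ a b, p a → p b → p (a + b))
    (hm : ∀ a b, p a → p b → p (a * b)) (hst : ∀ a, p a → p (star a)) (a : FreeStar G) : p a := by
  have hw : ∀ w, p (StarPoly.word w) := fun w => by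
    induction w using FreeMonoid.inductionOn' with
    | one => exact h1
    | of_mul y w ih =>
      have e : (StarPoly.word (FreeMonoid.of y * w) : StarPoly G) =
          StarPoly.word (FreeMonoid.of y) * StarPoly.word w := by
        simp [StarPoly.word, MonoidAlgebra.single_mul_single]
      rw [e]
      refine hm _ _ ?_ ih
      obtain ⟨g, b⟩ := y
      cases b
      · exact hx g
      · have : (StarPoly.word (FreeMonoid.of (g, true)) : StarPoly G) =
            star (StarPoly.word (FreeMonoid.of (g, false))) := by
          rw [StarPoly.word, StarPoly.word, StarPoly.star_single]
          simp [StarPoly.revHom]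
        rw [this]
        exact hst _ (hx g)
  induction (show StarPoly G from a) using MonoidAlgebra.induction_linear with
  | zero =>
    have := hs 0 1 h1
    rwa [zero_smul] at this
  | add f g hf hg => exact ha f g hf hg
  | single w c =>
    have e : (MonoidAlgebra.single w c : StarPoly G) = c • StarPoly.word w := by
      simp [StarPoly.word, MonoidAlgebra.smul_single]
    rw [e]
    exact hs _ _ (hw w)

end FreeStar

/-- The representations in which `1` acts as the identity and the relations `S` (polynomials which
are required to vanish) are satisfied. -/
def relReps {G : Type} (S : Set (FreeStar G)) : Set (Rep (FreeStar G)) :=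
  {ρ | ρ.π 1 = 1 ∧ ∀ s ∈ S, ρ.π s = 0}

theorem relReps_bdd {G : Type} (S : Set (FreeStar G))
    (h : ∀ ρ ∈ relReps S, ∀ g, ‖ρ.π (FreeStar.x g)‖ ≤ 1) (a : FreeStar G) :
    ∃ C : ℝ, ∀ ρ ∈ relReps S, ‖ρ.π a‖ ≤ C := by
  induction a using FreeStar.ind with
  | hx g => exact ⟨1, fun ρ hρ => h ρ hρ g⟩
  | h1 => exact ⟨1, fun ρ hρ => by rw [hρ.1]; exact ContinuousLinearMap.norm_id_le⟩
  | hs c a ha =>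
    obtain ⟨C, hC⟩ := ha
    refine ⟨‖c‖ * C, fun ρ hρ => ?_⟩
    rw [map_smul]
    exact (norm_smul_le _ _).trans (mul_le_mul_of_nonneg_left (hC ρ hρ) (norm_nonneg _))
  | ha a b ha hb =>
    obtain ⟨C, hC⟩ := ha
    obtain ⟨D, hD⟩ := hb
    refine ⟨C + D, fun ρ hρ => ?_⟩
    rw [map_add]
    exact (norm_add_le _ _).trans (add_le_add (hC ρ hρ) (hD ρ hρ))
  | hm a b ha hb =>
    obtain ⟨C, hC⟩ := ha
    obtain ⟨D, hD⟩ := hb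
    refine ⟨C * D, fun ρ hρ => ?_⟩
    rw [map_mul]
    exact (norm_mul_le _ _).trans (mul_le_mul (hC ρ hρ) (hD ρ hρ) (norm_nonneg _)
      ((norm_nonneg _).trans (hC ρ hρ)))
  | hst a ha =>
    obtain ⟨C, hC⟩ := ha
    refine ⟨C, fun ρ hρ => ?_⟩
    rw [map_star, norm_star]
    exact hC ρ hρ

theorem norm_le_one_of_isometry {H : Type} [NormedAddCommGroup H] [InnerProductSpace ℂ H]
    [CompleteSpace H] {T : H →L[ℂ] H} (h : star T * T = 1) : ‖T‖ ≤ 1 := by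
  have h1 : ‖T‖ * ‖T‖ ≤ 1 := by
    rw [← CStarRing.norm_star_mul_self, h]
    exact ContinuousLinearMap.norm_id_le
  nlinarith [norm_nonneg T]

theorem norm_le_one_of_projection {H : Type} [NormedAddCommGroup H] [InnerProductSpace ℂ H]
    [CompleteSpace H] {T : H →L[ℂ] H} (h : star T = T) (h' : T * T = T) : ‖T‖ ≤ 1 := by
  have h1 : ‖T‖ * ‖T‖ = ‖T‖ := by
    rw [← CStarRing.norm_star_mul_self, h, h']
  nlinarith [norm_nonneg T]

end FreeStar

section Tensor

section TensorStar
variable {A B : Type} [NonUnitalRing A] [StarRing A] [Module ℂ A] [StarModule ℂ A]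
  [IsScalarTower ℂ A A] [SMulCommClass ℂ A A]
  [NonUnitalRing B] [StarRing B] [Module ℂ B] [StarModule ℂ B]
  [IsScalarTower ℂ B B] [SMulCommClass ℂ B B]

/-- The involution `(a ⊗ b)* = a* ⊗ b*` on the algebraic tensor product. -/
instance tensorStarRing : StarRing (A ⊗[ℂ] B) where
  star_mul x y :=
    x.induction_on (by simp) (fun _ _ =>
      y.induction_on (by simp) (fun _ _ => by simp)
        fun _ _ h₁ h₂ => by simp only [mul_add, star_add, add_mul, h₁, h₂])
      fun _ _ h₁ h₂ => by simp only [mul_add, star_add, add_mul, h₁, h₂]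
  star_add := star_add
end TensorStar

theorem exists_sq {A : Type} [CStarAlgebra A] (a : A) :
    ∃ c : A, star a * a + star c * c = ((‖a‖ ^ 2 : ℝ) : ℂ) • (1 : A) := by
  let _ := CStarAlgebra.spectralOrder A
  let _ := CStarAlgebra.spectralOrderedRing A
  have h : star a * a ≤ algebraMap ℝ A (‖a‖ ^ 2) := CStarAlgebra.star_mul_le_algebraMap_norm_sq
  obtain ⟨c, hc⟩ := CStarAlgebra.nonneg_iff_eq_star_mul_self.mp (sub_nonneg.mpr h)
  refine ⟨c, ?_⟩
  rw [← hc, add_sub_cancel, Algebra.algebraMap_eq_smul_one]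
  exact (Complex.coe_smul _ _).symm

theorem tmul_bdd {A B : Type} [CStarAlgebra A] [NonUnitalCStarAlgebra B]
    {H : Type} [NormedAddCommGroup H] [InnerProductSpace ℂ H] [CompleteSpace H]
    (π : A ⊗[ℂ] B →⋆ₙₐ[ℂ] (H →L[ℂ] H)) (a : A) (b : B) : ‖π (a ⊗ₜ b)‖ ≤ ‖a‖ * ‖b‖ := by
  let ψ : B →⋆ₙₐ[ℂ] (H →L[ℂ] H) :=
    { toFun := fun b => π (1 ⊗ₜ b)
      map_smul' := fun c b => by
        change π (1 ⊗ₜ (c • b)) = c • π (1 ⊗ₜ b)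
        rw [TensorProduct.tmul_smul, map_smul]
      map_zero' := by rw [TensorProduct.tmul_zero, map_zero]
      map_add' := fun x y => by rw [TensorProduct.tmul_add, map_add]
      map_mul' := fun x y => by
        rw [← map_mul, Algebra.TensorProduct.tmul_mul_tmul, one_mul]
      map_star' := fun x => by rw [← map_star, TensorProduct.star_tmul, star_one] }
  have hψ : ‖π (1 ⊗ₜ b)‖ ≤ ‖b‖ := NonUnitalStarAlgHom.norm_apply_le ψ b
  obtain ⟨c, hc⟩ := exists_sq a
  have key : star (π (a ⊗ₜ b)) * π (a ⊗ₜ b) + star (π (c ⊗ₜ b)) * π (c ⊗ₜ b) =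
      ((‖a‖ ^ 2 : ℝ) : ℂ) • (star (π (1 ⊗ₜ b)) * π (1 ⊗ₜ b)) := by
    simp only [← map_star, ← map_mul, TensorProduct.star_tmul,
      Algebra.TensorProduct.tmul_mul_tmul, ← map_add, ← TensorProduct.add_tmul, hc, ← map_smul,
      TensorProduct.smul_tmul', star_one, one_mul]
  have inn : ∀ (T : H →L[ℂ] H) (ξ : H), ⟪(star T * T) ξ, ξ⟫_ℂ = ((‖T ξ‖ ^ 2 : ℝ) : ℂ) := by
    intro T ξ
    change ⟪(ContinuousLinearMap.adjoint T) (T ξ), ξ⟫_ℂ = _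
    rw [ContinuousLinearMap.adjoint_inner_left, inner_self_eq_norm_sq_to_K]
    norm_cast
  refine ContinuousLinearMap.opNorm_le_bound _ (by positivity) fun ξ => ?_
  have h2 := congrArg (fun T : H →L[ℂ] H => ⟪T ξ, ξ⟫_ℂ) key
  simp only [add_apply, inner_add_left, smul_apply,
    inner_smul_left, inn, Complex.conj_ofReal] at h2
  have h3 : ‖π (a ⊗ₜ b) ξ‖ ^ 2 + ‖π (c ⊗ₜ b) ξ‖ ^ 2 = ‖a‖ ^ 2 * ‖π (1 ⊗ₜ b) ξ‖ ^ 2 := by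
    exact_mod_cast h2
  have h4 : ‖π (a ⊗ₜ b) ξ‖ ≤ ‖a‖ * ‖π (1 ⊗ₜ b) ξ‖ := by
    refine abs_le_of_sq_le_sq' ?_ (by positivity) |>.2
    nlinarith [sq_nonneg ‖π (c ⊗ₜ b) ξ‖]
  calc ‖π (a ⊗ₜ b) ξ‖ ≤ ‖a‖ * ‖π (1 ⊗ₜ b) ξ‖ := h4
    _ ≤ ‖a‖ * (‖b‖ * ‖ξ‖) := by
      gcongr
      exact (ContinuousLinearMap.le_opNorm _ _).trans (by gcongr)
    _ = _ := by ring

/-- All Hilbert space representations of the algebraic tensor product `A ⊙ B`. -/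
def tensorReps (A B : Type) [CStarAlgebra A] [NonUnitalCStarAlgebra B] : RepFamily (A ⊗[ℂ] B) where
  reps := Set.univ
  bdd := fun t => by
    induction t using TensorProduct.induction_on with
    | zero => exact ⟨0, fun ρ _ => by rw [map_zero, norm_zero]⟩
    | tmul a b => exact ⟨‖a‖ * ‖b‖, fun ρ _ => tmul_bdd ρ.π a b⟩
    | add f g hf hg =>
      obtain ⟨C, hC⟩ := hf
      obtain ⟨D, hD⟩ := hg
      refine ⟨C + D, fun ρ hρ => ?_⟩
      rw [map_add]
      exact (norm_add_le _ _).trans (add_le_add (hC ρ hρ) (hD ρ hρ))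

/-- The C*-tensor product `A ⊗ B`: the completion of the algebraic tensor product in the greatest
C*-norm. (It is only used for `B` the compact operators; since these are nuclear, there is only one
C*-norm on the algebraic tensor product.) -/
def CTensor (A B : Type) [CStarAlgebra A] [NonUnitalCStarAlgebra B] : Type :=
  Env (tensorReps A B)

instance (A B : Type) [CStarAlgebra A] [NonUnitalCStarAlgebra B] :
    NonUnitalCStarAlgebra (CTensor A B) :=
  inferInstanceAs (NonUnitalCStarAlgebra (Env (tensorReps A B)))

/-- Elementary tensors. -/
def CTensor.tmul {A B : Type} [CStarAlgebra A] [NonUnitalCStarAlgebra B] (a : A) (b : B) :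
    CTensor A B := Env.of (tensorReps A B) (a ⊗ₜ[ℂ] b)

end Tensor

section Compacts

/-- The Hilbert space `ℓ²(ℕ)`. -/
abbrev L2 : Type := lp (fun _ : ℕ => ℂ) 2

theorem isCompactOperator_star {H : Type} [NormedAddCommGroup H] [InnerProductSpace ℂ H]
    [CompleteSpace H] {T : H →L[ℂ] H} (hT : IsCompactOperator T) :
    IsCompactOperator (star T : H →L[ℂ] H) := by
  have h1 : IsCompactOperator (T ∘L (star T : H →L[ℂ] H)) := hT.comp_clm _
  refine (isCompactOperator_iff_isCompact_closure_image_closedBall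
    (star T : H →L[ℂ] H).toLinearMap one_pos).2 ?_
  have h2 := (isCompactOperator_iff_isCompact_closure_image_closedBall
    (T ∘L (star T : H →L[ℂ] H)).toLinearMap one_pos).1 h1
  refine TotallyBounded.isCompact_of_isClosed (TotallyBounded.closure ?_) isClosed_closure
  refine Metric.totallyBounded_of_finite_discretization fun ε hε => ?_
  obtain ⟨t, htf, ht⟩ :=
    Metric.totallyBounded_iff.1 (h2.totallyBounded.subset subset_closure) (ε ^ 2 / 8) (by positivity)
  have hx : ∀ y : ((star T : H →L[ℂ] H).toLinearMap '' Metric.closedBall (0 : H) 1),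
      ∃ x : H, ∃ c : t, ‖x‖ ≤ 1 ∧ (star T : H →L[ℂ] H) x = y ∧
        dist (T ((star T : H →L[ℂ] H) x)) c < ε ^ 2 / 8 := by
    rintro ⟨_, x, hx, rfl⟩
    obtain ⟨c, hc, hxc⟩ := Set.mem_iUnion₂.1 (ht ⟨x, hx, rfl⟩)
    exact ⟨x, ⟨c, hc⟩, by simpa using hx, rfl, hxc⟩
  choose f F hf1 hf2 hf3 using hx
  refine ⟨t, htf.fintype, F, fun y z hyz => ?_⟩
  rw [← hf2 y, ← hf2 z, dist_eq_norm, ← map_sub]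
  set w := f y - f z with hw
  have hw2 : ‖w‖ ≤ 2 := (norm_sub_le _ _).trans (by linarith [hf1 y, hf1 z])
  have h3 : ‖T ((star T : H →L[ℂ] H) w)‖ < ε ^ 2 / 4 := by
    have h4 := hf3 y
    rw [hyz] at h4
    have := dist_triangle_right (T ((star T : H →L[ℂ] H) (f y)))
      (T ((star T : H →L[ℂ] H) (f z))) (F z : H)
    rw [dist_eq_norm, ← map_sub, ← map_sub] at this
    linarith [hf3 z]
  have h5 : ‖(star T : H →L[ℂ] H) w‖ ^ 2 ≤ ‖T ((star T : H →L[ℂ] H) w)‖ * ‖w‖ := by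
    rw [← inner_self_eq_norm_sq (𝕜 := ℂ)]
    have : ⟪(star T : H →L[ℂ] H) w, (star T : H →L[ℂ] H) w⟫_ℂ =
        ⟪T ((star T : H →L[ℂ] H) w), w⟫_ℂ :=
      ContinuousLinearMap.adjoint_inner_right T _ _
    rw [this]
    exact (RCLike.re_le_norm _).trans (norm_inner_le_norm _ _)
  refine lt_of_pow_lt_pow_left₀ 2 hε.le ?_
  nlinarith [norm_nonneg (T ((star T : H →L[ℂ] H) w)), norm_nonneg w, sq_nonneg ε, pow_pos hε 2]

/-- The C*-algebra of compact operators on `ℓ²(ℕ)`. -/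
def Compacts : NonUnitalStarSubalgebra ℂ (L2 →L[ℂ] L2) where
  carrier := {T | IsCompactOperator T}
  add_mem' := fun hS hT => hS.add hT
  zero_mem' := isCompactOperator_zero
  mul_mem' := fun {_ T} hS _ => IsCompactOperator.comp_clm hS T
  smul_mem' := fun c _ hT => hT.smul c
  star_mem' := isCompactOperator_star

theorem isClosed_compacts : IsClosed (Compacts : Set (L2 →L[ℂ] L2)) :=
  isClosed_setOfPred_isCompactOperator

instance : NonUnitalCStarAlgebra Compacts :=
  NonUnitalStarSubalgebra.nonUnitalCStarAlgebra Compacts (h_closed := isClosed_compacts)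

/-- The standard orthonormal basis of `ℓ²(ℕ)`. -/
def basisVec (i : ℕ) : L2 := lp.single 2 i (1 : ℂ)

/-- The matrix unit `x_i = e_{i0}`, i.e. the rank one operator `ξ ↦ ⟨e_0, ξ⟩ e_i`. They satisfy
`x_i* x_j = δ_{ij} x_0` and generate the compact operators. -/
def matUnit (i : ℕ) : Compacts :=
  ⟨InnerProductSpace.rankOne ℂ (basisVec i) (basisVec 0), by
    change IsCompactOperator (InnerProductSpace.rankOne ℂ (basisVec i) (basisVec 0))
    rw [InnerProductSpace.rankOne_def']
    have h : IsCompactOperator (ContinuousLinearMap.toSpanSingleton ℂ (basisVec i)) :=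
      isCompactOperator_of_locallyCompactSpace_rng (ContinuousLinearMap.toSpanSingleton ℂ (basisVec i))
    exact h.comp_clm (innerSL ℂ (basisVec 0))⟩
end Compacts

section Presentations

/-- Names for the generators `u`, `v` of the free twist of two isometries. -/
inductive GenUV
  | u
  | v

/-- The number `λ = exp(2 π i θ)`. -/
def lam (θ : ℝ) : ℂ := Complex.exp (2 * Real.pi * Complex.I * θ)

/-- The relations `u* u = 1`, `v* v = 1`, `u v = λ v u`. -/
def relUV (θ : ℝ) : Set (FreeStar GenUV) :=
  {star (FreeStar.x GenUV.u) * FreeStar.x GenUV.u - 1,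
   star (FreeStar.x GenUV.v) * FreeStar.x GenUV.v - 1,
   FreeStar.x GenUV.u * FreeStar.x GenUV.v - lam θ • (FreeStar.x GenUV.v * FreeStar.x GenUV.u)}

/-- The pairs of operators on Hilbert spaces which satisfy these relations. -/
def repsUV (θ : ℝ) : RepFamily (FreeStar GenUV) where
  reps := relReps (relUV θ)
  bdd := relReps_bdd _ fun ρ hρ g => by
    refine norm_le_one_of_isometry ?_
    have : ρ.π (star (FreeStar.x g) * FreeStar.x g - 1) = 0 :=
      hρ.2 _ (by cases g <;> simp [relUV])
    rw [map_sub, map_mul, map_star, hρ.1, sub_eq_zero] at this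
    exact this

/-- The free twist of two isometries: the universal unital C*-algebra generated by two isometries
`u`, `v` with `u v = λ v u`. -/
def Afree (θ : ℝ) : Type := Env (repsUV θ)

instance (θ : ℝ) : CStarAlgebra (Afree θ) := inferInstanceAs (CStarAlgebra (Env (repsUV θ)))

/-- Names for the generators of `C(S¹) * ℂ²`. -/
inductive GenUP
  | u
  | p

/-- The relations `u* u = 1`, `u u* = 1`, `p* = p`, `p p = p`. -/
def relUP : Set (FreeStar GenUP) :=
  {star (FreeStar.x GenUP.u) * FreeStar.x GenUP.u - 1,
   FreeStar.x GenUP.u * star (FreeStar.x GenUP.u) - 1,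
   star (FreeStar.x GenUP.p) - FreeStar.x GenUP.p,
   FreeStar.x GenUP.p * FreeStar.x GenUP.p - FreeStar.x GenUP.p}

/-- The pairs of operators on Hilbert spaces which satisfy these relations. -/
def repsUP : RepFamily (FreeStar GenUP) where
  reps := relReps relUP
  bdd := relReps_bdd _ fun ρ hρ g => by
    cases g with
    | u =>
      refine norm_le_one_of_isometry ?_
      have : ρ.π (star (FreeStar.x GenUP.u) * FreeStar.x GenUP.u - 1) = 0 := hρ.2 _ (by simp [relUP])
      rw [map_sub, map_mul, map_star, hρ.1, sub_eq_zero] at this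
      exact this
    | p =>
      have h1 : ρ.π (star (FreeStar.x GenUP.p) - FreeStar.x GenUP.p) = 0 := hρ.2 _ (by simp [relUP])
      have h2 : ρ.π (FreeStar.x GenUP.p * FreeStar.x GenUP.p - FreeStar.x GenUP.p) = 0 :=
        hρ.2 _ (by simp [relUP])
      rw [map_sub, map_star, sub_eq_zero] at h1
      rw [map_sub, map_mul, sub_eq_zero] at h2
      exact norm_le_one_of_projection h1 h2

/-- The unital free product `C(S¹) * ℂ²`: the universal unital C*-algebra generated by a unitary
and a projection. -/
def Aup : Type := Env repsUP

instance : CStarAlgebra Aup := inferInstanceAs (CStarAlgebra (Env repsUP))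

end Presentations

section Elements

variable (θ : ℝ)

/-- The isometry `u`. -/
def genU : Afree θ := Env.of (repsUV θ) (FreeStar.x GenUV.u)

/-- The isometry `v`. -/
def genV : Afree θ := Env.of (repsUV θ) (FreeStar.x GenUV.v)

/-- The element `u (1 - v v*) + (1 - u u*) v*` of the free twist. -/
def uBar : Afree θ :=
  genU θ * (1 - genV θ * star (genV θ)) + (1 - genU θ * star (genU θ)) * star (genV θ)

/-- The element `v (1 - u u*) v*` of the free twist. -/
def pBar : Afree θ := genV θ * (1 - genU θ * star (genU θ)) * star (genV θ)

/-- The generating unitary of `C(S¹) * ℂ²`. -/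
def upU : Aup := Env.of repsUP (FreeStar.x GenUP.u)

/-- The generating projection of `C(S¹) * ℂ²`. -/
def upP : Aup := Env.of repsUP (FreeStar.x GenUP.p)

end Elements

section Ideals

/-- The closed two-sided ideal `⟨S⟩` generated by a subset `S` of a C*-algebra. -/
def closedIdeal {A : Type} [CStarAlgebra A] (S : Set A) : TwoSidedIdeal A :=
  sInf {I : TwoSidedIdeal A | IsClosed (I : Set A) ∧ S ⊆ I}

theorem closedIdeal_star_mem {A : Type} [CStarAlgebra A] {S : Set A}
    (hS : ∀ s ∈ S, star s = s) {a : A} (ha : a ∈ closedIdeal S) : star a ∈ closedIdeal S := by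
  rw [closedIdeal, TwoSidedIdeal.mem_sInf] at ha ⊢
  rintro I ⟨hIc, hIS⟩
  let I' : TwoSidedIdeal A := TwoSidedIdeal.mk' {x | star x ∈ I}
    (by simp [I.zero_mem])
    (fun {x y} hx hy => by simpa using I.add_mem hx hy)
    (fun {x} hx => by simpa using I.neg_mem hx)
    (fun {x y} hy => by simpa using I.mul_mem_right _ _ hy)
    (fun {x y} hx => by simpa using I.mul_mem_left _ _ hx)
  have hI' : ∀ x, x ∈ I' ↔ star x ∈ I := fun x => TwoSidedIdeal.mem_mk' _ _ _ _ _ _ x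
  refine (hI' a).1 (ha I' ⟨?_, fun s hs => ?_⟩)
  · have : (I' : Set A) = star ⁻¹' (I : Set A) := Set.ext hI'
    rw [this]
    exact hIc.preimage continuous_star
  · exact (hI' s).2 (by rw [hS s hs]; exact hIS hs)

/-- The defect ideal `J = ⟨1 - u u*, 1 - v v*⟩` of the free twist. -/
def defectTwoSided (θ : ℝ) : TwoSidedIdeal (Afree θ) :=
  closedIdeal {1 - genU θ * star (genU θ), 1 - genV θ * star (genV θ)}

/-- The defect ideal `J`, regarded as a star subalgebra of the free twist. -/
def defectIdeal (θ : ℝ) : NonUnitalStarSubalgebra ℂ (Afree θ) where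
  carrier := defectTwoSided θ
  add_mem' := fun hx hy => (defectTwoSided θ).add_mem hx hy
  zero_mem' := (defectTwoSided θ).zero_mem
  mul_mem' := fun {x y} _ hy => (defectTwoSided θ).mul_mem_left x y hy
  smul_mem' := fun c x hx => by
    have := (defectTwoSided θ).mul_mem_left (algebraMap ℂ (Afree θ) c) x hx
    rwa [← Algebra.smul_def] at this
  star_mem' := fun hx => closedIdeal_star_mem (by rintro s (rfl | rfl) <;> simp) hx

/-- The closed subspace `I ⊗ K` of `(C(S¹) * ℂ²) ⊗ K`, for an ideal `I` of `C(S¹) * ℂ²`. -/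
def idealTensor (I : TwoSidedIdeal Aup) : Submodule ℂ (CTensor Aup Compacts) :=
  (Submodule.span ℂ {t | ∃ a ∈ I, ∃ k : Compacts, t = CTensor.tmul a k}).topologicalClosure

/-- The isomorphism `J ≅ (C(S¹) * ℂ²) ⊗ K` given by `(uv)^i ū ↔ ū ⊗ x_i`, `(uv)^i p̄ ↔ p̄ ⊗ x_i`. -/
def IsCanonical {θ : ℝ} (Φ : defectIdeal θ ≃⋆ₐ[ℂ] CTensor Aup Compacts) : Prop :=
  ∀ i : ℕ,
    (Φ.symm (CTensor.tmul upU (matUnit i)) : Afree θ) = (genU θ * genV θ) ^ i * uBar θ ∧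
    (Φ.symm (CTensor.tmul upP (matUnit i)) : Afree θ) = (genU θ * genV θ) ^ i * pBar θ

/-- An ideal `I` of the free twist corresponds to an ideal `I'` of `C(S¹) * ℂ²` under
`Φ : J ≅ (C(S¹) * ℂ²) ⊗ K` if `I` is contained in `J` and `Φ` maps `I` onto `I' ⊗ K`. -/
def Corresponds {θ : ℝ} (Φ : defectIdeal θ ≃⋆ₐ[ℂ] CTensor Aup Compacts)
    (I : TwoSidedIdeal (Afree θ)) (I' : TwoSidedIdeal Aup) : Prop :=
  (∀ x ∈ I, x ∈ defectIdeal θ) ∧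
    ∀ x : defectIdeal θ, (x : Afree θ) ∈ I ↔ Φ x ∈ idealTensor I'

end Ideals

end

end FreeTwist

open FreeTwist

namespace FreeTwist
noncomputable section

/-! ### Closed ideals of C*-algebras -/

section ClosedIdeals

variable {A : Type} [CStarAlgebra A]

/-! Put w = uv and P = 1 - ww*. As uv = λvu with |λ| = 1, the projection P splits in two ways: P =
(1-uu*) + u(1-vv*)u* and P = (1-vv*) + v(1-uu*)v*. The element ū = u(1-vv*) + (1-uu*)v* carries the
summands of the second splitting onto those of the first (in the opposite order), so it is a unitary
of PAP, and p̄ = v(1-uu*)v* is a projection of PAP. The universal property of B gives a homomorphism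
`corner` from B to PAP. Since w* annihilates its image, the elements w^i corner(b) w*^j multiply
like b ⊗ e_ij, and they assemble to `canon` from B ⊗ K to A.

Injectivity of `canon` reduces to that of `corner` by looking at matrix entries
(`Stabilizing.matrixHom_injective`). For `corner`, take a unitary U and a projection p on H and put
a = U(1-p), b = Up. The operators ∑ λ^i (a ⊗ e_{i,i} + b ⊗ e_{i+1,i}) and ∑ λ̄^i (b* ⊗ e_{i,i} + λ̄
a* ⊗ e_{i+1,i}) on ℓ²(ℕ, H) are twisted isometries whose product is the shift, and their ū and p̄
act on the zeroth coordinate as U and p. Every representation of B is thus seen inside a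
representation of A (`norm_rep_le_norm_corner`).

The generators u, v commute with w up to scalars, uP and vP have the form c + wc' with c, c' in the
image of `corner`, u*P and v*P lie in that image, and u*w = v, v*w = λu. Hence `canon` maps I ⊗ K
onto a closed two-sided ideal of A for every ideal I of B, and comparing ideals becomes comparing
generators (`closedIdeal_eq_imageIdeal`). The choice I = B shows that the range of `canon` is J.

The rest is read off in B, through `corner`: 1-uu* = ūp̄ū*, 1-vv* = 1-p̄, u*v - λ̄vu* = (1-p̄)ū*p̄ū*
and (1-uu*)(1-vv*) = ūp̄ū*(1-p̄). Up to adjoints and unitary factors these are the stated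
generators, and closed ideals are self-adjoint (`star_mem_of_isClosed`). The commutator of ū and p̄
is the difference of the two off-diagonal blocks of ū relative to p̄, whence (c). Finally, ū ⊗ x_i
and p̄ ⊗ x_i generate B ⊗ K, so every admissible Φ is the inverse of `canon` (`starHom_ext`). -/

theorem isClosed_closedIdeal (S : Set A) : IsClosed (closedIdeal S : Set A) := by
  have : (closedIdeal S : Set A) =
      ⋂ I ∈ {I : TwoSidedIdeal A | IsClosed (I : Set A) ∧ S ⊆ I}, (I : Set A) := by
    ext x
    simp only [closedIdeal, SetLike.mem_coe, TwoSidedIdeal.mem_sInf, Set.mem_iInter]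
  rw [this]
  exact isClosed_biInter fun I hI => hI.1

theorem subset_closedIdeal (S : Set A) : S ⊆ (closedIdeal S : Set A) := fun s hs => by
  simp only [closedIdeal, SetLike.mem_coe, TwoSidedIdeal.mem_sInf]
  exact fun I hI => hI.2 hs

theorem closedIdeal_le {S : Set A} {I : TwoSidedIdeal A} (hc : IsClosed (I : Set A))
    (hS : S ⊆ I) : closedIdeal S ≤ I :=
  sInf_le ⟨hc, hS⟩

theorem ideal_smul_mem (I : TwoSidedIdeal A) (c : ℂ) {x : A} (hx : x ∈ I) : c • x ∈ I := by
  have := I.mul_mem_left (algebraMap ℂ A c) x hx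
  rwa [← Algebra.smul_def] at this

/-- A closed two-sided ideal of a C*-algebra is closed under the involution. -/
theorem star_mem_of_isClosed (I : TwoSidedIdeal A) (hI : IsClosed (I : Set A)) {x : A}
    (hx : x ∈ I) : star x ∈ I := by
  let _ := CStarAlgebra.spectralOrder A
  let _ := CStarAlgebra.spectralOrderedRing A
  -- With y = xx*, the elements x* y (y+ε)⁻¹ lie in the ideal and tend to x* as ε → 0; the error is
  -- x*d with d = 1 - y(y+ε)⁻¹ = ε(y+ε)⁻¹.
  set y := x * star x with hy
  have hy0 : 0 ≤ y := mul_star_self_nonneg x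
  have hsa : IsSelfAdjoint y := IsSelfAdjoint.of_nonneg hy0
  refine hI.closure_subset_iff.2 subset_rfl (Metric.mem_closure_iff.2 fun δ hδ => ?_)
  obtain ⟨ε, hε, hεδ⟩ : ∃ ε : ℝ, 0 < ε ∧ ε < δ ^ 2 :=
    ⟨δ ^ 2 / 2, by positivity, by linarith [pow_pos hδ 2]⟩
  have hspec : ∀ t ∈ spectrum ℝ y, 0 ≤ t := fun t ht => spectrum_nonneg_of_nonneg hy0 ht
  have hcont : ContinuousOn (fun t : ℝ => (t + ε)⁻¹) (spectrum ℝ y) :=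
    ContinuousOn.inv₀ (by fun_prop) fun t ht => by linarith [hspec t ht]
  set z := cfc (fun t : ℝ => (t + ε)⁻¹) y with hz
  have hyz : y * z = cfc (fun t : ℝ => t * (t + ε)⁻¹) y := by
    rw [cfc_mul (fun t : ℝ => t) _ y (by fun_prop) hcont, cfc_id' ℝ y]
  refine ⟨star x * (y * z), I.mul_mem_left _ _ (I.mul_mem_right _ _ (I.mul_mem_right _ _ hx)), ?_⟩
  set d := cfc (fun t : ℝ => 1 - t * (t + ε)⁻¹) y with hd
  have hcont' : ContinuousOn (fun t : ℝ => t * (t + ε)⁻¹) (spectrum ℝ y) := by fun_prop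
  have hd1 : 1 - y * z = d := by
    rw [hyz, hd, cfc_sub (fun _ => (1 : ℝ)) _ y (by fun_prop) hcont', cfc_const_one ℝ y]
  have hds : star d = d := (cfc_predicate _ y : IsSelfAdjoint d)
  have e : star x - star x * (y * z) = star x * d := by rw [← hd1, mul_sub, mul_one]
  rw [dist_eq_norm, e]
  -- By the C*-identity the square of the error is the norm of d y d, the function ε² t/(t+ε)² of y,
  -- which is at most ε for t ≥ 0.
  have hn : ‖star x * d‖ * ‖star x * d‖ ≤ ε := by
    have hcd : ContinuousOn (fun t : ℝ => 1 - t * (t + ε)⁻¹) (spectrum ℝ y) := by fun_prop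
    rw [← CStarRing.norm_star_mul_self, star_mul, star_star, hds]
    have : d * x * (star x * d) =
        cfc (fun t : ℝ => (1 - t * (t + ε)⁻¹) * (t * (1 - t * (t + ε)⁻¹))) y := by
      rw [cfc_mul _ (fun t : ℝ => t * (1 - t * (t + ε)⁻¹)) y hcd (by fun_prop),
        cfc_mul (fun t : ℝ => t) _ y (by fun_prop) hcd, cfc_id' ℝ y, ← hd]
      simp only [hy, mul_assoc]
    rw [this]
    refine norm_cfc_le hε.le fun t ht => ?_
    have h0 := hspec t ht
    have hp : 0 < t + ε := by linarith
    have e1 : 1 - t * (t + ε)⁻¹ = ε * (t + ε)⁻¹ := by field_simp; ring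
    have h1 : ε * (t + ε)⁻¹ ≤ 1 := by
      rw [← div_eq_mul_inv, div_le_one hp]; linarith
    have h2 : t * (t + ε)⁻¹ ≤ 1 := by
      rw [← div_eq_mul_inv, div_le_one hp]; linarith
    have h3 : 0 ≤ (t + ε)⁻¹ := by positivity
    rw [e1, Real.norm_of_nonneg (by positivity)]
    calc ε * (t + ε)⁻¹ * (t * (ε * (t + ε)⁻¹))
        = (ε * (t + ε)⁻¹) * (t * (t + ε)⁻¹) * ε := by ring
      _ ≤ 1 * 1 * ε := by gcongr
      _ = ε := by ring
  nlinarith [norm_nonneg (star x * d)]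

end ClosedIdeals

/-! ### Universal property of enveloping C*-algebras -/

section EnvLift

variable {R : Type} [NonUnitalRing R] [StarRing R] [Module ℂ R]
  (F : RepFamily R) {D : Type} [NonUnitalCStarAlgebra D]

/-- A star homomorphism dominated by the C*-seminorm, as a bounded linear map on `Pre F`. -/
def Env.preLift (f : R →⋆ₙₐ[ℂ] D) (h : ∀ x, ‖f x‖ ≤ F.sup x) : Pre F →L[ℂ] D :=
  LinearMap.mkContinuous
    { toFun := fun x : Pre F => f (show R from x)
      map_add' := fun x y => map_add f (show R from x) (show R from y)
      map_smul' := fun c x => map_smul f c (show R from x) } 1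
    (fun x => by rw [one_mul]; exact h x)

/-- The extension of `f` to the enveloping C*-algebra as a function. -/
def Env.liftFun (f : R →⋆ₙₐ[ℂ] D) (h : ∀ x, ‖f x‖ ≤ F.sup x) : Env F → D :=
  UniformSpace.Completion.extension (Env.preLift F f h)

theorem Env.continuous_liftFun (f : R →⋆ₙₐ[ℂ] D) (h : ∀ x, ‖f x‖ ≤ F.sup x) :
    Continuous (Env.liftFun F f h) :=
  UniformSpace.Completion.continuous_extension

theorem Env.liftFun_of (f : R →⋆ₙₐ[ℂ] D) (h : ∀ x, ‖f x‖ ≤ F.sup x) (x : R) :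
    Env.liftFun F f h (Env.of F x) = f x :=
  UniformSpace.Completion.extension_coe (Env.preLift F f h).uniformContinuous (show Pre F from x)

/-- Extension of a star homomorphism dominated by the C*-seminorm to the enveloping C*-algebra. -/
def Env.lift (f : R →⋆ₙₐ[ℂ] D) (h : ∀ x, ‖f x‖ ≤ F.sup x) : Env F →⋆ₙₐ[ℂ] D where
  toFun := Env.liftFun F f h
  map_smul' c x := Env.ind F (p := fun x => Env.liftFun F f h (c • x) = c • Env.liftFun F f h x)
    (isClosed_eq ((continuous_liftFun F f h).comp (continuous_const_smul c))
      ((continuous_liftFun F f h).const_smul c))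
    (fun a => by rw [← of_smul, liftFun_of, liftFun_of, map_smul]) x
  map_zero' := by rw [← of_zero, liftFun_of, map_zero]
  map_add' := Env.ind₂ F
    (isClosed_eq ((continuous_liftFun F f h).comp (continuous_fst.add continuous_snd))
      (((continuous_liftFun F f h).comp continuous_fst).add
        ((continuous_liftFun F f h).comp continuous_snd)))
    (fun a b => by rw [← of_add, liftFun_of, liftFun_of, liftFun_of, map_add])
  map_mul' := Env.ind₂ F
    (isClosed_eq ((continuous_liftFun F f h).comp (continuous_fst.mul continuous_snd))
      (((continuous_liftFun F f h).comp continuous_fst).mul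
        ((continuous_liftFun F f h).comp continuous_snd)))
    (fun a b => by rw [← of_mul, liftFun_of, liftFun_of, liftFun_of, map_mul])
  map_star' := Env.ind F
    (isClosed_eq ((continuous_liftFun F f h).comp continuous_star)
      (continuous_liftFun F f h).star)
    (fun a => by rw [← of_star, liftFun_of, liftFun_of, map_star])

@[simp]
theorem Env.lift_of (f : R →⋆ₙₐ[ℂ] D) (h : ∀ x, ‖f x‖ ≤ F.sup x) (x : R) :
    Env.lift F f h (Env.of F x) = f x := Env.liftFun_of F f h x

/-- The extension of a representation in the family. -/
def Env.rep {ρ : Rep R} (h : ρ ∈ F.reps) : Env F →⋆ₙₐ[ℂ] (ρ.H →L[ℂ] ρ.H) :=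
  Env.lift F ρ.π (F.le_sup h)

@[simp]
theorem Env.rep_of {ρ : Rep R} (h : ρ ∈ F.reps) (x : R) : Env.rep F h (Env.of F x) = ρ.π x :=
  Env.lift_of F _ _ x

variable [IsScalarTower ℂ R R] [SMulCommClass ℂ R R] [StarModule ℂ R]

/-- On the dense image of `R` the norm is a supremum over the family by construction. The extended
representations are contractive, so the bound survives approximation. Hence the norm is controlled
by representations already at hand. -/
theorem Env.norm_le_of_rep (a : Env F) {C : ℝ} (hC : 0 ≤ C)
    (h : ∀ (ρ : Rep R) (hρ : ρ ∈ F.reps), ‖Env.rep F hρ a‖ ≤ C) : ‖a‖ ≤ C := by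
  refine le_of_forall_pos_le_add fun ε hε => ?_
  obtain ⟨x, hx⟩ : ∃ x : R, ‖a - Env.of F x‖ ≤ ε / 2 := by
    have hd : a ∈ closure (Set.range (Env.of F)) :=
      Env.ind F (p := (· ∈ closure (Set.range (Env.of F)))) isClosed_closure
        (fun x => subset_closure ⟨x, rfl⟩) a
    obtain ⟨_, ⟨x, rfl⟩, hx⟩ := Metric.mem_closure_iff.1 hd (ε / 2) (by positivity)
    exact ⟨x, by rw [← dist_eq_norm]; exact hx.le⟩
  have h1 : ‖Env.of F x‖ ≤ C + ε / 2 := by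
    rw [Env.norm_of]
    refine F.sup_le (by positivity) fun ρ hρ => ?_
    rw [← Env.rep_of F hρ]
    have e : Env.rep F hρ (Env.of F x) = Env.rep F hρ a - Env.rep F hρ (a - Env.of F x) := by
      rw [map_sub, sub_sub_cancel]
    rw [e]
    have := NonUnitalStarAlgHom.norm_apply_le (Env.rep F hρ) (a - Env.of F x)
    linarith [norm_sub_le (Env.rep F hρ a) (Env.rep F hρ (a - Env.of F x)), h ρ hρ]
  have h2 : ‖a‖ ≤ ‖a - Env.of F x‖ + ‖Env.of F x‖ := by
    simpa using norm_add_le (a - Env.of F x) (Env.of F x)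
  linarith

end EnvLift

/-! ### Universal property of the free star algebra -/

section FreeStarLift

variable {G : Type} {D : Type} [Ring D] [StarRing D]

/-- The monoid homomorphism underlying the universal property of the free star algebra. -/
def FreeStar.liftMon (d : G → D) : FreeMonoid (G × Bool) →* D :=
  FreeMonoid.lift fun y => if y.2 then star (d y.1) else d y.1

theorem FreeStar.liftMon_revHom (d : G → D) (w : FreeMonoid (G × Bool)) :
    FreeStar.liftMon d (StarPoly.revHom w).unop = star (FreeStar.liftMon d w) := by
  induction w using FreeMonoid.inductionOn' with
  | one => simp
  | of_mul y w ih =>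
    rw [map_mul, MulOpposite.unop_mul, map_mul, ih, map_mul, star_mul]
    obtain ⟨g, b⟩ := y
    cases b <;> simp [StarPoly.revHom, FreeStar.liftMon]

variable [Algebra ℂ D]

/-- The universal property of the free star algebra, as an algebra homomorphism. -/
def FreeStar.liftAlg (d : G → D) : FreeStar G →ₐ[ℂ] D :=
  show StarPoly G →ₐ[ℂ] D from MonoidAlgebra.lift ℂ D _ (FreeStar.liftMon d)

theorem FreeStar.liftAlg_single (d : G → D) (w : FreeMonoid (G × Bool)) (c : ℂ) :
    FreeStar.liftAlg d (MonoidAlgebra.single w c : StarPoly G) = c • FreeStar.liftMon d w :=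
  MonoidAlgebra.lift_single _ _ _

variable [StarModule ℂ D]

theorem FreeStar.liftAlg_star (d : G → D) (a : FreeStar G) :
    FreeStar.liftAlg d (star a) = star (FreeStar.liftAlg d a) := by
  induction (show StarPoly G from a) using MonoidAlgebra.induction_linear with
  | zero => exact (congrArg _ (star_zero (FreeStar G))).trans (by
      rw [map_zero (FreeStar.liftAlg d)]
      exact ((congrArg star (map_zero (FreeStar.liftAlg d))).trans (star_zero D)).symm)
  | add f g hf hg =>
    have e := (congrArg (FreeStar.liftAlg d) (star_add (R := FreeStar G) f g)).trans
      (map_add (FreeStar.liftAlg d) (star (show FreeStar G from f)) (star (show FreeStar G from g)))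
    refine e.trans ?_
    have e2 := congrArg star (map_add (FreeStar.liftAlg d) (show FreeStar G from f) g)
    rw [star_add] at e2
    exact (congrArg₂ (· + ·) hf hg).trans e2.symm
  | single w c =>
    have e := congrArg (FreeStar.liftAlg d) (StarPoly.star_single w c)
    refine e.trans ?_
    rw [FreeStar.liftAlg_single, FreeStar.liftAlg_single, FreeStar.liftMon_revHom, star_smul]
    rfl

/-- The universal property of the free star algebra. -/
def FreeStar.lift (d : G → D) : FreeStar G →⋆ₐ[ℂ] D :=
  { FreeStar.liftAlg d with map_star' := FreeStar.liftAlg_star d }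

@[simp]
theorem FreeStar.lift_x (d : G → D) (g : G) : FreeStar.lift d (FreeStar.x g) = d g := by
  refine (FreeStar.liftAlg_single d _ 1).trans ?_
  simp [FreeStar.liftMon]

end FreeStarLift

/-! ### Algebra of two twisted isometries and the corner cut out by `P = 1 - (uv)(uv)*` -/

section TwistPairs

variable {A : Type} [CStarAlgebra A]

/-- Two isometries `u`, `v` with `u v = l v u`, where `l` is a complex number of modulus one. -/
structure TwistPair (u v : A) (l : ℂ) : Prop where
  isom_u : star u * u = 1
  isom_v : star v * v = 1
  comm : u * v = l • (v * u)
  conj_mul : starRingEnd ℂ l * l = 1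

/-- The defect projection `1 - u u*` of an isometry. -/
def defect (u : A) : A := 1 - u * star u

/-- The element `u (1 - v v*) + (1 - u u*) v*`. -/
def cornerU (u v : A) : A := u * defect v + defect u * star v

/-- The element `v (1 - u u*) v*`. -/
def cornerP (u v : A) : A := v * defect u * star v

theorem star_defect (u : A) : star (defect u) = defect u := by simp [defect]

theorem defect_mul {u : A} (h : star u * u = 1) : defect u * u = 0 := by
  rw [defect, sub_mul, mul_assoc, h]; simp

theorem star_mul_defect {u : A} (h : star u * u = 1) : star u * defect u = 0 := by
  rw [defect, mul_sub, ← mul_assoc, h]; simp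

theorem defect_mul_defect {u : A} (h : star u * u = 1) : defect u * defect u = defect u := by
  conv_lhs => rw [defect.eq_def, mul_sub, ← mul_assoc, ← defect.eq_def, defect_mul h]
  simp

theorem star_cornerP (u v : A) : star (cornerP u v) = cornerP u v := by
  simp [cornerP, star_defect, mul_assoc]

theorem star_cornerU (u v : A) :
    star (cornerU u v) = defect v * star u + v * defect u := by
  simp [cornerU, star_defect]

/-- First splitting of P: the gap between uu* and uvv*u* is u(1-vv*)u*. It needs no relation between
u and v. -/
theorem defect_prod_eq (u v : A) : defect (u * v) = defect u + u * defect v * star u := by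
  simp only [defect, star_mul]; noncomm_ring

namespace TwistPair

variable {u v : A} {l : ℂ} (h : TwistPair u v l)
include h

theorem mul_conj : l * starRingEnd ℂ l = 1 := by rw [mul_comm]; exact h.conj_mul

theorem comm' : v * u = starRingEnd ℂ l • (u * v) := by
  rw [h.comm, smul_smul, h.conj_mul, one_smul]

theorem comm_star : star v * star u = starRingEnd ℂ l • (star u * star v) := by
  have := congrArg star h.comm
  simpa using this

theorem isom_mul : star (u * v) * (u * v) = 1 := by
  rw [star_mul, mul_assoc, ← mul_assoc (star u), h.isom_u, one_mul, h.isom_v]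

/-- Second splitting of P: since λ has modulus one, uv and vu have the same range projection, so the
roles of u and v may be exchanged. In the corner, p̄ is therefore the complement of 1-vv*. -/
theorem defect_mul_eq' : defect (u * v) = defect v + cornerP u v := by
  have e : u * v * star (u * v) = v * u * (star u * star v) := by
    rw [h.comm, star_smul, smul_mul_smul_comm, Complex.star_def, h.mul_conj, one_smul, star_mul]
  rw [defect, e]
  simp only [defect, cornerP]; noncomm_ring

/-- The two terms of ū are partial isometries with source projections 1-vv* and p̄. This lemma and
the next recover them by restricting ū to these summands of P. -/
theorem cornerU_mul_defect : cornerU u v * defect v = u * defect v := by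
  rw [cornerU, add_mul, mul_assoc, defect_mul_defect h.isom_v, mul_assoc,
    star_mul_defect h.isom_v, mul_zero, add_zero]

theorem cornerU_mul_cornerP : cornerU u v * cornerP u v = defect u * star v := by
  have e : cornerU u v * v = defect u := by
    rw [cornerU, add_mul, mul_assoc, defect_mul h.isom_v, mul_zero, zero_add, mul_assoc,
      h.isom_v, mul_one]
  rw [cornerP, ← mul_assoc, ← mul_assoc, e, defect_mul_defect h.isom_u]

theorem defect_mul_star_cornerU : defect v * star (cornerU u v) = defect v * star u := by
  have := congrArg star h.cornerU_mul_defect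
  simpa [star_defect] using this

theorem cornerP_mul_star_cornerU : cornerP u v * star (cornerU u v) = v * defect u := by
  have := congrArg star h.cornerU_mul_cornerP
  simpa [star_defect, star_cornerP] using this

theorem cornerP_mul_cornerP : cornerP u v * cornerP u v = cornerP u v := by
  have e : cornerP u v * v = v * defect u := by
    rw [cornerP, mul_assoc, h.isom_v, mul_one]
  conv_lhs => rw [cornerP.eq_1 u v, ← mul_assoc, ← mul_assoc, ← cornerP.eq_1 u v, e, mul_assoc v,
    defect_mul_defect h.isom_u]
  rfl

theorem defect_mul_cornerP : defect v * cornerP u v = 0 := by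
  rw [cornerP, ← mul_assoc, ← mul_assoc, defect_mul h.isom_v, zero_mul, zero_mul]

theorem cornerP_mul_defect : cornerP u v * defect v = 0 := by
  rw [cornerP, mul_assoc, star_mul_defect h.isom_v, mul_zero]

theorem unit_mul_cornerP : defect (u * v) * cornerP u v = cornerP u v := by
  rw [h.defect_mul_eq', add_mul, h.defect_mul_cornerP, h.cornerP_mul_cornerP, zero_add]

theorem cornerP_mul_unit : cornerP u v * defect (u * v) = cornerP u v := by
  rw [h.defect_mul_eq', mul_add, h.cornerP_mul_defect, h.cornerP_mul_cornerP, zero_add]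

theorem cornerU_mul_unit : cornerU u v * defect (u * v) = cornerU u v := by
  rw [h.defect_mul_eq', mul_add, h.cornerU_mul_defect, h.cornerU_mul_cornerP]; rfl

theorem unit_mul_cornerU : defect (u * v) * cornerU u v = cornerU u v := by
  rw [defect_prod_eq, add_mul]
  have e1 : defect u * cornerU u v = defect u * star v := by
    rw [cornerU, mul_add, ← mul_assoc, defect_mul h.isom_u, zero_mul, zero_add, ← mul_assoc,
      defect_mul_defect h.isom_u]
  have e2 : star u * cornerU u v = defect v := by
    rw [cornerU, mul_add, ← mul_assoc, h.isom_u, one_mul, ← mul_assoc,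
      star_mul_defect h.isom_u, zero_mul, add_zero]
  rw [e1, mul_assoc, e2, mul_assoc, defect_mul_defect h.isom_v, add_comm]; rfl

/-- The source projections of the two terms of ū add up to P by the second splitting, and their
range projections u(1-vv*)u* and 1-uu* add up to P by the first. Hence ū is a unitary of PAP. -/
theorem star_cornerU_mul_cornerU : star (cornerU u v) * cornerU u v = defect (u * v) := by
  have e1 : star u * cornerU u v = defect v := by
    rw [cornerU, mul_add, ← mul_assoc, h.isom_u, one_mul, ← mul_assoc,
      star_mul_defect h.isom_u, zero_mul, add_zero]
  have e2 : defect u * cornerU u v = defect u * star v := by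
    rw [cornerU, mul_add, ← mul_assoc, defect_mul h.isom_u, zero_mul, zero_add, ← mul_assoc,
      defect_mul_defect h.isom_u]
  rw [star_cornerU, add_mul, mul_assoc, e1, mul_assoc v, e2, defect_mul_defect h.isom_v,
    h.defect_mul_eq', ← mul_assoc]; rfl

theorem cornerU_mul_star_cornerU : cornerU u v * star (cornerU u v) = defect (u * v) := by
  conv_lhs => rw [star_cornerU, mul_add, ← mul_assoc, h.cornerU_mul_defect]
  rw [defect_prod_eq, cornerU, add_mul, ← mul_assoc, mul_assoc u (defect v) v,
    defect_mul h.isom_v, mul_zero, zero_mul, zero_add, ← mul_assoc, mul_assoc (defect u) (star v),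
    h.isom_v, mul_one, defect_mul_defect h.isom_u, add_comm]

/-- Conjugation by ū moves p̄ to the range projection of (1-uu*)v*. -/
theorem defect_u_eq : defect u = cornerU u v * cornerP u v * star (cornerU u v) := by
  rw [mul_assoc, h.cornerP_mul_star_cornerU, cornerU, add_mul, mul_assoc, ← mul_assoc (defect v),
    defect_mul h.isom_v, zero_mul, mul_zero, zero_add, mul_assoc, ← mul_assoc (star v), h.isom_v,
    one_mul, defect_mul_defect h.isom_u]

theorem defect_v_eq : defect v = defect (u * v) - cornerP u v := by
  rw [h.defect_mul_eq', add_sub_cancel_right]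

/-- The relation uv = λvu forces v*c = 0 and cu = 0 for c = u*v - λ̄vu*. Compressing to 1-vv* on the
left and 1-uu* on the right changes nothing and removes the term vu*, so c = (1-vv*)u* · v(1-uu*), a
product of two corner elements. -/
theorem commutator_eq : star u * v - starRingEnd ℂ l • (v * star u) =
    defect v * star (cornerU u v) * (cornerP u v * star (cornerU u v)) := by
  have e1 : star v * star u * v = starRingEnd ℂ l • star u := by
    rw [h.comm_star, smul_mul_assoc, mul_assoc, h.isom_v, mul_one]
  have e2 : star u * v * u = starRingEnd ℂ l • v := by
    rw [mul_assoc, h.comm', mul_smul_comm, ← mul_assoc, h.isom_u, one_mul]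
  rw [h.defect_mul_star_cornerU, h.cornerP_mul_star_cornerU]
  have e3 : defect v * star u * v = star u * v - starRingEnd ℂ l • (v * star u) := by
    rw [defect, sub_mul, sub_mul, one_mul, mul_assoc v, mul_assoc v, e1, mul_smul_comm]
  have e4 : star u * v * defect u = star u * v - starRingEnd ℂ l • (v * star u) := by
    rw [defect, mul_sub, mul_one, ← mul_assoc, e2, smul_mul_assoc]
  have e5 : star u * defect u = 0 := star_mul_defect h.isom_u
  rw [← mul_assoc, e3, sub_mul, e4, smul_mul_assoc, mul_assoc v, e5, mul_zero, smul_zero, sub_zero]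

/-- Multiply the second splitting of P by u: the summand 1-vv* stays in the corner, while p̄ is sent
to uv(1-uu*)v*, one power of w further. The formulas for v, u*, v* arise from whichever splitting
suits; together they make the image of B ⊗ K an ideal. -/
theorem u_mul_unit : u * defect (u * v) =
    cornerU u v * defect v + u * v * (cornerU u v * cornerP u v) := by
  rw [h.cornerU_mul_defect, h.cornerU_mul_cornerP, h.defect_mul_eq', mul_add, cornerP]
  simp only [mul_assoc]

theorem v_mul_unit : v * defect (u * v) =
    cornerP u v * star (cornerU u v) +
      starRingEnd ℂ l • (u * v * (defect v * star (cornerU u v))) := by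
  rw [h.cornerP_mul_star_cornerU, h.defect_mul_star_cornerU, defect_prod_eq, mul_add,
    ← smul_mul_assoc, ← h.comm']
  simp only [mul_assoc]

theorem star_u_mul_unit : star u * defect (u * v) = defect v * star (cornerU u v) := by
  rw [h.defect_mul_star_cornerU, defect_prod_eq, mul_add, star_mul_defect h.isom_u, zero_add,
    ← mul_assoc, ← mul_assoc, h.isom_u, one_mul]

theorem star_v_mul_unit : star v * defect (u * v) = cornerU u v * cornerP u v := by
  rw [h.cornerU_mul_cornerP, h.defect_mul_eq', mul_add, star_mul_defect h.isom_v, zero_add,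
    cornerP, ← mul_assoc, ← mul_assoc, h.isom_v, one_mul]

theorem star_u_mul : star u * (u * v) = v := by rw [← mul_assoc, h.isom_u, one_mul]

theorem star_v_mul : star v * (u * v) = l • u := by
  rw [h.comm, mul_smul_comm, ← mul_assoc, h.isom_v, one_mul]

theorem u_mul_pow (i : ℕ) : u * (u * v) ^ i = l ^ i • ((u * v) ^ i * u) := by
  have h1 : u * (u * v) = l • (u * v * u) := by
    conv_lhs => rw [h.comm, mul_smul_comm]
    rw [mul_assoc]
  induction i with
  | zero => simp
  | succ i ih =>
    rw [pow_succ, ← mul_assoc, ih, smul_mul_assoc, mul_assoc _ u, h1, mul_smul_comm, smul_smul,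
      pow_succ]
    simp only [mul_assoc]

theorem v_mul_pow (i : ℕ) :
    v * (u * v) ^ i = starRingEnd ℂ l ^ i • ((u * v) ^ i * v) := by
  have h1 : v * (u * v) = starRingEnd ℂ l • (u * v * v) := by
    rw [← mul_assoc, h.comm', smul_mul_assoc]
  induction i with
  | zero => simp
  | succ i ih =>
    rw [pow_succ, ← mul_assoc, ih, smul_mul_assoc, mul_assoc _ v, h1, mul_smul_comm, smul_smul,
      pow_succ]
    simp only [mul_assoc]

/-- The universal property of B yields unital maps, but the unit P of the corner is not 1. Therefore
ū is completed by 1-P, which is `defect P` because P is a projection; the extra summand is cut off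
again in `cornerMap`. -/
theorem unitary_star_mul : star (cornerU u v + defect (defect (u * v))) *
    (cornerU u v + defect (defect (u * v))) = 1 := by
  set P := defect (u * v) with hP
  have hPs : star P = P := star_defect _
  have hPP : P * P = P := defect_mul_defect h.isom_mul
  have hd : defect P = 1 - P := by rw [defect, hPs, hPP]
  have a : star (cornerU u v) * (1 - P) = 0 := by
    have := congrArg star h.unit_mul_cornerU
    rw [star_mul, ← hP, hPs] at this
    rw [mul_sub, mul_one, this, sub_self]
  have b : (1 - P) * cornerU u v = 0 := by rw [sub_mul, one_mul, h.unit_mul_cornerU, sub_self]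
  have c : (1 - P) * (1 - P) = 1 - P := by rw [mul_sub, mul_one, sub_mul, one_mul, hPP]; simp
  rw [hd, star_add, star_sub, star_one, hPs, mul_add, add_mul, add_mul,
    h.star_cornerU_mul_cornerU, a, b, c]
  simp [hP]

theorem unitary_mul_star : (cornerU u v + defect (defect (u * v))) *
    star (cornerU u v + defect (defect (u * v))) = 1 := by
  set P := defect (u * v) with hP
  have hPs : star P = P := star_defect _
  have hPP : P * P = P := defect_mul_defect h.isom_mul
  have hd : defect P = 1 - P := by rw [defect, hPs, hPP]
  have a : (1 - P) * star (cornerU u v) = 0 := by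
    have := congrArg star h.cornerU_mul_unit
    rw [star_mul, ← hP, hPs] at this
    rw [sub_mul, one_mul, this, sub_self]
  have b : cornerU u v * (1 - P) = 0 := by rw [mul_sub, mul_one, h.cornerU_mul_unit, sub_self]
  have c : (1 - P) * (1 - P) = 1 - P := by rw [mul_sub, mul_one, sub_mul, one_mul, hPP]; simp
  rw [hd, star_add, star_sub, star_one, hPs, mul_add, add_mul, add_mul,
    h.cornerU_mul_star_cornerU, a, b, c]
  simp [hP]

end TwistPair

end TwistPairs

/-! ### Matrix units and approximation of compact operators on ℓ²(ℕ) -/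

section MatrixUnits

open Filter Topology InnerProductSpace

theorem clm_mul_apply {H : Type} [NormedAddCommGroup H] [InnerProductSpace ℂ H]
    (S T : H →L[ℂ] H) (x : H) : (S * T) x = S (T x) := rfl

/-- The matrix unit `e_{ij}` on `ℓ²(ℕ)`. -/
def unitOp (i j : ℕ) : L2 →L[ℂ] L2 := rankOne ℂ (basisVec i) (basisVec j)

/-- The matrix coefficients of an operator on `ℓ²(ℕ)`. -/
def entry (T : L2 →L[ℂ] L2) (i j : ℕ) : ℂ := ⟪basisVec i, T (basisVec j)⟫_ℂ

/-- The projection onto the span of the first `n` basis vectors. -/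
def trunc (n : ℕ) : L2 →L[ℂ] L2 := ∑ i ∈ Finset.range n, unitOp i i

theorem inner_basisVec (i : ℕ) (f : L2) : ⟪basisVec i, f⟫_ℂ = f i := by
  rw [basisVec, lp.inner_single_left]; simp

theorem inner_basisVec_basisVec (i j : ℕ) :
    ⟪basisVec i, basisVec j⟫_ℂ = if i = j then 1 else 0 := by
  rw [inner_basisVec, basisVec, lp.single_apply, Pi.single_apply]

theorem unitOp_apply (i j : ℕ) (f : L2) : unitOp i j f = ⟪basisVec j, f⟫_ℂ • basisVec i := rfl

theorem star_unitOp (i j : ℕ) : star (unitOp i j) = unitOp j i :=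
  InnerProductSpace.adjoint_rankOne _ _

theorem unitOp_mul (i j : ℕ) (T : L2 →L[ℂ] L2) (k l : ℕ) :
    unitOp i j * T * unitOp k l = entry T j k • unitOp i l := by
  ext1 f
  simp only [clm_mul_apply, unitOp_apply, map_smul, smul_apply,
    entry, smul_smul, mul_comm]

theorem unitOp_mul_unitOp (i j k l : ℕ) :
    unitOp i j * unitOp k l = if j = k then unitOp i l else 0 := by
  have h := unitOp_mul i j 1 k l
  rw [mul_one, entry, one_apply_eq_self, inner_basisVec_basisVec] at h
  rw [h]; split_ifs <;> simp

theorem entry_add (S T : L2 →L[ℂ] L2) (i j : ℕ) : entry (S + T) i j = entry S i j + entry T i j := by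
  simp [entry]

theorem entry_smul (c : ℂ) (T : L2 →L[ℂ] L2) (i j : ℕ) : entry (c • T) i j = c * entry T i j := by
  simp [entry]

theorem entry_star (T : L2 →L[ℂ] L2) (i j : ℕ) :
    entry (star T) i j = starRingEnd ℂ (entry T j i) := by
  rw [entry, entry, inner_conj_symm]
  exact ContinuousLinearMap.adjoint_inner_right T _ _

theorem entry_unitOp (k l i j : ℕ) :
    entry (unitOp k l) i j = if i = k ∧ l = j then 1 else 0 := by
  rw [entry, unitOp_apply, inner_smul_right, inner_basisVec_basisVec, inner_basisVec_basisVec]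
  split_ifs <;> simp_all

theorem entry_mul_trunc_mul (S T : L2 →L[ℂ] L2) (n i j : ℕ) :
    entry (S * trunc n * T) i j = ∑ l ∈ Finset.range n, entry S i l * entry T l j := by
  simp only [entry, trunc, Finset.mul_sum, Finset.sum_mul, sum_apply, inner_sum,
    clm_mul_apply, unitOp_apply, map_smul, inner_smul_right, mul_comm]

theorem star_trunc (n : ℕ) : star (trunc n) = trunc n := by
  simp [trunc, star_sum, star_unitOp]

theorem trunc_mul_unitOp {n i j : ℕ} (h : i < n) : trunc n * unitOp i j = unitOp i j := by
  simp only [trunc, Finset.sum_mul, unitOp_mul_unitOp]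
  rw [Finset.sum_eq_single i] <;> simp +contextual [h]

theorem trunc_mul_trunc (n : ℕ) : trunc n * trunc n = trunc n := by
  conv_lhs => rw [trunc.eq_1 n, Finset.mul_sum, ← trunc.eq_1 n]
  exact Finset.sum_congr rfl fun i hi => trunc_mul_unitOp (Finset.mem_range.1 hi)

theorem norm_trunc_le (n : ℕ) : ‖trunc n‖ ≤ 1 :=
  norm_le_one_of_projection (star_trunc n) (trunc_mul_trunc n)

theorem trunc_mul_mul_trunc (n : ℕ) (T : L2 →L[ℂ] L2) : trunc n * T * trunc n =
    ∑ i ∈ Finset.range n, ∑ j ∈ Finset.range n, entry T i j • unitOp i j := by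
  simp only [trunc, Finset.sum_mul, Finset.mul_sum, unitOp_mul]
  exact Finset.sum_comm

theorem tendsto_trunc_apply (f : L2) : Tendsto (fun n => trunc n f) atTop (𝓝 f) := by
  have h := (lp.hasSum_single (p := 2) (by simp) f).tendsto_sum_nat
  refine h.congr fun n => ?_
  rw [trunc, sum_apply]
  refine Finset.sum_congr rfl fun i _ => ?_
  rw [unitOp_apply, inner_basisVec, basisVec, ← lp.single_smul]
  simp

/-- The contractions `trunc n` converge strongly to 1, hence uniformly on totally bounded sets such
as the image of the unit ball under T. -/
theorem tendsto_trunc_mul {T : L2 →L[ℂ] L2} (hT : IsCompactOperator T) :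
    Tendsto (fun n => trunc n * T) atTop (𝓝 T) := by
  have hK := ((isCompactOperator_iff_isCompact_closure_image_closedBall
    T.toLinearMap one_pos).1 hT).totallyBounded.subset subset_closure
  refine Metric.tendsto_atTop.2 fun ε hε => ?_
  -- Three errors of size ε/8 occur below, so the norm is at most ε/2, which leaves room for
  -- strictness after taking the supremum.
  obtain ⟨t, htf, ht⟩ := Metric.totallyBounded_iff.1 hK (ε / 8) (by positivity)
  have h1 : ∀ᶠ n in atTop, ∀ c ∈ t, dist (trunc n c) c < ε / 8 :=
    (htf.eventually_all).2 fun c _ =>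
      (tendsto_trunc_apply c).eventually (Metric.ball_mem_nhds c (by positivity))
  obtain ⟨N, hN⟩ := eventually_atTop.1 h1
  refine ⟨N, fun n hn => ?_⟩
  rw [dist_eq_norm]
  refine lt_of_le_of_lt (ContinuousLinearMap.opNorm_le_of_unit_norm (C := ε / 2) (by positivity)
    fun x hx => ?_) (by linarith)
  obtain ⟨c, hc, hxc⟩ := Set.mem_iUnion₂.1 (ht ⟨x, by simp [hx], rfl⟩)
  have hxc' : ‖T x - c‖ < ε / 8 := by rw [← dist_eq_norm]; exact hxc
  have h2 := hN n hn c hc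
  rw [dist_eq_norm] at h2
  have h3 : ‖trunc n (T x - c)‖ ≤ ‖T x - c‖ := by
    have := (trunc n).le_of_opNorm_le (norm_trunc_le n) (T x - c)
    rwa [one_mul] at this
  have e : (trunc n * T - T) x = trunc n (T x - c) + (trunc n c - c) - (T x - c) := by
    rw [map_sub, sub_apply, clm_mul_apply]; abel
  rw [e]
  have h4 := norm_sub_le (trunc n (T x - c) + (trunc n c - c)) (T x - c)
  have h5 := norm_add_le (trunc n (T x - c)) (trunc n c - c)
  linarith

theorem tendsto_mul_trunc {T : L2 →L[ℂ] L2} (hT : IsCompactOperator T) :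
    Tendsto (fun n => T * trunc n) atTop (𝓝 T) := by
  have h := (continuous_star.tendsto _).comp (tendsto_trunc_mul (isCompactOperator_star hT))
  rw [star_star] at h
  refine h.congr fun n => ?_
  simp [star_trunc]

theorem tendsto_trunc_mul_mul_trunc {T : L2 →L[ℂ] L2} (hT : IsCompactOperator T) :
    Tendsto (fun n => trunc n * T * trunc n) atTop (𝓝 T) := by
  have h : Tendsto (fun n => trunc n * (T * trunc n - T) + trunc n * T) atTop (𝓝 (0 + T)) := by
    refine Tendsto.add ?_ (tendsto_trunc_mul hT)
    have h0 : Tendsto (fun n => ‖T * trunc n - T‖) atTop (𝓝 0) := by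
      have := ((tendsto_mul_trunc hT).sub_const T).norm
      simpa using this
    refine squeeze_zero_norm (fun n => ?_) h0
    calc ‖trunc n * (T * trunc n - T)‖ ≤ ‖trunc n‖ * ‖T * trunc n - T‖ := norm_mul_le _ _
      _ ≤ 1 * ‖T * trunc n - T‖ := by gcongr; exact norm_trunc_le n
      _ = _ := one_mul _
  rw [zero_add] at h
  refine h.congr fun n => ?_
  rw [mul_sub, ← mul_assoc]; abel

/-- The matrix unit `e_{ij}` as a compact operator. -/
def unitCompact (i j : ℕ) : Compacts := ⟨unitOp i j, by
  change IsCompactOperator (rankOne ℂ (basisVec i) (basisVec j))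
  rw [InnerProductSpace.rankOne_def']
  have h : IsCompactOperator (ContinuousLinearMap.toSpanSingleton ℂ (basisVec i)) :=
    isCompactOperator_of_locallyCompactSpace_rng
      (ContinuousLinearMap.toSpanSingleton ℂ (basisVec i))
  exact h.comp_clm (innerSL ℂ (basisVec j))⟩

theorem matUnit_eq (i : ℕ) : matUnit i = unitCompact i 0 := rfl

theorem star_unitCompact (i j : ℕ) : star (unitCompact i j) = unitCompact j i :=
  Subtype.ext (star_unitOp i j)

theorem unitCompact_mul (i j k l : ℕ) :
    unitCompact i j * unitCompact k l = if j = k then unitCompact i l else 0 := by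
  refine Subtype.ext ((unitOp_mul_unitOp i j k l).trans ?_)
  split_ifs <;> rfl

/-- Compact operators are norm limits of finite sums of matrix units. -/
theorem tendsto_sum_unitCompact (T : Compacts) :
    Tendsto (fun n => ∑ i ∈ Finset.range n, ∑ j ∈ Finset.range n,
      entry (T : L2 →L[ℂ] L2) i j • unitCompact i j) atTop (𝓝 T) := by
  rw [tendsto_subtype_rng]
  refine (tendsto_trunc_mul_mul_trunc T.2).congr fun n => ?_
  rw [trunc_mul_mul_trunc]
  simp [unitCompact]

end MatrixUnits

/-- A star homomorphism on a closed star subalgebra is contractive. -/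
theorem norm_le_of_star_hom_on {E A : Type} [NonUnitalCStarAlgebra E] [NonUnitalCStarAlgebra A]
    (S : NonUnitalStarSubalgebra ℂ E) (hS : IsClosed (S : Set E)) (f : E →ₗ[ℂ] A)
    (hmul : ∀ x ∈ S, ∀ y ∈ S, f (x * y) = f x * f y) (hstar : ∀ x ∈ S, f (star x) = star (f x))
    {x : E} (hx : x ∈ S) : ‖f x‖ ≤ ‖x‖ := by
  let _ : NonUnitalCStarAlgebra S :=
    NonUnitalStarSubalgebra.nonUnitalCStarAlgebra S (h_closed := hS)
  let ψ : S →⋆ₙₐ[ℂ] A :=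
    { toFun := fun x => f x
      map_smul' := fun c x => map_smul f c (x : E)
      map_zero' := map_zero f
      map_add' := fun x y => map_add f (x : E) (y : E)
      map_mul' := fun x y => hmul x x.2 y y.2
      map_star' := fun x => hstar x x.2 }
  exact NonUnitalStarAlgHom.norm_apply_le ψ ⟨x, hx⟩

/-! ### Maps out of the C*-tensor product -/

section
variable {B K A : Type} [CStarAlgebra B] [NonUnitalCStarAlgebra K] [NonUnitalCStarAlgebra A]

/-- A bilinear map which respects products and adjoints defines a star homomorphism on the
algebraic tensor product. -/
def tensorHom (f : B →ₗ[ℂ] K →ₗ[ℂ] A)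
    (hmul : ∀ b c S T, f (b * c) (S * T) = f b S * f c T)
    (hstar : ∀ b T, f (star b) (star T) = star (f b T)) : B ⊗[ℂ] K →⋆ₙₐ[ℂ] A where
  toFun := TensorProduct.lift f
  map_smul' := map_smul _
  map_zero' := map_zero _
  map_add' := map_add _
  map_mul' x y := by
    induction x using TensorProduct.induction_on with
    | zero => rw [zero_mul, map_zero, zero_mul]
    | add x₁ x₂ h₁ h₂ => rw [add_mul, map_add, map_add, add_mul, h₁, h₂]
    | tmul b S =>
      induction y using TensorProduct.induction_on with
      | zero => rw [mul_zero, map_zero, mul_zero]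
      | add y₁ y₂ h₁ h₂ => rw [mul_add, map_add, map_add, mul_add, h₁, h₂]
      | tmul c T =>
        rw [Algebra.TensorProduct.tmul_mul_tmul]
        exact hmul b c S T
  map_star' x := by
    induction x using TensorProduct.induction_on with
    | zero => rw [star_zero, map_zero, star_zero]
    | add x₁ x₂ h₁ h₂ => rw [star_add, map_add, map_add, star_add, h₁, h₂]
    | tmul b S =>
      rw [TensorProduct.star_tmul]
      exact hstar b S

/-- The norm of a C*-algebra is determined by its Hilbert space representations. -/
def NormedByReps (A : Type) [NonUnitalCStarAlgebra A] : Prop :=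
  ∀ (a : A) (C : ℝ), 0 ≤ C → (∀ (ρ : Rep A), ‖ρ.π a‖ ≤ C) → ‖a‖ ≤ C

/-- The star homomorphism on `B ⊗ K` defined by a bilinear map. -/
def CTensor.lift (hA : NormedByReps A) (f : B →ₗ[ℂ] K →ₗ[ℂ] A)
    (hmul : ∀ b c S T, f (b * c) (S * T) = f b S * f c T)
    (hstar : ∀ b T, f (star b) (star T) = star (f b T)) : CTensor B K →⋆ₙₐ[ℂ] A :=
  Env.lift (tensorReps B K) (tensorHom f hmul hstar) fun x =>
    -- Composing a representation of A with the map on the algebraic tensor product gives one of the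
    -- representations that define the greatest C*-norm.
    hA _ _ (RepFamily.sup_nonneg _ _) fun ρ =>
      (tensorReps B K).le_sup (ρ := ⟨ρ.H, ρ.π.comp (tensorHom f hmul hstar)⟩) (Set.mem_univ _) x

theorem CTensor.lift_tmul (hA : NormedByReps A) (f : B →ₗ[ℂ] K →ₗ[ℂ] A)
    (hmul : ∀ b c S T, f (b * c) (S * T) = f b S * f c T)
    (hstar : ∀ b T, f (star b) (star T) = star (f b T)) (b : B) (T : K) :
    CTensor.lift hA f hmul hstar (CTensor.tmul b T) = f b T :=
  Env.lift_of _ _ _ _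

theorem CTensor.tmul_mul (b c : B) (S T : K) :
    CTensor.tmul b S * CTensor.tmul c T = CTensor.tmul (b * c) (S * T) := by
  refine (Env.of_mul (tensorReps B K) _ _).symm.trans ?_
  rw [Algebra.TensorProduct.tmul_mul_tmul]; rfl

theorem CTensor.star_tmul (b : B) (T : K) :
    star (CTensor.tmul b T) = CTensor.tmul (star b) (star T) := by
  refine (Env.of_star (tensorReps B K) _).symm.trans ?_
  rw [TensorProduct.star_tmul]; rfl

theorem CTensor.norm_tmul_le (b : B) (T : K) : ‖CTensor.tmul b T‖ ≤ ‖b‖ * ‖T‖ :=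
  (Env.norm_of (tensorReps B K) _).trans_le
    (RepFamily.sup_le _ (by positivity) fun ρ _ => tmul_bdd ρ.π b T)

variable (B K) in
/-- Elementary tensors as a bilinear map. -/
def CTensor.mk : B →ₗ[ℂ] K →ₗ[ℂ] CTensor B K :=
  LinearMap.mk₂ ℂ CTensor.tmul
    (fun b c T => (congrArg (Env.of (tensorReps B K)) (TensorProduct.add_tmul b c T)).trans
      (Env.of_add _ _ _))
    (fun c b T => (congrArg (Env.of (tensorReps B K)) (TensorProduct.smul_tmul' c b T).symm).trans
      (Env.of_smul _ _ _))
    (fun b S T => (congrArg (Env.of (tensorReps B K)) (TensorProduct.tmul_add b S T)).trans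
      (Env.of_add _ _ _))
    (fun c b T => (congrArg (Env.of (tensorReps B K)) (TensorProduct.tmul_smul c b T)).trans
      (Env.of_smul _ _ _))

theorem CTensor.continuous_tmul (b : B) : Continuous fun T : K => CTensor.tmul b T :=
  ((CTensor.mk B K b).mkContinuous ‖b‖ fun T => CTensor.norm_tmul_le b T).continuous

/-- A closed subspace containing all elementary tensors is everything. -/
theorem CTensor.mem_of_tmul (M : Submodule ℂ (CTensor B K)) (hM : IsClosed (M : Set (CTensor B K)))
    (h : ∀ b T, CTensor.tmul b T ∈ M) (t : CTensor B K) : t ∈ M :=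
  Env.ind (tensorReps B K) (p := (· ∈ M)) hM (fun x => by
    induction x using TensorProduct.induction_on with
    | zero => rw [Env.of_zero]; exact M.zero_mem
    | tmul b T => exact h b T
    | add x y hx hy => rw [Env.of_add]; exact M.add_mem hx hy) t

end
-- The homomorphism b ⊗ T ↦ ∑ T_ij w^i π(b) w*^j
section MatrixMap

open Filter Topology

variable {B A : Type} [CStarAlgebra B] [CStarAlgebra A]

/-- An isometry `w` together with a homomorphism `π` whose image is annihilated by `w*` from the
left. -/
structure Stabilizing (w : A) (π : B →⋆ₙₐ[ℂ] A) : Prop where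
  isom : star w * w = 1
  annihilate : ∀ b, star w * π b = 0

/-- The element `w^i π(b) w*^j`. -/
def slot (w : A) (π : B →⋆ₙₐ[ℂ] A) (i j : ℕ) (b : B) : A := w ^ i * π b * star w ^ j

/-- The truncated sum `∑ T_{ij} w^i π(b) w*^j` over `i, j < n`. -/
def blockMap (w : A) (π : B →⋆ₙₐ[ℂ] A) (n : ℕ) : B →ₗ[ℂ] (L2 →L[ℂ] L2) →ₗ[ℂ] A :=
  LinearMap.mk₂ ℂ
    (fun b T => ∑ i ∈ Finset.range n, ∑ j ∈ Finset.range n, entry T i j • slot w π i j b)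
    (fun b c T => by
      simp only [slot, map_add, mul_add, add_mul, smul_add, Finset.sum_add_distrib])
    (fun c b T => by
      simp only [slot, map_smul, mul_smul_comm, smul_mul_assoc, Finset.smul_sum, smul_comm c])
    (fun b S T => by simp only [entry_add, add_smul, Finset.sum_add_distrib])
    (fun c b T => by simp only [entry_smul, mul_smul, Finset.smul_sum])

theorem blockMap_apply (w : A) (π : B →⋆ₙₐ[ℂ] A) (n : ℕ) (b : B) (T : L2 →L[ℂ] L2) :
    blockMap w π n b T =
      ∑ i ∈ Finset.range n, ∑ j ∈ Finset.range n, entry T i j • slot w π i j b := rfl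

theorem star_slot (w : A) (π : B →⋆ₙₐ[ℂ] A) (i j : ℕ) (b : B) :
    star (slot w π i j b) = slot w π j i (star b) := by
  simp [slot, mul_assoc, map_star]

theorem star_blockMap (w : A) (π : B →⋆ₙₐ[ℂ] A) (n : ℕ) (b : B) (T : L2 →L[ℂ] L2) :
    star (blockMap w π n b T) = blockMap w π n (star b) (star T) := by
  simp only [blockMap_apply, star_sum, star_smul, star_slot, entry_star]
  exact Finset.sum_comm

theorem blockMap_unitOp (w : A) (π : B →⋆ₙₐ[ℂ] A) {n i j : ℕ} (hi : i < n) (hj : j < n) (b : B) :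
    blockMap w π n b (unitOp i j) = slot w π i j b := by
  rw [blockMap_apply, Finset.sum_eq_single_of_mem i (Finset.mem_range.2 hi),
    Finset.sum_eq_single_of_mem j (Finset.mem_range.2 hj)]
  · simp [entry_unitOp]
  · intro k _ hk
    simp [entry_unitOp, hk.symm]
  · intro k _ hk
    simp [entry_unitOp, hk]

theorem blockMap_truncated (w : A) (π : B →⋆ₙₐ[ℂ] A) {k n : ℕ} (h : k ≤ n) (b : B)
    (T : L2 →L[ℂ] L2) :
    blockMap w π n b (trunc k * T * trunc k) = blockMap w π k b T := by
  rw [trunc_mul_mul_trunc, map_sum, blockMap_apply]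
  refine Finset.sum_congr rfl fun i hi => ?_
  rw [map_sum]
  refine Finset.sum_congr rfl fun j hj => ?_
  rw [map_smul, blockMap_unitOp w π ((Finset.mem_range.1 hi).trans_le h)
    ((Finset.mem_range.1 hj).trans_le h)]

namespace Stabilizing

variable {w : A} {π : B →⋆ₙₐ[ℂ] A} (hw : Stabilizing w π)
include hw

theorem annihilate' (b : B) : π b * w = 0 := by
  have := congrArg star (hw.annihilate (star b))
  simpa [map_star] using this

theorem star_pow_mul_pow (j m : ℕ) : star w ^ j * w ^ (j + m) = w ^ m := by
  induction j with
  | zero => simp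
  | succ j ih =>
    rw [pow_succ, Nat.succ_add, pow_succ', mul_assoc, ← mul_assoc (star w), hw.isom, one_mul, ih]

theorem star_pow_mul_pow' (k m : ℕ) : star w ^ (k + m) * w ^ k = star w ^ m := by
  have := congrArg star (hw.star_pow_mul_pow k m)
  simpa using this

/-- For j ≠ k the middle factor w*^j w^k reduces to a positive power of w or of w*, which is killed
by π(b) from the left or by π(c) from the right. -/
theorem slot_mul_slot (i j k l : ℕ) (b c : B) :
    slot w π i j b * slot w π k l c = if j = k then slot w π i l (b * c) else 0 := by
  have e : slot w π i j b * slot w π k l c =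
      w ^ i * (π b * (star w ^ j * w ^ k) * π c) * star w ^ l := by
    simp only [slot, mul_assoc]
  rw [e]
  split_ifs with hjk
  · subst hjk
    have := hw.star_pow_mul_pow j 0
    rw [add_zero, pow_zero] at this
    rw [this, mul_one, ← map_mul]; rfl
  · rcases lt_or_gt_of_ne hjk with h | h
    · obtain ⟨m, rfl⟩ := Nat.exists_eq_add_of_lt h
      rw [add_assoc, hw.star_pow_mul_pow, pow_succ', ← mul_assoc (π b), hw.annihilate']
      simp
    · obtain ⟨m, rfl⟩ := Nat.exists_eq_add_of_lt h
      have h0 : star w ^ (m + 1) * π c = 0 := by rw [pow_succ, mul_assoc, hw.annihilate, mul_zero]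
      rw [add_assoc, hw.star_pow_mul_pow', mul_assoc (π b), h0]
      simp

/-- Only indices below n are summed in the middle, so multiplicativity holds with a truncation
inserted between S and T; the truncation disappears in the limit for compact operators. -/
theorem blockMap_mul (n : ℕ) (b c : B) (S T : L2 →L[ℂ] L2) :
    blockMap w π n b S * blockMap w π n c T = blockMap w π n (b * c) (S * trunc n * T) := by
  simp only [blockMap_apply, entry_mul_trunc_mul]
  rw [Finset.sum_mul]
  refine Finset.sum_congr rfl fun i _ => ?_
  have e : ∀ j ∈ Finset.range n, entry S i j • slot w π i j b *
      ∑ k ∈ Finset.range n, ∑ l ∈ Finset.range n, entry T k l • slot w π k l c =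
      ∑ l ∈ Finset.range n, (entry S i j * entry T j l) • slot w π i l (b * c) := by
    intro j hj
    rw [Finset.mul_sum, Finset.sum_eq_single_of_mem j hj]
    · rw [Finset.mul_sum]
      refine Finset.sum_congr rfl fun l _ => ?_
      rw [smul_mul_smul_comm, hw.slot_mul_slot, if_pos rfl]
    · intro k _ hk
      rw [Finset.mul_sum]
      refine Finset.sum_eq_zero fun l _ => ?_
      rw [smul_mul_smul_comm, hw.slot_mul_slot, if_neg hk.symm, smul_zero]
  rw [Finset.sum_mul, Finset.sum_congr rfl e, Finset.sum_comm]
  simp only [Finset.sum_smul]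

theorem norm_blockMap_trunc_le (n : ℕ) (b : B) : ‖blockMap w π n b (trunc n)‖ ≤ ‖b‖ := by
  let ψ : B →⋆ₙₐ[ℂ] A :=
    { toFun := fun b => blockMap w π n b (trunc n)
      map_smul' := fun c b => by rw [map_smul]; rfl
      map_zero' := by rw [map_zero]; rfl
      map_add' := fun b c => by rw [map_add]; rfl
      map_mul' := fun b c => by rw [hw.blockMap_mul, trunc_mul_trunc, trunc_mul_trunc]
      map_star' := fun b => by rw [star_blockMap, star_trunc] }
  exact NonUnitalStarAlgHom.norm_apply_le ψ b

omit hw in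
/-- The operators supported on the first `n` basis vectors. -/
def _root_.FreeTwist.truncCorner (n : ℕ) : NonUnitalStarSubalgebra ℂ (L2 →L[ℂ] L2) where
  carrier := {T | trunc n * T = T ∧ T * trunc n = T}
  add_mem' := fun ha hb => ⟨by rw [mul_add, ha.1, hb.1], by rw [add_mul, ha.2, hb.2]⟩
  zero_mem' := ⟨mul_zero _, zero_mul _⟩
  mul_mem' := fun ha hb => ⟨by rw [← mul_assoc, ha.1], by rw [mul_assoc, hb.2]⟩
  smul_mem' := fun c _ ha => ⟨by rw [mul_smul_comm, ha.1], by rw [smul_mul_assoc, ha.2]⟩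
  star_mem' := fun {a} ha =>
    ⟨by simpa [star_trunc] using congrArg star ha.2, by simpa [star_trunc] using congrArg star ha.1⟩

theorem norm_blockMap_one_le {n : ℕ} {T : L2 →L[ℂ] L2} (hT : T ∈ truncCorner n) :
    ‖blockMap w π n 1 T‖ ≤ ‖T‖ := by
  have hc : IsClosed (truncCorner n : Set (L2 →L[ℂ] L2)) :=
    (isClosed_eq (continuous_const.mul continuous_id) continuous_id).inter
      (isClosed_eq (continuous_id.mul continuous_const) continuous_id)
  exact norm_le_of_star_hom_on (truncCorner n) hc (blockMap w π n 1)
    (fun S hS T _ => by rw [hw.blockMap_mul, one_mul, hS.2])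
    (fun T _ => by rw [star_blockMap, star_one]) hT

/-- The point is a bound uniform in n. The map factors as the product of the values at (b, trunc n)
and at (1, truncated T), and each of these depends on its variable through a star homomorphism,
which is contractive. -/
theorem norm_blockMap_le (n : ℕ) (b : B) (T : L2 →L[ℂ] L2) :
    ‖blockMap w π n b T‖ ≤ ‖b‖ * ‖T‖ := by
  have hT : trunc n * T * trunc n ∈ truncCorner n :=
    ⟨by rw [← mul_assoc, ← mul_assoc, trunc_mul_trunc], by rw [mul_assoc, trunc_mul_trunc]⟩
  have e : blockMap w π n b T =
      blockMap w π n b (trunc n) * blockMap w π n 1 (trunc n * T * trunc n) := by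
    rw [hw.blockMap_mul, mul_one, trunc_mul_trunc, hT.1, blockMap_truncated w π le_rfl]
  have h1 : ‖trunc n * T * trunc n‖ ≤ ‖T‖ := by
    calc ‖trunc n * T * trunc n‖ ≤ ‖trunc n‖ * ‖T‖ * ‖trunc n‖ :=
          (norm_mul_le _ _).trans (by gcongr; exact norm_mul_le _ _)
      _ ≤ 1 * ‖T‖ * 1 := by gcongr <;> exact norm_trunc_le n
      _ = ‖T‖ := by ring
  rw [e]
  refine (norm_mul_le _ _).trans ?_
  gcongr
  · exact hw.norm_blockMap_trunc_le n b
  · exact (hw.norm_blockMap_one_le hT).trans h1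

theorem cauchySeq_blockMap (b : B) (T : Compacts) :
    CauchySeq fun n => blockMap w π n b (T : L2 →L[ℂ] L2) := by
  refine Metric.cauchySeq_iff'.2 fun ε hε => ?_
  have h := (tendsto_trunc_mul_mul_trunc T.2)
  have hb : 0 < ε / (‖b‖ + 1) := by positivity
  obtain ⟨N, hN⟩ := Metric.tendsto_atTop.1 h _ hb
  refine ⟨N, fun n hn => ?_⟩
  -- The N-th term is the n-th map at the N-truncation of T, so the difference is a single value of
  -- the n-th map and the uniform bound applies. The summand 1 in the chosen tolerance covers b = 0.
  rw [dist_eq_norm, ← blockMap_truncated w π hn, ← map_sub]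
  have h1 := hN N le_rfl
  rw [dist_comm, dist_eq_norm, lt_div_iff₀ (by positivity)] at h1
  have h2 := hw.norm_blockMap_le n b
    ((T : L2 →L[ℂ] L2) - trunc N * (T : L2 →L[ℂ] L2) * trunc N)
  have h3 := norm_nonneg ((T : L2 →L[ℂ] L2) - trunc N * (T : L2 →L[ℂ] L2) * trunc N)
  nlinarith

omit hw in
/-- The sum `∑ T_{ij} w^i π(b) w*^j` for a compact operator `T`. -/
def _root_.FreeTwist.matrixFun (w : A) (π : B →⋆ₙₐ[ℂ] A) (b : B) (T : Compacts) : A :=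
  limUnder atTop fun n => blockMap w π n b (T : L2 →L[ℂ] L2)

theorem tendsto_blockMap (b : B) (T : Compacts) :
    Tendsto (fun n => blockMap w π n b (T : L2 →L[ℂ] L2)) atTop (𝓝 (matrixFun w π b T)) :=
  (hw.cauchySeq_blockMap b T).tendsto_limUnder

theorem matrixFun_unitCompact (b : B) (i j : ℕ) :
    matrixFun w π b (unitCompact i j) = slot w π i j b := by
  refine tendsto_nhds_unique (hw.tendsto_blockMap b _) (tendsto_const_nhds.congr' ?_)
  filter_upwards [eventually_gt_atTop i, eventually_gt_atTop j] with n hi hj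
  exact (blockMap_unitOp w π hi hj b).symm

theorem star_matrixFun (b : B) (T : Compacts) :
    matrixFun w π (star b) (star T) = star (matrixFun w π b T) := by
  refine tendsto_nhds_unique (hw.tendsto_blockMap _ _)
    (((continuous_star.tendsto _).comp (hw.tendsto_blockMap b T)).congr fun n => ?_)
  exact star_blockMap w π n b _

theorem matrixFun_mul (b c : B) (S T : Compacts) :
    matrixFun w π (b * c) (S * T) = matrixFun w π b S * matrixFun w π c T := by
  have h1 := (hw.tendsto_blockMap b S).mul (hw.tendsto_blockMap c T)
  simp only [hw.blockMap_mul] at h1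
  -- The truncation inserted by `blockMap_mul` costs an error that vanishes because S is compact, so
  -- S · trunc n → S in norm.
  have h2 : Tendsto (fun n => blockMap w π n (b * c)
      ((S : L2 →L[ℂ] L2) * T - (S : L2 →L[ℂ] L2) * trunc n * T)) atTop (𝓝 0) := by
    have h0 : Tendsto (fun n => ‖b * c‖ *
        ‖(S : L2 →L[ℂ] L2) * T - (S : L2 →L[ℂ] L2) * trunc n * T‖) atTop (𝓝 0) := by
      have := ((((tendsto_mul_trunc S.2).mul_const (T : L2 →L[ℂ] L2)).const_sub
        ((S : L2 →L[ℂ] L2) * T)).norm).const_mul ‖b * c‖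
      simpa using this
    exact squeeze_zero_norm (fun n => hw.norm_blockMap_le n _ _) h0
  have h3 := h2.add h1
  rw [zero_add] at h3
  refine tendsto_nhds_unique (hw.tendsto_blockMap _ _) (h3.congr fun n => ?_)
  rw [map_sub, sub_add_cancel]; rfl

/-- The bilinear map `(b, T) ↦ ∑ T_{ij} w^i π(b) w*^j`. -/
def matrixBilin : B →ₗ[ℂ] Compacts →ₗ[ℂ] A :=
  LinearMap.mk₂ ℂ (matrixFun w π)
    (fun b c T => tendsto_nhds_unique (hw.tendsto_blockMap _ _)
      (((hw.tendsto_blockMap b T).add (hw.tendsto_blockMap c T)).congr fun n => by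
        rw [map_add]; rfl))
    (fun c b T => tendsto_nhds_unique (hw.tendsto_blockMap _ _)
      (((hw.tendsto_blockMap b T).const_smul c).congr fun n => by rw [map_smul]; rfl))
    (fun b S T => tendsto_nhds_unique (hw.tendsto_blockMap _ _)
      (((hw.tendsto_blockMap b S).add (hw.tendsto_blockMap b T)).congr fun n =>
        (map_add (blockMap w π n b) (S : L2 →L[ℂ] L2) (T : L2 →L[ℂ] L2)).symm))
    (fun c b T => tendsto_nhds_unique (hw.tendsto_blockMap _ _)
      (((hw.tendsto_blockMap b T).const_smul c).congr fun n =>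
        (map_smul (blockMap w π n b) c (T : L2 →L[ℂ] L2)).symm))

/-- The star homomorphism `b ⊗ T ↦ ∑ T_{ij} w^i π(b) w*^j`. -/
def matrixHom (hA : NormedByReps A) : CTensor B Compacts →⋆ₙₐ[ℂ] A :=
  CTensor.lift hA hw.matrixBilin hw.matrixFun_mul hw.star_matrixFun

theorem matrixHom_unitCompact (hA : NormedByReps A) (b : B) (i j : ℕ) :
    hw.matrixHom hA (CTensor.tmul b (unitCompact i j)) = slot w π i j b :=
  (CTensor.lift_tmul hA hw.matrixBilin hw.matrixFun_mul hw.star_matrixFun b _).trans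
    (hw.matrixFun_unitCompact b i j)

end Stabilizing

end MatrixMap

/-! ### Injectivity on B ⊗ K through matrix entries -/

section MatrixHom

open Filter Topology

variable {B A : Type} [CStarAlgebra B] [CStarAlgebra A]

theorem CTensor.tmul_mem_of_unitCompact {M : Submodule ℂ (CTensor B Compacts)}
    (hM : IsClosed (M : Set (CTensor B Compacts))) {b : B}
    (h : ∀ i j, CTensor.tmul b (unitCompact i j) ∈ M) (T : Compacts) : CTensor.tmul b T ∈ M := by
  refine hM.mem_of_tendsto
    (((CTensor.continuous_tmul b).tendsto T).comp (tendsto_sum_unitCompact T))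
    (Eventually.of_forall fun n => ?_)
  change CTensor.mk B Compacts b _ ∈ M
  rw [map_sum]
  refine M.sum_mem fun i _ => ?_
  rw [map_sum]
  refine M.sum_mem fun j _ => ?_
  have e : CTensor.mk B Compacts b (entry (T : L2 →L[ℂ] L2) i j • unitCompact i j) =
      entry (T : L2 →L[ℂ] L2) i j • CTensor.tmul b (unitCompact i j) :=
    map_smul (CTensor.mk B Compacts b) _ _
  rw [e]
  exact M.smul_mem _ (h i j)

theorem CTensor.mem_of_unitCompact (M : Submodule ℂ (CTensor B Compacts))
    (hM : IsClosed (M : Set (CTensor B Compacts)))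
    (h : ∀ b i j, CTensor.tmul b (unitCompact i j) ∈ M) (t : CTensor B Compacts) : t ∈ M :=
  CTensor.mem_of_tmul M hM (fun b => CTensor.tmul_mem_of_unitCompact hM (h b)) t

theorem CTensor.tmul_unitCompact_mul (b c : B) (i j k l : ℕ) :
    CTensor.tmul b (unitCompact i j) * CTensor.tmul c (unitCompact k l) =
      if j = k then CTensor.tmul (b * c) (unitCompact i l) else 0 := by
  rw [CTensor.tmul_mul, unitCompact_mul]
  split_ifs
  · rfl
  · exact map_zero (CTensor.mk B Compacts (b * c))

/-- Since b ⊗ e_ij = (b ⊗ e_i0)(1 ⊗ e_0j), the hypothesis gives sx = 0 for all s in a dense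
subspace, hence for all s; then take s = x*. -/
theorem CTensor.eq_zero_of_unitCompact_mul {x : CTensor B Compacts}
    (h : ∀ i, CTensor.tmul 1 (unitCompact 0 i) * x = 0) : x = 0 := by
  have key : ∀ s : CTensor B Compacts, s * x = 0 := by
    let M : Submodule ℂ (CTensor B Compacts) :=
      { carrier := {s | s * x = 0}
        add_mem' := fun {s t} hs ht => by
          change (s + t) * x = 0
          rw [add_mul, show s * x = 0 from hs, show t * x = 0 from ht, add_zero]
        zero_mem' := zero_mul x
        smul_mem' := fun c s hs => by
          change (c • s) * x = 0
          rw [smul_mul_assoc, show s * x = 0 from hs, smul_zero] }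
    refine CTensor.mem_of_unitCompact M
      (isClosed_eq (continuous_id.mul continuous_const) continuous_const) fun b i j => ?_
    change CTensor.tmul b (unitCompact i j) * x = 0
    have e := CTensor.tmul_unitCompact_mul b 1 i 0 0 j
    rw [if_pos rfl, mul_one] at e
    rw [← e, mul_assoc, h, mul_zero]
  exact CStarRing.star_mul_self_eq_zero_iff x |>.1 (key (star x))

theorem CTensor.eq_zero_of_mul_unitCompact {x : CTensor B Compacts}
    (h : ∀ i, x * CTensor.tmul 1 (unitCompact i 0) = 0) : x = 0 := by
  rw [← star_eq_zero]
  refine CTensor.eq_zero_of_unitCompact_mul fun i => ?_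
  have := congrArg star (h i)
  rwa [star_mul, CTensor.star_tmul, star_one, star_unitCompact, star_zero] at this

variable (B) in
/-- The embedding `b ↦ b ⊗ e_{00}`. -/
def CTensor.cornerHom : B →⋆ₙₐ[ℂ] CTensor B Compacts where
  toFun b := CTensor.tmul b (unitCompact 0 0)
  map_smul' c b := congrFun (congrArg DFunLike.coe (map_smul (CTensor.mk B Compacts) c b)) _
  map_zero' := congrFun (congrArg DFunLike.coe (map_zero (CTensor.mk B Compacts))) _
  map_add' b c := congrFun (congrArg DFunLike.coe (map_add (CTensor.mk B Compacts) b c)) _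
  map_mul' b c := by rw [CTensor.tmul_unitCompact_mul, if_pos rfl]
  map_star' b := by rw [CTensor.star_tmul, star_unitCompact]

namespace Stabilizing

variable {w : A} {π : B →⋆ₙₐ[ℂ] A} (hw : Stabilizing w π) (hA : NormedByReps A)
include hw hA

theorem matrixHom_cornerHom (b : B) : hw.matrixHom hA (CTensor.cornerHom B b) = π b := by
  refine (hw.matrixHom_unitCompact hA b 0 0).trans ?_
  simp [slot]

theorem cornerHom_injective (hπ : Function.Injective π) :
    Function.Injective (CTensor.cornerHom B) := fun b c h => hπ <| by
  rw [← hw.matrixHom_cornerHom hA, ← hw.matrixHom_cornerHom hA, h]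

/-- The (i, j) entry of t is an element of B. This is clear for elementary tensors with matrix
units, and passes to limits because the embedding of B, being injective, is isometric and so has
closed range. -/
theorem corner_mem_range (hπ : Function.Injective π) (i j : ℕ) (t : CTensor B Compacts) :
    CTensor.tmul 1 (unitCompact 0 i) * t * CTensor.tmul 1 (unitCompact j 0) ∈
      Set.range (CTensor.cornerHom B) := by
  have hc : IsClosed (Set.range (CTensor.cornerHom B)) :=
    (NonUnitalStarAlgHom.isometry (CTensor.cornerHom B)
      (hw.cornerHom_injective hA hπ)).isClosedEmbedding.isClosed_range
  let M : Submodule ℂ (CTensor B Compacts) :=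
    { carrier := {t | CTensor.tmul 1 (unitCompact 0 i) * t * CTensor.tmul 1 (unitCompact j 0) ∈
        Set.range (CTensor.cornerHom B)}
      add_mem' := by
        rintro s t ⟨b, hb⟩ ⟨c, hc⟩
        exact ⟨b + c, by rw [map_add, hb, hc, mul_add, add_mul]⟩
      zero_mem' := ⟨0, by rw [map_zero, mul_zero, zero_mul]⟩
      smul_mem' := by
        rintro c t ⟨b, hb⟩
        exact ⟨c • b, by rw [map_smul, hb, mul_smul_comm, smul_mul_assoc]⟩ }
  refine CTensor.mem_of_unitCompact M (hc.preimage (by fun_prop)) (fun b k l => ?_) t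
  change CTensor.tmul 1 (unitCompact 0 i) * CTensor.tmul b (unitCompact k l) *
    CTensor.tmul 1 (unitCompact j 0) ∈ Set.range (CTensor.cornerHom B)
  rw [CTensor.tmul_unitCompact_mul]
  split_ifs
  · rw [CTensor.tmul_unitCompact_mul]
    split_ifs
    · exact ⟨1 * b * 1, rfl⟩
    · exact ⟨0, map_zero _⟩
  · exact ⟨0, by rw [map_zero, zero_mul]⟩

/-- The entries of an element of the kernel lie in the kernel too, and on B ⊗ e_00 the homomorphism
is the injective π; an element with vanishing entries is zero. Nuclearity of K is not needed. -/
theorem matrixHom_injective (hπ : Function.Injective π) :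
    Function.Injective (hw.matrixHom hA) := by
  refine (injective_iff_map_eq_zero _).2 fun t ht => ?_
  refine CTensor.eq_zero_of_mul_unitCompact fun j => CTensor.eq_zero_of_unitCompact_mul fun i => ?_
  rw [← mul_assoc]
  obtain ⟨b, hb⟩ := hw.corner_mem_range hA hπ i j t
  rw [← hb]
  have : π b = 0 := by
    rw [← hw.matrixHom_cornerHom hA, hb, map_mul, map_mul, ht, mul_zero, zero_mul]
  rw [(map_eq_zero_iff π hπ).1 this, map_zero]

end Stabilizing

end MatrixHom

/-! ### Universal properties of B and A, and the relations between their generators -/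

section Universal

/-- The norm of a unital C*-algebra is determined by its unital Hilbert space representations. -/
def NormedByUnitalReps (A : Type) [CStarAlgebra A] : Prop :=
  ∀ (a : A) (C : ℝ), 0 ≤ C → (∀ ρ : Rep A, ρ.π 1 = 1 → ‖ρ.π a‖ ≤ C) → ‖a‖ ≤ C

theorem NormedByUnitalReps.normedByReps {A : Type} [CStarAlgebra A]
    (hA : NormedByUnitalReps A) : NormedByReps A :=
  fun a C hC h => hA a C hC fun ρ _ => h ρ

/-- The representations defining the norm extend to the completion and remain unital there, so they
suffice as test representations. -/
theorem normedByUnitalReps_Afree (θ : ℝ) : NormedByUnitalReps (Afree θ) := fun a _ hC h =>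
  Env.norm_le_of_rep (repsUV θ) a hC fun ρ hρ =>
    h ⟨ρ.H, Env.rep (repsUV θ) hρ⟩ ((Env.rep_of (repsUV θ) hρ 1).trans hρ.1)

/-- Induction on elements of the universal C*-algebra generated by a unitary and a projection. -/
theorem Aup.induction {p : Aup → Prop} (hc : IsClosed {x | p x}) (hu : p upU) (hp : p upP)
    (h1 : p 1) (hs : ∀ (c : ℂ) a, p a → p (c • a)) (ha : ∀ a b, p a → p b → p (a + b))
    (hm : ∀ a b, p a → p b → p (a * b)) (hst : ∀ a, p a → p (star a)) (a : Aup) : p a :=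
  Env.ind repsUP hc (fun x => by
    induction x using FreeStar.ind with
    | hx g => cases g; exacts [hu, hp]
    | h1 => exact h1
    | hs c a h => rw [Env.of_smul]; exact hs _ _ h
    | ha a b h h' => rw [Env.of_add]; exact ha _ _ h h'
    | hm a b h h' => rw [Env.of_mul]; exact hm _ _ h h'
    | hst a h => rw [Env.of_star]; exact hst _ h) a

/-- Induction on elements of the free twist. -/
theorem Afree.induction {θ : ℝ} {p : Afree θ → Prop} (hc : IsClosed {x | p x}) (hu : p (genU θ))
    (hv : p (genV θ)) (hu' : p (star (genU θ))) (hv' : p (star (genV θ)))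
    (h1 : p 1) (hs : ∀ (c : ℂ) a, p a → p (c • a)) (ha : ∀ a b, p a → p b → p (a + b))
    (hm : ∀ a b, p a → p b → p (a * b)) (a : Afree θ) : p a := by
  -- The property is not assumed stable under adjoints, so it is carried along for a polynomial and
  -- its adjoint together; only the four letters u, v, u*, v* are needed.
  have key : ∀ x : FreeStar GenUV,
      p (Env.of (repsUV θ) x) ∧ p (Env.of (repsUV θ) (star x)) := fun x => by
    induction x using FreeStar.ind with
    | hx g => cases g <;> rw [Env.of_star]; exacts [⟨hu, hu'⟩, ⟨hv, hv'⟩]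
    | h1 => rw [star_one]; exact ⟨h1, h1⟩
    | hs c a h => rw [star_smul, Env.of_smul, Env.of_smul]; exact ⟨hs _ _ h.1, hs _ _ h.2⟩
    | ha a b h h' =>
      rw [star_add, Env.of_add, Env.of_add]; exact ⟨ha _ _ h.1 h'.1, ha _ _ h.2 h'.2⟩
    | hm a b h h' =>
      rw [star_mul, Env.of_mul, Env.of_mul]; exact ⟨hm _ _ h.1 h'.1, hm _ _ h'.2 h.2⟩
    | hst a h => rw [star_star]; exact ⟨h.2, h.1⟩
  exact Env.ind (repsUV θ) hc (fun x => (key x).1) a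

variable {A : Type} [CStarAlgebra A]

/-- The star homomorphism on the free star algebra defined by a unitary and a projection. -/
def freeUP (U p : A) : FreeStar GenUP →⋆ₐ[ℂ] A :=
  FreeStar.lift fun g => match g with | .u => U | .p => p

theorem freeUP_u (U p : A) : freeUP U p (FreeStar.x .u) = U := FreeStar.lift_x _ _

theorem freeUP_p (U p : A) : freeUP U p (FreeStar.x .p) = p := FreeStar.lift_x _ _

/-- A unitary and a projection. -/
structure UnitaryProj (U p : A) : Prop where
  star_mul : star U * U = 1
  mul_star : U * star U = 1
  star_p : star p = p
  mul_p : p * p = p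

theorem UnitaryProj.norm_freeUP_le (hA : NormedByUnitalReps A) {U p : A} (h : UnitaryProj U p)
    (x : FreeStar GenUP) : ‖freeUP U p x‖ ≤ repsUP.sup x := by
  refine hA _ _ (repsUP.sup_nonneg x) fun ρ hρ => ?_
  refine repsUP.le_sup
    (ρ := ⟨ρ.H, ρ.π.comp ((freeUP U p : FreeStar GenUP →⋆ₐ[ℂ] A) : FreeStar GenUP →⋆ₙₐ[ℂ] A)⟩)
    ⟨?_, ?_⟩ x
  · change ρ.π (freeUP U p 1) = 1
    rw [map_one, hρ]
  · intro s hs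
    change ρ.π (freeUP U p s) = 0
    have : freeUP U p s = 0 := by
      have e (a) : freeUP U p (star a) = star (freeUP U p a) := map_star (freeUP U p) a
      rcases hs with rfl | rfl | rfl | rfl <;>
        simp only [map_sub, map_mul, map_one, e, freeUP_u, freeUP_p, h.star_mul, h.mul_star,
          h.star_p, h.mul_p, sub_self]
    rw [this, map_zero]

/-- The universal property of `C(S¹) * ℂ²`. -/
def UnitaryProj.lift (hA : NormedByUnitalReps A) {U p : A} (h : UnitaryProj U p) :
    Aup →⋆ₙₐ[ℂ] A :=
  Env.lift repsUP ((freeUP U p : FreeStar GenUP →⋆ₐ[ℂ] A) : FreeStar GenUP →⋆ₙₐ[ℂ] A)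
    (h.norm_freeUP_le hA)

theorem UnitaryProj.lift_of (hA : NormedByUnitalReps A) {U p : A} (h : UnitaryProj U p)
    (x : FreeStar GenUP) : h.lift hA (Env.of repsUP x) = freeUP U p x :=
  Env.lift_of repsUP _ (h.norm_freeUP_le hA) x

theorem UnitaryProj.lift_upU (hA : NormedByUnitalReps A) {U p : A} (h : UnitaryProj U p) :
    h.lift hA upU = U :=
  (h.lift_of hA _).trans (freeUP_u _ _)

theorem UnitaryProj.lift_upP (hA : NormedByUnitalReps A) {U p : A} (h : UnitaryProj U p) :
    h.lift hA upP = p :=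
  (h.lift_of hA _).trans (freeUP_p _ _)

theorem UnitaryProj.lift_one (hA : NormedByUnitalReps A) {U p : A} (h : UnitaryProj U p) :
    h.lift hA 1 = 1 :=
  (h.lift_of hA 1).trans (map_one (freeUP U p))

theorem of_eq_zero_of_mem_relUP {s : FreeStar GenUP} (hs : s ∈ relUP) :
    Env.of repsUP s = 0 := by
  rw [← norm_eq_zero, Env.norm_of]
  refine le_antisymm (repsUP.sup_le le_rfl fun ρ hρ => ?_) (repsUP.sup_nonneg _)
  rw [hρ.2 s hs, norm_zero]

theorem of_eq_zero_of_mem_relUV {θ : ℝ} {s : FreeStar GenUV} (hs : s ∈ relUV θ) :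
    Env.of (repsUV θ) s = 0 := by
  rw [← norm_eq_zero, Env.norm_of]
  refine le_antisymm ((repsUV θ).sup_le le_rfl fun ρ hρ => ?_) ((repsUV θ).sup_nonneg _)
  rw [hρ.2 s hs, norm_zero]

theorem Env.of_sub {R : Type} [NonUnitalRing R] [StarRing R] [Module ℂ R] (F : RepFamily R)
    (x y : R) : Env.of F (x - y) = Env.of F x - Env.of F y :=
  eq_sub_of_add_eq (by rw [← Env.of_add, sub_add_cancel])

/-- The canonical map from star polynomials to `C(S¹) * ℂ²`. -/
def Aup.of (x : FreeStar GenUP) : Aup := Env.of repsUP x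

theorem Aup.of_add (x y : FreeStar GenUP) : Aup.of (x + y) = Aup.of x + Aup.of y :=
  Env.of_add repsUP x y

theorem Aup.of_smul (c : ℂ) (x : FreeStar GenUP) : Aup.of (c • x) = c • Aup.of x :=
  Env.of_smul repsUP c x

theorem Aup.of_mul (x y : FreeStar GenUP) : Aup.of (x * y) = Aup.of x * Aup.of y :=
  Env.of_mul repsUP x y

theorem Aup.of_star (x : FreeStar GenUP) : Aup.of (star x) = star (Aup.of x) :=
  Env.of_star repsUP x

theorem continuous_starHom {A B : Type} [NonUnitalCStarAlgebra A] [NonUnitalCStarAlgebra B]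
    (f : A →⋆ₙₐ[ℂ] B) : Continuous f :=
  AddMonoidHomClass.continuous_of_bound f 1 fun x => by
    rw [one_mul]; exact NonUnitalStarAlgHom.norm_apply_le f x

theorem unitaryProj_up : UnitaryProj upU upP where
  star_mul := by
    have h := of_eq_zero_of_mem_relUP (s := star (FreeStar.x .u) * FreeStar.x .u - 1)
      (by simp [relUP])
    rw [Env.of_sub, Env.of_mul, Env.of_star] at h
    exact sub_eq_zero.1 h
  mul_star := by
    have h := of_eq_zero_of_mem_relUP (s := FreeStar.x .u * star (FreeStar.x .u) - 1)
      (by simp [relUP])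
    rw [Env.of_sub, Env.of_mul, Env.of_star] at h
    exact sub_eq_zero.1 h
  star_p := by
    have h := of_eq_zero_of_mem_relUP (s := star (FreeStar.x .p) - FreeStar.x .p)
      (by simp [relUP])
    rw [Env.of_sub, Env.of_star] at h
    exact sub_eq_zero.1 h
  mul_p := by
    have h := of_eq_zero_of_mem_relUP
      (s := FreeStar.x .p * FreeStar.x .p - FreeStar.x .p) (by simp [relUP])
    rw [Env.of_sub, Env.of_mul] at h
    exact sub_eq_zero.1 h

theorem conj_lam_mul_lam (θ : ℝ) : starRingEnd ℂ (lam θ) * lam θ = 1 := by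
  have h : ‖lam θ‖ = 1 := by
    have : lam θ = Complex.exp (((2 * Real.pi * θ : ℝ) : ℂ) * Complex.I) := by
      rw [lam]; push_cast; ring_nf
    rw [this, Complex.norm_exp_ofReal_mul_I]
  rw [mul_comm, Complex.mul_conj, Complex.normSq_eq_norm_sq, h]; simp

theorem twistPair_gen (θ : ℝ) : TwistPair (genU θ) (genV θ) (lam θ) where
  isom_u := by
    have h := of_eq_zero_of_mem_relUV (θ := θ) (s := star (FreeStar.x .u) * FreeStar.x .u - 1)
      (by simp [relUV])
    rw [Env.of_sub, Env.of_mul, Env.of_star] at h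
    exact sub_eq_zero.1 h
  isom_v := by
    have h := of_eq_zero_of_mem_relUV (θ := θ) (s := star (FreeStar.x .v) * FreeStar.x .v - 1)
      (by simp [relUV])
    rw [Env.of_sub, Env.of_mul, Env.of_star] at h
    exact sub_eq_zero.1 h
  comm := by
    have h := of_eq_zero_of_mem_relUV (θ := θ) (s := FreeStar.x GenUV.u * FreeStar.x GenUV.v -
      lam θ • (FreeStar.x GenUV.v * FreeStar.x GenUV.u)) (by simp [relUV])
    rw [Env.of_sub, Env.of_smul, Env.of_mul, Env.of_mul] at h
    exact sub_eq_zero.1 h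
  conj_mul := conj_lam_mul_lam θ

end Universal

/-! ### Model twisted isometries on ℓ²(ℕ, H) -/

section Model

variable {H : Type} [NormedAddCommGroup H]

/-- The Hilbert space `ℓ²(ℕ, H)`. -/
abbrev SeqSpace (H : Type) [NormedAddCommGroup H] : Type := lp (fun _ : ℕ => H) 2

/-- The sequence `(0, ξ₀, ξ₁, …)`. -/
def shiftSeq (ξ : ℕ → H) : ℕ → H
  | 0 => 0
  | i + 1 => ξ i

theorem hasSum_shiftSeq (ξ : SeqSpace H) :
    HasSum (fun i => ‖shiftSeq ξ i‖ ^ (2 : ENNReal).toReal) (‖ξ‖ ^ (2 : ENNReal).toReal) := by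
  rw [← hasSum_nat_add_iff' 1]
  simpa [shiftSeq] using lp.hasSum_norm (p := 2) (by simp) ξ

theorem norm_shiftSeq (ξ : SeqSpace H) :
    ‖(⟨shiftSeq ξ, memℓp_gen (hasSum_shiftSeq ξ).summable⟩ : SeqSpace H)‖ = ‖ξ‖ := by
  set η : SeqSpace H := ⟨shiftSeq ξ, memℓp_gen (hasSum_shiftSeq ξ).summable⟩ with hη
  have h := (lp.hasSum_norm (p := 2) (by simp) η).unique (hasSum_shiftSeq ξ)
  simp only [ENNReal.toReal_ofNat, Real.rpow_ofNat] at h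
  exact (sq_eq_sq₀ (norm_nonneg _) (norm_nonneg _)).1 h

/-- The embedding of `H` as the zeroth coordinate of `ℓ²(ℕ, H)`. -/
def zeroth (x : H) : SeqSpace H := lp.single 2 0 x

theorem norm_zeroth (x : H) : ‖zeroth x‖ = ‖x‖ := lp.norm_single (E := fun _ : ℕ => H) (p := 2) (by norm_num) 0 x

theorem zeroth_sub (x y : H) : zeroth (x - y) = zeroth x - zeroth y := lp.single_sub _ _ _ _

theorem zeroth_add (x y : H) : zeroth (x + y) = zeroth x + zeroth y := lp.single_add _ _ _ _

variable [InnerProductSpace ℂ H]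

/-- The diagonal operator on `ℓ²(ℕ, H)` given by a bounded sequence of operators. -/
def diagOp (f : ℕ → H →L[ℂ] H) (C : ℝ) (hf : ∀ i, ‖f i‖ ≤ C) : SeqSpace H →L[ℂ] SeqSpace H :=
  have hC : 0 ≤ C := (norm_nonneg _).trans (hf 0)
  have hb : ∀ (ξ : SeqSpace H) i, ‖f i (ξ i)‖ ^ (2 : ENNReal).toReal ≤
      C ^ 2 * ‖ξ i‖ ^ (2 : ENNReal).toReal := fun ξ i => by
    have h := (f i).le_of_opNorm_le (hf i) (ξ i)
    simp only [ENNReal.toReal_ofNat, Real.rpow_ofNat]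
    rw [← mul_pow]
    gcongr
  have hs : ∀ ξ : SeqSpace H, Summable fun i => C ^ 2 * ‖ξ i‖ ^ (2 : ENNReal).toReal := fun ξ =>
    ((lp.memℓp ξ).summable (by simp)).mul_left _
  LinearMap.mkContinuous
    { toFun := fun ξ => ⟨fun i => f i (ξ i), memℓp_gen
        (Summable.of_nonneg_of_le (fun i => by positivity) (hb ξ) (hs ξ))⟩
      map_add' := fun ξ η => lp.ext (funext fun i => map_add (f i) (ξ i) (η i))
      map_smul' := fun c ξ => lp.ext (funext fun i => map_smul (f i) c (ξ i)) } C
    (fun ξ => by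
      refine lp.norm_le_of_forall_sum_le (by simp) (by positivity) fun s => ?_
      refine (Finset.sum_le_sum fun i _ => hb ξ i).trans ?_
      have h := lp.norm_rpow_eq_tsum (p := 2) (by simp) ξ
      rw [← Finset.mul_sum, Real.mul_rpow hC (norm_nonneg _), h]
      simp only [ENNReal.toReal_ofNat, Real.rpow_ofNat]
      gcongr
      have h' := (lp.memℓp ξ).summable (p := 2) (by simp)
      simp only [ENNReal.toReal_ofNat, Real.rpow_ofNat] at h'
      exact h'.sum_le_tsum s fun i _ => by positivity)

theorem diagOp_apply (f : ℕ → H →L[ℂ] H) (C : ℝ) (hf : ∀ i, ‖f i‖ ≤ C) (ξ : SeqSpace H) (i : ℕ) :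
    diagOp f C hf ξ i = f i (ξ i) := rfl

/-- The unilateral shift on `ℓ²(ℕ, H)` as a linear isometry. -/
def shiftIsometry (H : Type) [NormedAddCommGroup H] [InnerProductSpace ℂ H] :
    SeqSpace H →ₗᵢ[ℂ] SeqSpace H where
  toFun ξ := ⟨shiftSeq ξ, memℓp_gen (hasSum_shiftSeq ξ).summable⟩
  map_add' _ _ := lp.ext <| funext fun
    | 0 => (add_zero (0 : H)).symm
    | _ + 1 => rfl
  map_smul' c _ := lp.ext <| funext fun
    | 0 => (smul_zero c).symm
    | _ + 1 => rfl
  norm_map' := norm_shiftSeq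

/-- The unilateral shift on `ℓ²(ℕ, H)`. -/
def shiftOp (H : Type) [NormedAddCommGroup H] [InnerProductSpace ℂ H] :
    SeqSpace H →L[ℂ] SeqSpace H :=
  (shiftIsometry H).toContinuousLinearMap

theorem shiftOp_zero (ξ : SeqSpace H) : shiftOp H ξ 0 = 0 := rfl

theorem shiftOp_succ (ξ : SeqSpace H) (i : ℕ) : shiftOp H ξ (i + 1) = ξ i := rfl

theorem zeroth_smul (c : ℂ) (x : H) : zeroth (c • x) = c • zeroth x := lp.single_smul _ _ _ _

theorem zeroth_zero : zeroth (0 : H) = 0 := by simpa using zeroth_smul 0 (0 : H)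

theorem diagOp_zeroth (f : ℕ → H →L[ℂ] H) (C : ℝ) (hf : ∀ i, ‖f i‖ ≤ C) (x : H) :
    diagOp f C hf (zeroth x) = zeroth (f 0 x) := by
  refine lp.ext (funext fun i => ?_)
  rw [diagOp_apply, zeroth, zeroth, lp.single_apply, lp.single_apply]
  rcases i with _ | i
  · simp
  · simp

variable [CompleteSpace H]

theorem star_diagOp (f : ℕ → H →L[ℂ] H) (C : ℝ) (hf : ∀ i, ‖f i‖ ≤ C) :
    star (diagOp f C hf) =
      diagOp (fun i => star (f i)) C (fun i => (norm_star (f i)).trans_le (hf i)) := by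
  symm
  refine (ContinuousLinearMap.eq_adjoint_iff _ _).2 fun ξ η => ?_
  rw [lp.inner_eq_tsum, lp.inner_eq_tsum]
  exact tsum_congr fun i => ContinuousLinearMap.adjoint_inner_left (f i) (η i) (ξ i)

theorem star_shiftOp_mul : star (shiftOp H) * shiftOp H = 1 :=
  (ContinuousLinearMap.norm_map_iff_adjoint_comp_self _).1 fun ξ =>
    (shiftIsometry H).norm_map ξ

theorem star_shiftOp_zeroth (x : H) : star (shiftOp H) (zeroth x) = 0 := by
  refine ext_inner_right ℂ fun η => ?_
  have : ⟪star (shiftOp H) (zeroth x), η⟫_ℂ = ⟪zeroth x, shiftOp H η⟫_ℂ :=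
    ContinuousLinearMap.adjoint_inner_left _ _ _
  rw [this, zeroth, lp.inner_single_left, shiftOp_zero, inner_zero_right, inner_zero_left]

/-- Two operators `a`, `b` for which the sum `a + b` is a unitary, such that `a* b = 0` and
`a b* = 0`. -/
structure UnitarySplit (a b : H →L[ℂ] H) : Prop where
  star_mul_eq : star a * b = 0
  mul_star_eq : a * star b = 0
  star_add_eq : star a * a + star b * b = 1
  add_star_eq : a * star a + b * star b = 1

theorem norm_pow_smul_le {l : ℂ} (hl : ‖l‖ = 1) (a : H →L[ℂ] H) (i : ℕ) : ‖l ^ i • a‖ ≤ ‖a‖ := by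
  rw [norm_smul, norm_pow, hl, one_pow, one_mul]

/-- The model isometry `∑ l^i (a ⊗ e_{ii} + b ⊗ e_{i+1,i})`. -/
def modelU (a b : H →L[ℂ] H) {l : ℂ} (hl : ‖l‖ = 1) : SeqSpace H →L[ℂ] SeqSpace H :=
  diagOp (fun i => l ^ i • a) ‖a‖ (norm_pow_smul_le hl a) +
    shiftOp H * diagOp (fun i => l ^ i • b) ‖b‖ (norm_pow_smul_le hl b)

theorem star_modelU (a b : H →L[ℂ] H) {l : ℂ} (hl : ‖l‖ = 1) :
    star (modelU a b hl) = star (diagOp (fun i => l ^ i • a) ‖a‖ (norm_pow_smul_le hl a)) +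
      star (diagOp (fun i => l ^ i • b) ‖b‖ (norm_pow_smul_le hl b)) * star (shiftOp H) := by
  rw [modelU, star_add, star_mul]

theorem modelU_apply_zero (a b : H →L[ℂ] H) {l : ℂ} (hl : ‖l‖ = 1) (ξ : SeqSpace H) :
    modelU a b hl ξ 0 = a (ξ 0) := by
  have : modelU a b hl ξ 0 = (l ^ 0 • a) (ξ 0) + 0 := rfl
  rw [this]; simp

theorem modelU_apply_succ (a b : H →L[ℂ] H) {l : ℂ} (hl : ‖l‖ = 1) (ξ : SeqSpace H) (i : ℕ) :
    modelU a b hl ξ (i + 1) = l ^ (i + 1) • a (ξ (i + 1)) + l ^ i • b (ξ i) := rfl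

theorem modelU_zeroth (a b : H →L[ℂ] H) {l : ℂ} (hl : ‖l‖ = 1) (x : H) :
    modelU a b hl (zeroth x) = zeroth (a x) + shiftOp H (zeroth (b x)) := by
  rw [modelU, add_apply, clm_mul_apply, diagOp_zeroth, diagOp_zeroth]; simp

theorem star_modelU_zeroth (a b : H →L[ℂ] H) {l : ℂ} (hl : ‖l‖ = 1) (x : H) :
    star (modelU a b hl) (zeroth x) = zeroth (star a x) := by
  rw [star_modelU, add_apply, clm_mul_apply, star_shiftOp_zeroth, map_zero, add_zero, star_diagOp,
    diagOp_zeroth]; simp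

/-- Write the operator as d + se with d, e diagonal and s the shift. The cross terms contain a*b or
its adjoint and vanish; the diagonal terms add up to a*a + b*b = 1, the scalars having modulus one.
-/
theorem UnitarySplit.star_modelU_mul {a b : H →L[ℂ] H} (h : UnitarySplit a b) {l : ℂ}
    (hl : ‖l‖ = 1) : star (modelU a b hl) * modelU a b hl = 1 := by
  have hl' : starRingEnd ℂ l * l = 1 := by
    rw [mul_comm, Complex.mul_conj, Complex.normSq_eq_norm_sq, hl]; simp
  set d := diagOp (fun i => l ^ i • a) ‖a‖ (norm_pow_smul_le hl a) with hd
  set e := diagOp (fun i => l ^ i • b) ‖b‖ (norm_pow_smul_le hl b) with he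
  have cross : star d * shiftOp H * e = 0 := by
    ext1 ξ
    refine lp.ext (funext fun i => ?_)
    rw [clm_mul_apply, clm_mul_apply, hd, star_diagOp, diagOp_apply]
    rcases i with _ | i
    · rw [shiftOp_zero, map_zero]; rfl
    · rw [shiftOp_succ, he, diagOp_apply]
      have := congrArg (fun T : H →L[ℂ] H => T (ξ i)) h.star_mul_eq
      simp only [clm_mul_apply, zero_apply] at this
      simp [this]
  have cross' : star e * star (shiftOp H) * d = 0 := by
    have := congrArg star cross
    simpa [mul_assoc] using this
  have diag : star d * d + star e * e = 1 := by
    ext1 ξ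
    refine lp.ext (funext fun i => ?_)
    have h1 : (star d * d + star e * e) ξ i =
        star (l ^ i • a) ((l ^ i • a) (ξ i)) + star (l ^ i • b) ((l ^ i • b) (ξ i)) := by
      rw [hd, he, star_diagOp, star_diagOp]; rfl
    have := congrArg (fun T : H →L[ℂ] H => T (ξ i)) h.star_add_eq
    simp only [clm_mul_apply, add_apply, one_apply_eq_self] at this
    rw [h1]
    simp only [star_smul, smul_apply, map_smul, smul_smul, one_apply_eq_self]
    rw [← smul_add, this, star_pow, ← mul_pow, Complex.star_def, mul_comm, hl', one_pow, one_smul]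
  rw [star_modelU, modelU, ← hd, ← he]
  calc (star d + star e * star (shiftOp H)) * (d + shiftOp H * e)
      = (star d * d + star e * (star (shiftOp H) * shiftOp H) * e) + star d * shiftOp H * e +
        star e * star (shiftOp H) * d := by noncomm_ring
    _ = 1 := by rw [star_shiftOp_mul, mul_one, cross, cross', diag, add_zero, add_zero]

/-- The second model isometry is the first one formed from (b*, λ̄a*) and λ̄, so its isometry
property is an instance of the one already proved. -/
theorem UnitarySplit.dual {a b : H →L[ℂ] H} (h : UnitarySplit a b) {l : ℂ} (hl : ‖l‖ = 1) :
    UnitarySplit (star b) (l • star a) where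
  star_mul_eq := by
    have := congrArg star h.mul_star_eq
    rw [star_mul, star_star, star_zero] at this
    rw [star_star, mul_smul_comm, this, smul_zero]
  mul_star_eq := by
    have := congrArg star h.star_mul_eq
    rw [star_mul, star_star, star_zero] at this
    rw [star_smul, star_star, mul_smul_comm, this, smul_zero]
  star_add_eq := by
    have hl' : star l * l = 1 := by
      rw [mul_comm, Complex.star_def, Complex.mul_conj, Complex.normSq_eq_norm_sq, hl]; simp
    rw [star_smul, star_star, star_star, smul_mul_smul_comm, hl', one_smul, add_comm, h.add_star_eq]
  add_star_eq := by
    have hl' : l * star l = 1 := by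
      rw [Complex.star_def, Complex.mul_conj, Complex.normSq_eq_norm_sq, hl]; simp
    rw [star_smul, star_star, star_star, smul_mul_smul_comm, hl', one_smul, add_comm, h.star_add_eq]

/-- The model isometry `∑ l̄^i (b* ⊗ e_{ii} + l̄ a* ⊗ e_{i+1,i})`. -/
def modelV (a b : H →L[ℂ] H) {l : ℂ} (hl : ‖l‖ = 1) : SeqSpace H →L[ℂ] SeqSpace H :=
  modelU (star b) (starRingEnd ℂ l • star a) (l := starRingEnd ℂ l) (by simpa using hl)

/-- The diagonal part of the product contains ab* and the part raising degree by two contains ba*;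
both vanish. In the part raising degree by one the scalars cancel and leave aa* + bb* = 1. In the
opposite order a factor λ̄ survives, which gives the twist. -/
theorem UnitarySplit.modelU_mul_modelV {a b : H →L[ℂ] H} (h : UnitarySplit a b) {l : ℂ}
    (hl : ‖l‖ = 1) : modelU a b hl * modelV a b hl = shiftOp H := by
  have hl' : l * starRingEnd ℂ l = 1 := by
    rw [Complex.mul_conj, Complex.normSq_eq_norm_sq, hl]; simp
  have e1 : ∀ x, a (star b x) = 0 := fun x =>
    congrArg (fun T : H →L[ℂ] H => T x) h.mul_star_eq
  have e2 : ∀ x, b (star a x) = 0 := fun x => by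
    have := congrArg star h.mul_star_eq
    rw [star_mul, star_star, star_zero] at this
    exact congrArg (fun T : H →L[ℂ] H => T x) this
  have e3 : ∀ x, a (star a x) + b (star b x) = x := fun x =>
    congrArg (fun T : H →L[ℂ] H => T x) h.add_star_eq
  have e4 : ∀ i, l ^ i * starRingEnd ℂ l ^ i = 1 := fun i => by rw [← mul_pow, hl', one_pow]
  have e5 : ∀ (ξ : SeqSpace H) i, l ^ i • b (modelV a b hl ξ i) = b (star b (ξ i)) := by
    intro ξ i
    rcases i with _ | i
    · rw [modelV, modelU_apply_zero]; simp
    · rw [modelV, modelU_apply_succ]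
      simp only [map_add, map_smul, smul_apply, e2, smul_zero, add_zero, smul_smul, e4, one_smul]
  ext1 ξ
  refine lp.ext (funext fun i => ?_)
  rw [clm_mul_apply]
  rcases i with _ | i
  · rw [modelU_apply_zero, modelV, modelU_apply_zero, e1, shiftOp_zero]
  · rw [modelU_apply_succ, e5, modelV, modelU_apply_succ, shiftOp_succ]
    simp only [map_add, map_smul, smul_apply, e1, smul_zero, zero_add, smul_smul]
    rw [← pow_succ, e4, one_smul, e3]

theorem UnitarySplit.modelV_mul_modelU {a b : H →L[ℂ] H} (h : UnitarySplit a b) {l : ℂ}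
    (hl : ‖l‖ = 1) : modelV a b hl * modelU a b hl = starRingEnd ℂ l • shiftOp H := by
  have hl' : starRingEnd ℂ l * l = 1 := by
    rw [mul_comm, Complex.mul_conj, Complex.normSq_eq_norm_sq, hl]; simp
  have e1 : ∀ x, star a (b x) = 0 := fun x =>
    congrArg (fun T : H →L[ℂ] H => T x) h.star_mul_eq
  have e2 : ∀ x, star b (a x) = 0 := fun x => by
    have := congrArg star h.star_mul_eq
    rw [star_mul, star_star, star_zero] at this
    exact congrArg (fun T : H →L[ℂ] H => T x) this
  have e3 : ∀ x, star a (a x) + star b (b x) = x := fun x =>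
    congrArg (fun T : H →L[ℂ] H => T x) h.star_add_eq
  have e4 : ∀ i, starRingEnd ℂ l ^ i * l ^ i = 1 := fun i => by rw [← mul_pow, hl', one_pow]
  have e5 : ∀ (ξ : SeqSpace H) i,
      starRingEnd ℂ l ^ i • star a (modelU a b hl ξ i) = star a (a (ξ i)) := by
    intro ξ i
    rcases i with _ | i
    · rw [modelU_apply_zero]; simp
    · rw [modelU_apply_succ]
      simp only [map_add, map_smul, e1, smul_zero, add_zero, smul_smul, e4, one_smul]
  ext1 ξ
  refine lp.ext (funext fun i => ?_)
  have e0 : (starRingEnd ℂ l • shiftOp H) ξ i = starRingEnd ℂ l • shiftOp H ξ i := rfl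
  rw [clm_mul_apply, e0]
  rcases i with _ | i
  · rw [modelV, modelU_apply_zero, modelU_apply_zero, e2, shiftOp_zero, smul_zero]
  · rw [modelV, modelU_apply_succ, smul_apply, smul_comm, e5, modelU_apply_succ, shiftOp_succ]
    simp only [map_add, map_smul, e2, smul_zero, zero_add, smul_smul]
    rw [pow_succ', mul_assoc, e4, mul_one, ← smul_add, add_comm, e3]

end Model

/-! ### The homomorphism from B to the corner PAP -/

section Corner

namespace TwistPair

variable {A : Type} [CStarAlgebra A] {u v : A} {l : ℂ} (h : TwistPair u v l)
include h

theorem unitaryProj : UnitaryProj (cornerU u v + defect (defect (u * v))) (cornerP u v) where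
  star_mul := h.unitary_star_mul
  mul_star := h.unitary_mul_star
  star_p := star_cornerP u v
  mul_p := h.cornerP_mul_cornerP

theorem defect_unit : defect (defect (u * v)) = 1 - defect (u * v) := by
  rw [defect.eq_1 (defect (u * v)), star_defect, defect_mul_defect h.isom_mul]

theorem unit_mul_unit : defect (u * v) * defect (u * v) = defect (u * v) :=
  defect_mul_defect h.isom_mul

variable (hA : NormedByUnitalReps A)

/-- P commutes with the images of both generators, hence with the image of B; this makes cutting
down by P multiplicative. -/
theorem lift_mul_unit (b : Aup) :
    h.unitaryProj.lift hA b * defect (u * v) = defect (u * v) * h.unitaryProj.lift hA b := by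
  set ψ := h.unitaryProj.lift hA with hψ
  have hcont : Continuous ψ := continuous_starHom ψ
  induction b using Aup.induction with
  | hc => exact isClosed_eq (hcont.mul continuous_const) (continuous_const.mul hcont)
  | hu =>
    rw [hψ, UnitaryProj.lift_upU, add_mul, mul_add, h.cornerU_mul_unit, h.unit_mul_cornerU,
      h.defect_unit, sub_mul, mul_sub, one_mul, mul_one]
  | hp => rw [hψ, UnitaryProj.lift_upP, h.cornerP_mul_unit, h.unit_mul_cornerP]
  | h1 => rw [hψ, UnitaryProj.lift_one, one_mul, mul_one]
  | hs c a h => rw [map_smul, smul_mul_assoc, mul_smul_comm, h]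
  | ha a b h h' => rw [map_add, add_mul, mul_add, h, h']
  | hm a b h h' => rw [map_mul, mul_assoc, h', ← mul_assoc, h, mul_assoc]
  | hst a h =>
    have := congrArg star h
    rw [star_mul, star_mul, star_defect] at this
    rw [map_star, this]

/-- The homomorphism from `C(S¹) * ℂ²` to the corner `P A P`, where `P = 1 - (u v) (u v)*`. -/
def cornerMap : Aup →⋆ₙₐ[ℂ] A where
  toFun b := h.unitaryProj.lift hA b * defect (u * v)
  map_smul' c b := by rw [map_smul, smul_mul_assoc]; rfl
  map_zero' := by rw [map_zero, zero_mul]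
  map_add' b c := by rw [map_add, add_mul]
  map_mul' b c := by
    rw [map_mul, mul_assoc, mul_assoc, ← mul_assoc (defect (u * v)), ← h.lift_mul_unit hA c,
      mul_assoc _ (defect (u * v)), h.unit_mul_unit]
  map_star' b := by rw [map_star, star_mul, star_defect, ← map_star, h.lift_mul_unit]

theorem cornerMap_apply (b : Aup) :
    h.cornerMap hA b = h.unitaryProj.lift hA b * defect (u * v) := rfl

theorem cornerMap_upU : h.cornerMap hA upU = cornerU u v := by
  rw [cornerMap_apply, UnitaryProj.lift_upU, add_mul, h.cornerU_mul_unit, h.defect_unit, sub_mul,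
    one_mul, h.unit_mul_unit, sub_self, add_zero]

theorem cornerMap_upP : h.cornerMap hA upP = cornerP u v := by
  rw [cornerMap_apply, UnitaryProj.lift_upP, h.cornerP_mul_unit]

theorem cornerMap_one : h.cornerMap hA 1 = defect (u * v) := by
  rw [cornerMap_apply, UnitaryProj.lift_one, one_mul]

theorem stabilizing : Stabilizing (u * v) (h.cornerMap hA) where
  isom := h.isom_mul
  annihilate b := by
    rw [cornerMap_apply, h.lift_mul_unit, ← mul_assoc, star_mul_defect h.isom_mul, zero_mul]

end TwistPair

end Corner

/-! ### Action of the corner elements of the model on the zeroth coordinate -/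

section ModelAction

variable {H : Type} [NormedAddCommGroup H] [InnerProductSpace ℂ H] [CompleteSpace H]

/-- With this choice a + b = U and b*b = p, so the pair is recovered from the split; these are the
operators by which ū and p̄ of the model act in degree zero. -/
theorem UnitaryProj.unitarySplit {U p : H →L[ℂ] H} (h : UnitaryProj U p) :
    UnitarySplit (U * (1 - p)) (U * p) where
  star_mul_eq := by
    rw [StarMul.star_mul, star_sub, star_one, h.star_p, mul_assoc, ← mul_assoc (star U), h.star_mul,
      one_mul, sub_mul, one_mul, h.mul_p, sub_self]
  mul_star_eq := by
    rw [StarMul.star_mul, h.star_p, mul_assoc, ← mul_assoc (1 - p), sub_mul, one_mul, h.mul_p, sub_self,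
      zero_mul, mul_zero]
  star_add_eq := by
    rw [StarMul.star_mul U, StarMul.star_mul U, star_sub, star_one, h.star_p, mul_assoc, mul_assoc,
      ← mul_assoc (star U), ← mul_assoc (star U), h.star_mul, one_mul, one_mul, mul_sub, sub_mul,
      sub_mul, h.mul_p]
    simp
  add_star_eq := by
    rw [StarMul.star_mul U, StarMul.star_mul U, star_sub, star_one, h.star_p, mul_assoc, mul_assoc,
      ← mul_assoc (1 - p), ← mul_assoc p, ← mul_add, ← add_mul, mul_sub, sub_mul, sub_mul, h.mul_p]
    simp [h.mul_star]

theorem modelV_zeroth (a b : H →L[ℂ] H) {l : ℂ} (hl : ‖l‖ = 1) (x : H) : modelV a b hl (zeroth x) =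
    zeroth (star b x) + shiftOp H (zeroth ((starRingEnd ℂ l • star a) x)) :=
  modelU_zeroth _ _ _ x

theorem star_modelV_zeroth (a b : H →L[ℂ] H) {l : ℂ} (hl : ‖l‖ = 1) (x : H) : star (modelV a b hl) (zeroth x) = zeroth (b x) := by
  rw [modelV, star_modelU_zeroth, star_star]

namespace UnitarySplit

variable {a b : H →L[ℂ] H} (h : UnitarySplit a b)
include h

theorem mul_star_eq' : b * star a = 0 := by
  have := congrArg star h.mul_star_eq
  rwa [star_mul, star_star, star_zero] at this

theorem mul_star_mul : a * star a * a = a := by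
  have := congrArg (a * ·) h.star_add_eq
  simpa [mul_add, ← mul_assoc, h.mul_star_eq] using this

theorem mul_star_mul' : b * star b * b = b := by
  have := congrArg (b * ·) h.star_add_eq
  simpa [mul_add, ← mul_assoc, h.mul_star_eq'] using this

variable {l : ℂ} (hl : ‖l‖ = 1)

theorem defect_modelV_zeroth (x : H) :
    defect (modelV a b hl) (zeroth x) = zeroth ((star a * a) x) := by
  have e : (star a * a) x = x - (star b * b) x := by
    rw [eq_sub_iff_add_eq, ← add_apply, h.star_add_eq]; rfl
  have e' : star a (b x) = 0 := congrArg (fun T : H →L[ℂ] H => T x) h.star_mul_eq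
  rw [defect, sub_apply, clm_mul_apply, star_modelV_zeroth, modelV_zeroth, e, zeroth_sub,
    smul_apply, e', smul_zero, zeroth_zero, map_zero, add_zero]; rfl

theorem defect_modelU_zeroth (x : H) :
    defect (modelU a b hl) (zeroth x) = zeroth ((b * star b) x) := by
  have e : (b * star b) x = x - (a * star a) x := by
    rw [eq_sub_iff_add_eq, ← add_apply, add_comm, h.add_star_eq]; rfl
  have e' : b (star a x) = 0 := congrArg (fun T : H →L[ℂ] H => T x) h.mul_star_eq'
  rw [defect, sub_apply, clm_mul_apply, star_modelU_zeroth, modelU_zeroth, e, zeroth_sub,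
    e', zeroth_zero, map_zero, add_zero]; rfl

/-- Both u and v have a component raising the degree. It is absent here: 1-vv* projects onto the
range of a*a, where b vanishes. -/
theorem cornerU_zeroth (x : H) :
    cornerU (modelU a b hl) (modelV a b hl) (zeroth x) = zeroth ((a + b) x) := by
  have e1 : a ((star a * a) x) = a x :=
    congrArg (fun T : H →L[ℂ] H => T x) h.mul_star_mul
  have e2 : b ((star a * a) x) = 0 := congrArg (fun T : H →L[ℂ] H => T (a x)) h.mul_star_eq'
  have e3 : (b * star b) (b x) = b x := congrArg (fun T : H →L[ℂ] H => T x) h.mul_star_mul'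
  rw [cornerU, add_apply, clm_mul_apply, clm_mul_apply, star_modelV_zeroth,
    h.defect_modelU_zeroth, h.defect_modelV_zeroth, modelU_zeroth, e1, e2, e3, zeroth_zero,
    map_zero, add_zero, ← zeroth_add]; rfl

theorem cornerP_zeroth (x : H) :
    cornerP (modelU a b hl) (modelV a b hl) (zeroth x) = zeroth ((star b * b) x) := by
  have e1 : star a (b x) = 0 := congrArg (fun T : H →L[ℂ] H => T x) h.star_mul_eq
  have e3 : (b * star b) (b x) = b x := congrArg (fun T : H →L[ℂ] H => T x) h.mul_star_mul'
  rw [cornerP, clm_mul_apply, clm_mul_apply, star_modelV_zeroth, h.defect_modelU_zeroth,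
    modelV_zeroth, e3, smul_apply, e1, smul_zero, zeroth_zero, map_zero, add_zero]; rfl

theorem star_cornerU_zeroth (x : H) :
    star (cornerU (modelU a b hl) (modelV a b hl)) (zeroth x) = zeroth (star (a + b) x) := by
  have e1 : (star a * a) (star a x) = star a x := by
    have := congrArg star h.mul_star_mul
    rw [star_mul, star_mul, star_star, ← mul_assoc] at this
    exact congrArg (fun T : H →L[ℂ] H => T x) this
  have e2 : star a ((b * star b) x) = 0 :=
    congrArg (fun T : H →L[ℂ] H => T (star b x)) h.star_mul_eq
  have e3 : star b ((b * star b) x) = star b x := by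
    have := congrArg star h.mul_star_mul'
    rw [star_mul, star_mul, star_star] at this
    exact congrArg (fun T : H →L[ℂ] H => T x) this
  rw [star_cornerU, add_apply, clm_mul_apply, clm_mul_apply, star_modelU_zeroth,
    h.defect_modelU_zeroth, h.defect_modelV_zeroth, modelV_zeroth, e1, smul_apply, e2, e3,
    smul_zero, zeroth_zero, map_zero, add_zero, ← zeroth_add, star_add]; rfl

theorem defect_mul_zeroth (x : H) :
    defect (modelU a b hl * modelV a b hl) (zeroth x) = zeroth x := by
  rw [h.modelU_mul_modelV hl, defect, sub_apply, clm_mul_apply, star_shiftOp_zeroth, map_zero,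
    sub_zero]; rfl

theorem twistPair : TwistPair (modelU a b hl) (modelV a b hl) l where
  isom_u := h.star_modelU_mul hl
  isom_v := (h.dual (l := starRingEnd ℂ l) (by simpa using hl)).star_modelU_mul _
  comm := by
    rw [h.modelU_mul_modelV, h.modelV_mul_modelU, smul_smul, Complex.mul_conj,
      Complex.normSq_eq_norm_sq, hl]
    simp
  conj_mul := by
    rw [mul_comm, Complex.mul_conj, Complex.normSq_eq_norm_sq, hl]; simp

end UnitarySplit

end ModelAction

/-! ### Injectivity of the map from B to the corner -/

section Injectivity

variable {K : Type} [NormedAddCommGroup K] [InnerProductSpace ℂ K] [CompleteSpace K]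

/-- The star homomorphism on the free star algebra defined by two operators. -/
def freeUV (U V : K →L[ℂ] K) : FreeStar GenUV →⋆ₐ[ℂ] (K →L[ℂ] K) :=
  FreeStar.lift fun g => match g with | .u => U | .v => V

theorem freeUV_u (U V : K →L[ℂ] K) : freeUV U V (FreeStar.x .u) = U := FreeStar.lift_x _ _

theorem freeUV_v (U V : K →L[ℂ] K) : freeUV U V (FreeStar.x .v) = V := FreeStar.lift_x _ _

/-- The representation defined by a pair of twisted isometries. -/
def repUV (U V : K →L[ℂ] K) : Rep (FreeStar GenUV) :=
  ⟨K, ((freeUV U V : FreeStar GenUV →⋆ₐ[ℂ] (K →L[ℂ] K)) :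
    FreeStar GenUV →⋆ₙₐ[ℂ] (K →L[ℂ] K))⟩

theorem TwistPair.repUV_mem {U V : K →L[ℂ] K} {θ : ℝ} (h : TwistPair U V (lam θ)) :
    repUV U V ∈ (repsUV θ).reps := by
  refine ⟨map_one (freeUV U V), fun s hs => ?_⟩
  change freeUV U V s = 0
  have e (a) : freeUV U V (star a) = star (freeUV U V a) := map_star (freeUV U V) a
  rcases hs with rfl | rfl | rfl <;>
    simp only [map_sub, map_mul, map_one, map_smul, e, freeUV_u, freeUV_v, h.isom_u, h.isom_v,
      ← h.comm, sub_self]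

/-- The representation of the free twist defined by a pair of twisted isometries. -/
def TwistPair.rep {U V : K →L[ℂ] K} {θ : ℝ} (h : TwistPair U V (lam θ)) :
    Afree θ →⋆ₙₐ[ℂ] (K →L[ℂ] K) :=
  Env.rep (repsUV θ) h.repUV_mem

theorem TwistPair.rep_genU {U V : K →L[ℂ] K} {θ : ℝ} (h : TwistPair U V (lam θ)) :
    h.rep (genU θ) = U :=
  (Env.rep_of (repsUV θ) h.repUV_mem _).trans (freeUV_u U V)

theorem TwistPair.rep_genV {U V : K →L[ℂ] K} {θ : ℝ} (h : TwistPair U V (lam θ)) :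
    h.rep (genV θ) = V :=
  (Env.rep_of (repsUV θ) h.repUV_mem _).trans (freeUV_v U V)

theorem TwistPair.rep_one {U V : K →L[ℂ] K} {θ : ℝ} (h : TwistPair U V (lam θ)) :
    h.rep 1 = 1 :=
  (Env.rep_of (repsUV θ) h.repUV_mem 1).trans (map_one (freeUV U V))

theorem unitaryProj_of_mem {σ : Rep (FreeStar GenUP)} (hσ : σ ∈ repsUP.reps) :
    UnitaryProj (σ.π (FreeStar.x .u)) (σ.π (FreeStar.x .p)) where
  star_mul := by
    have := hσ.2 (star (FreeStar.x .u) * FreeStar.x .u - 1) (by simp [relUP])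
    rwa [map_sub, map_mul, map_star, hσ.1, sub_eq_zero] at this
  mul_star := by
    have := hσ.2 (FreeStar.x .u * star (FreeStar.x .u) - 1) (by simp [relUP])
    rwa [map_sub, map_mul, map_star, hσ.1, sub_eq_zero] at this
  star_p := by
    have := hσ.2 (star (FreeStar.x .p) - FreeStar.x .p) (by simp [relUP])
    rwa [map_sub, map_star, sub_eq_zero] at this
  mul_p := by
    have := hσ.2 (FreeStar.x .p * FreeStar.x .p - FreeStar.x .p) (by simp [relUP])
    rwa [map_sub, map_mul, sub_eq_zero] at this

theorem norm_lam (θ : ℝ) : ‖lam θ‖ = 1 := by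
  have : lam θ = Complex.exp (((2 * Real.pi * θ : ℝ) : ℂ) * Complex.I) := by
    rw [lam]; push_cast; ring_nf
  rw [this, Complex.norm_exp_ofReal_mul_I]

/-- The homomorphism from `C(S¹) * ℂ²` to the corner of the free twist. -/
def corner (θ : ℝ) : Aup →⋆ₙₐ[ℂ] Afree θ :=
  (twistPair_gen θ).cornerMap (normedByUnitalReps_Afree θ)

/-- The representation of A built from the model of σ restricts, through `corner`, to σ on the
zeroth coordinate, which is an isometric copy of the space of σ; representations of A are
contractive. -/
theorem norm_rep_le_norm_corner (θ : ℝ) {σ : Rep (FreeStar GenUP)} (hσ : σ ∈ repsUP.reps)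
    (x : FreeStar GenUP) : ‖σ.π x‖ ≤ ‖corner θ (Aup.of x)‖ := by
  have hup := unitaryProj_of_mem hσ
  set U := σ.π (FreeStar.x .u)
  set p := σ.π (FreeStar.x .p)
  have hs := hup.unitarySplit
  have hm := hs.twistPair (norm_lam θ)
  set ρ := hm.rep with hρ
  have hrep : ∀ a, ρ (defect a) = defect (ρ a) := fun a => by
    rw [defect, map_sub, hρ, hm.rep_one, map_mul, map_star]; rfl
  set ψ := (twistPair_gen θ).unitaryProj.lift (normedByUnitalReps_Afree θ) with hψ
  have hP : ∀ ξ, ρ (defect (genU θ * genV θ)) (zeroth ξ) = zeroth ξ := fun ξ => by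
    rw [hrep, map_mul, hρ, hm.rep_genU, hm.rep_genV, hs.defect_mul_zeroth]
  have hab : U * (1 - p) + U * p = U := by rw [← mul_add, sub_add_cancel, mul_one]
  have hbb : star (U * p) * (U * p) = p := by
    rw [star_mul, hup.star_p, mul_assoc, ← mul_assoc (star U), hup.star_mul, one_mul, hup.mul_p]
  have hcU : ρ (cornerU (genU θ) (genV θ)) = cornerU (modelU (U * (1 - p)) (U * p) (norm_lam θ))
      (modelV (U * (1 - p)) (U * p) (norm_lam θ)) := by
    rw [cornerU, map_add, map_mul, map_mul, map_star, hrep, hrep, hρ, hm.rep_genU, hm.rep_genV]; rfl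
  have hcP : ρ (cornerP (genU θ) (genV θ)) = cornerP (modelU (U * (1 - p)) (U * p) (norm_lam θ))
      (modelV (U * (1 - p)) (U * p) (norm_lam θ)) := by
    rw [cornerP, map_mul, map_mul, map_star, hrep, hρ, hm.rep_genU, hm.rep_genV]; rfl
  have hd : ∀ ξ, ρ (defect (defect (genU θ * genV θ))) (zeroth ξ) = 0 := fun ξ => by
    rw [(twistPair_gen θ).defect_unit, map_sub, hρ, hm.rep_one, ← hρ, sub_apply, hP]
    exact sub_self _
  -- The action of y on the zeroth coordinate does not by itself determine that of y*, so both are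
  -- tracked in the induction.
  have key : ∀ y : FreeStar GenUP, ∀ ξ,
      ρ (ψ (Aup.of y)) (zeroth ξ) = zeroth (σ.π y ξ) ∧
      ρ (ψ (Aup.of (star y))) (zeroth ξ) = zeroth (σ.π (star y) ξ) := by
    intro y
    induction y using FreeStar.ind with
    | hx g =>
      intro ξ
      cases g with
      | u =>
        constructor
        · change ρ (ψ upU) (zeroth ξ) = _
          rw [hψ, UnitaryProj.lift_upU, map_add, add_apply, hd, hcU, hs.cornerU_zeroth, hab,
            add_zero]
        · rw [Aup.of_star]
          change ρ (ψ (star upU)) (zeroth ξ) = _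
          have hds : star (defect (defect (genU θ * genV θ))) = defect (defect (genU θ * genV θ)) :=
            star_defect _
          rw [map_star, hψ, UnitaryProj.lift_upU, star_add, map_add, add_apply, hds, hd,
            map_star, hcU, hs.star_cornerU_zeroth, hab, add_zero, map_star]
      | p =>
        have h1 : ρ (ψ (Aup.of (FreeStar.x .p))) (zeroth ξ) = zeroth (p ξ) := by
          change ρ (ψ upP) (zeroth ξ) = _
          rw [hψ, UnitaryProj.lift_upP, hcP, hs.cornerP_zeroth, hbb]
        refine ⟨h1, ?_⟩
        have e : Aup.of (star (FreeStar.x .p)) = Aup.of (FreeStar.x .p) := by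
          rw [Aup.of_star]; exact unitaryProj_up.star_p
        rw [e, h1, map_star, hup.star_p]
    | h1 =>
      intro ξ
      have h1 : ρ (ψ (Aup.of 1)) (zeroth ξ) = zeroth (σ.π 1 ξ) := by
        change ρ (ψ 1) (zeroth ξ) = _
        rw [hψ, UnitaryProj.lift_one, hρ, hm.rep_one, hσ.1]; rfl
      rw [star_one]
      exact ⟨h1, h1⟩
    | hs c a h =>
      intro ξ
      rw [star_smul, Aup.of_smul, Aup.of_smul, map_smul, map_smul, map_smul, map_smul, map_smul,
        map_smul, smul_apply, smul_apply, smul_apply, smul_apply, (h ξ).1, (h ξ).2, zeroth_smul,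
        zeroth_smul]
      exact ⟨rfl, rfl⟩
    | ha a b h h' =>
      intro ξ
      rw [star_add, Aup.of_add, Aup.of_add, map_add, map_add, map_add, map_add, map_add,
        map_add, add_apply, add_apply, add_apply, add_apply, (h ξ).1, (h ξ).2, (h' ξ).1,
        (h' ξ).2, zeroth_add, zeroth_add]
      exact ⟨rfl, rfl⟩
    | hm a b h h' =>
      intro ξ
      rw [star_mul, Aup.of_mul, Aup.of_mul, map_mul, map_mul, map_mul, map_mul, map_mul,
        map_mul, clm_mul_apply, clm_mul_apply, clm_mul_apply, clm_mul_apply, (h ξ).2, (h' ξ).1,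
        (h _).1, (h' _).2]
      exact ⟨rfl, rfl⟩
    | hst a h =>
      intro ξ
      rw [star_star]
      exact ⟨(h ξ).2, (h ξ).1⟩
  refine ContinuousLinearMap.opNorm_le_bound _ (norm_nonneg _) fun ξ => ?_
  have e : ρ (corner θ (Aup.of x)) (zeroth ξ) = zeroth (σ.π x ξ) := by
    rw [corner, TwistPair.cornerMap_apply, map_mul, clm_mul_apply, hP, (key x ξ).1]
  rw [← norm_zeroth, ← e, ← norm_zeroth ξ]
  exact ContinuousLinearMap.le_of_opNorm_le _ (NonUnitalStarAlgHom.norm_apply_le ρ _) _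

theorem norm_le_norm_corner (θ : ℝ) (b : Aup) : ‖b‖ ≤ ‖corner θ b‖ := by
  have hc : Continuous (corner θ) := continuous_starHom (corner θ)
  refine Env.ind repsUP (p := fun b : Aup => ‖b‖ ≤ ‖corner θ b‖)
    (isClosed_le continuous_norm hc.norm) (fun x => ?_) b
  refine (Env.norm_of repsUP x).trans_le ?_
  exact repsUP.sup_le (norm_nonneg _) fun σ hσ => norm_rep_le_norm_corner θ hσ x

theorem corner_injective (θ : ℝ) : Function.Injective (corner θ) :=
  (injective_iff_map_eq_zero _).2 fun b hb => by
    have := norm_le_norm_corner θ b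
    rw [hb, norm_zero] at this
    exact norm_le_zero_iff.1 this

end Injectivity

/-! ### The embedding of B ⊗ K in A, its image, and ideals -/

section Canonical

variable (θ : ℝ)

theorem corner_upU : corner θ upU = cornerU (genU θ) (genV θ) :=
  (twistPair_gen θ).cornerMap_upU (normedByUnitalReps_Afree θ)

theorem corner_upP : corner θ upP = cornerP (genU θ) (genV θ) :=
  (twistPair_gen θ).cornerMap_upP (normedByUnitalReps_Afree θ)

theorem corner_one : corner θ 1 = defect (genU θ * genV θ) :=
  (twistPair_gen θ).cornerMap_one (normedByUnitalReps_Afree θ)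

theorem corner_compl : corner θ (1 - upP) = defect (genV θ) := by
  rw [map_sub, corner_one, corner_upP, (twistPair_gen θ).defect_v_eq]

theorem stabilizing_corner : Stabilizing (genU θ * genV θ) (corner θ) :=
  (twistPair_gen θ).stabilizing (normedByUnitalReps_Afree θ)

theorem unit_mul_corner (b : Aup) : defect (genU θ * genV θ) * corner θ b = corner θ b := by
  rw [← corner_one, ← map_mul, one_mul]

/-- The embedding of `(C(S¹) * ℂ²) ⊗ K` in the free twist. -/
def canon : CTensor Aup Compacts →⋆ₙₐ[ℂ] Afree θ :=
  (stabilizing_corner θ).matrixHom (normedByUnitalReps_Afree θ).normedByReps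

theorem canon_injective : Function.Injective (canon θ) :=
  (stabilizing_corner θ).matrixHom_injective _ (corner_injective θ)

theorem canon_unitCompact (b : Aup) (i j : ℕ) :
    canon θ (CTensor.tmul b (unitCompact i j)) = slot (genU θ * genV θ) (corner θ) i j b :=
  (stabilizing_corner θ).matrixHom_unitCompact _ b i j

/-- The elements `a` for which every `a (u v)^i P` has the form `∑ (u v)^k d_k` with two terms and
`d_k` in the corner. -/
def ShiftBounded (a : Afree θ) : Prop :=
  ∀ i : ℕ, ∃ (k k' : ℕ) (d d' : Aup), a * (genU θ * genV θ) ^ i * defect (genU θ * genV θ) =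
    (genU θ * genV θ) ^ k * corner θ d + (genU θ * genV θ) ^ k' * corner θ d'

variable {θ}

theorem ShiftBounded.mul_slot {a : Afree θ} (ha : ShiftBounded θ a) (i j : ℕ) :
    ∃ (k k' : ℕ) (d d' : Aup), ∀ b, a * slot (genU θ * genV θ) (corner θ) i j b =
      slot (genU θ * genV θ) (corner θ) k j (d * b) +
        slot (genU θ * genV θ) (corner θ) k' j (d' * b) := by
  obtain ⟨k, k', d, d', h⟩ := ha i
  refine ⟨k, k', d, d', fun b => ?_⟩
  have e : a * slot (genU θ * genV θ) (corner θ) i j b =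
      a * (genU θ * genV θ) ^ i * defect (genU θ * genV θ) * corner θ b *
        star (genU θ * genV θ) ^ j := by
    rw [mul_assoc _ (defect _), unit_mul_corner, slot]; simp only [mul_assoc]
  rw [e, h]
  simp only [slot, map_mul, add_mul, mul_assoc]

/-- Adjoint of the preceding formula. It is stated for all b, so right multiplication can be treated
for ideals of B not known to be self-adjoint. -/
theorem ShiftBounded.slot_mul {a : Afree θ} (ha : ShiftBounded θ a) (i j : ℕ) :
    ∃ (k k' : ℕ) (d d' : Aup), ∀ b, slot (genU θ * genV θ) (corner θ) i j b * star a =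
      slot (genU θ * genV θ) (corner θ) i k (b * d) +
        slot (genU θ * genV θ) (corner θ) i k' (b * d') := by
  obtain ⟨k, k', d, d', h⟩ := ha.mul_slot j i
  refine ⟨k, k', star d, star d', fun b => ?_⟩
  have := congrArg star (h (star b))
  simpa only [star_mul, star_add, star_slot, star_star] using this

variable (θ)

theorem shiftBounded_genU : ShiftBounded θ (genU θ) := fun i => by
  have h := twistPair_gen θ
  refine ⟨i, i + 1, lam θ ^ i • (upU * (1 - upP)), lam θ ^ i • (upU * upP), ?_⟩
  rw [h.u_mul_pow, smul_mul_assoc, mul_assoc _ (genU θ) (defect _), h.u_mul_unit, map_smul, map_smul, map_mul,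
    map_mul, corner_compl, corner_upU, corner_upP, mul_smul_comm, mul_smul_comm, ← smul_add,
    mul_add, pow_succ, mul_assoc (_ ^ i)]

theorem shiftBounded_genV : ShiftBounded θ (genV θ) := fun i => by
  have h := twistPair_gen θ
  refine ⟨i, i + 1, starRingEnd ℂ (lam θ) ^ i • (upP * star upU),
    starRingEnd ℂ (lam θ) ^ (i + 1) • ((1 - upP) * star upU), ?_⟩
  rw [h.v_mul_pow, smul_mul_assoc, mul_assoc _ (genV θ) (defect _), h.v_mul_unit, map_smul, map_smul, map_mul,
    map_mul, map_star, corner_compl, corner_upU, corner_upP, mul_smul_comm, mul_smul_comm,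
    pow_succ (starRingEnd ℂ (lam θ)), mul_smul, ← smul_add, mul_add, mul_smul_comm, pow_succ (_ * _),
    mul_assoc (_ ^ i)]

theorem shiftBounded_star_genU : ShiftBounded θ (star (genU θ)) := fun i => by
  have h := twistPair_gen θ
  rcases i with _ | i
  -- In degree zero u*P is already in the corner and the second term is a dummy; in positive degree
  -- u*w = v reduces to the case of v.
  · refine ⟨0, 0, (1 - upP) * star upU, 0, ?_⟩
    rw [pow_zero, mul_one, h.star_u_mul_unit, map_mul, map_star, corner_compl, corner_upU, map_zero]
    simp
  · rw [pow_succ', ← mul_assoc, h.star_u_mul]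
    exact shiftBounded_genV θ i

theorem shiftBounded_star_genV : ShiftBounded θ (star (genV θ)) := fun i => by
  have h := twistPair_gen θ
  rcases i with _ | i
  · refine ⟨0, 0, upU * upP, 0, ?_⟩
    rw [pow_zero, mul_one, h.star_v_mul_unit, map_mul, corner_upU, corner_upP, map_zero]
    simp
  · rw [pow_succ', ← mul_assoc, h.star_v_mul]
    obtain ⟨k, k', d, d', e⟩ := shiftBounded_genU θ i
    refine ⟨k, k', lam θ • d, lam θ • d', ?_⟩
    rw [smul_mul_assoc, smul_mul_assoc, e, smul_add, map_smul, map_smul, mul_smul_comm,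
      mul_smul_comm]

/-- Induction on closed subspaces containing `I ⊗ K`. -/
theorem idealTensor_le {I : TwoSidedIdeal Aup} {M : Submodule ℂ (CTensor Aup Compacts)}
    (hM : IsClosed (M : Set (CTensor Aup Compacts)))
    (h : ∀ b ∈ I, ∀ i j, CTensor.tmul b (unitCompact i j) ∈ M) : idealTensor I ≤ M := by
  refine Submodule.topologicalClosure_minimal _ (Submodule.span_le.2 ?_) hM
  rintro _ ⟨a, ha, k, rfl⟩
  exact CTensor.tmul_mem_of_unitCompact hM (h a ha) k

theorem tmul_mem_idealTensor {I : TwoSidedIdeal Aup} {b : Aup} (hb : b ∈ I) (T : Compacts) :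
    CTensor.tmul b T ∈ idealTensor I :=
  Submodule.le_topologicalClosure _ (Submodule.subset_span ⟨b, hb, T, rfl⟩)

theorem isClosed_idealTensor (I : TwoSidedIdeal Aup) :
    IsClosed (idealTensor I : Set (CTensor Aup Compacts)) :=
  Submodule.isClosed_topologicalClosure _

/-- The image of `I ⊗ K` in the free twist. -/
def imageTensor (I : TwoSidedIdeal Aup) : Submodule ℂ (Afree θ) :=
  (idealTensor I).map (LinearMapClass.linearMap (canon θ) : CTensor Aup Compacts →ₗ[ℂ] Afree θ)

theorem mem_imageTensor {I : TwoSidedIdeal Aup} {x : Afree θ} :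
    x ∈ imageTensor θ I ↔ ∃ t ∈ idealTensor I, canon θ t = x := Iff.rfl

theorem isClosed_imageTensor (I : TwoSidedIdeal Aup) :
    IsClosed (imageTensor θ I : Set (Afree θ)) :=
  (NonUnitalStarAlgHom.isometry (canon θ) (canon_injective θ)).isClosedEmbedding.isClosedMap _
    (isClosed_idealTensor I)

theorem slot_mem_imageTensor {I : TwoSidedIdeal Aup} {b : Aup} (hb : b ∈ I) (i j : ℕ) :
    slot (genU θ * genV θ) (corner θ) i j b ∈ imageTensor θ I :=
  ⟨_, tmul_mem_idealTensor hb (unitCompact i j), canon_unitCompact θ b i j⟩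

theorem imageTensor_le {I : TwoSidedIdeal Aup} {M : Submodule ℂ (Afree θ)}
    (hM : IsClosed (M : Set (Afree θ)))
    (h : ∀ b ∈ I, ∀ i j, slot (genU θ * genV θ) (corner θ) i j b ∈ M) : imageTensor θ I ≤ M := by
  refine Submodule.map_le_iff_le_comap.2 (idealTensor_le ?_ fun b hb i j => ?_)
  · exact hM.preimage (continuous_starHom (canon θ))
  · change canon θ _ ∈ M
    rw [canon_unitCompact]
    exact h b hb i j

theorem mul_mem_imageTensor_of_shiftBounded {I : TwoSidedIdeal Aup} {a : Afree θ}
    (ha : ShiftBounded θ a) {x : Afree θ} (hx : x ∈ imageTensor θ I) :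
    a * x ∈ imageTensor θ I := by
  have h : imageTensor θ I ≤ (imageTensor θ I).comap (LinearMap.mulLeft ℂ a) := by
    refine imageTensor_le θ ((isClosed_imageTensor θ I).preimage (continuous_const_mul a)) ?_
    intro b hb i j
    obtain ⟨k, k', d, d', e⟩ := ha.mul_slot i j
    change a * slot _ _ i j b ∈ imageTensor θ I
    rw [e]
    exact add_mem (slot_mem_imageTensor θ (I.mul_mem_left _ _ hb) _ _)
      (slot_mem_imageTensor θ (I.mul_mem_left _ _ hb) _ _)
  exact h hx

theorem mul_star_mem_imageTensor_of_shiftBounded {I : TwoSidedIdeal Aup} {a : Afree θ}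
    (ha : ShiftBounded θ a) {x : Afree θ} (hx : x ∈ imageTensor θ I) :
    x * star a ∈ imageTensor θ I := by
  have h : imageTensor θ I ≤ (imageTensor θ I).comap (LinearMap.mulRight ℂ (star a)) := by
    refine imageTensor_le θ ((isClosed_imageTensor θ I).preimage (continuous_mul_const (star a))) ?_
    intro b hb i j
    obtain ⟨k, k', d, d', e⟩ := ha.slot_mul i j
    change slot _ _ i j b * star a ∈ imageTensor θ I
    rw [e]
    exact add_mem (slot_mem_imageTensor θ (I.mul_mem_right _ _ hb) _ _)
      (slot_mem_imageTensor θ (I.mul_mem_right _ _ hb) _ _)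
  exact h hx

theorem mul_mem_imageTensor (I : TwoSidedIdeal Aup) (a : Afree θ) :
    ∀ x ∈ imageTensor θ I, a * x ∈ imageTensor θ I := by
  induction a using Afree.induction with
  | hc =>
    have : {a : Afree θ | ∀ x ∈ imageTensor θ I, a * x ∈ imageTensor θ I} =
        ⋂ x ∈ imageTensor θ I, {a | a * x ∈ imageTensor θ I} := by
      ext; simp
    rw [this]
    exact isClosed_biInter fun x _ =>
      (isClosed_imageTensor θ I).preimage (continuous_mul_const x)
  | hu => exact fun x => mul_mem_imageTensor_of_shiftBounded θ (shiftBounded_genU θ)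
  | hv => exact fun x => mul_mem_imageTensor_of_shiftBounded θ (shiftBounded_genV θ)
  | hu' => exact fun x => mul_mem_imageTensor_of_shiftBounded θ (shiftBounded_star_genU θ)
  | hv' => exact fun x => mul_mem_imageTensor_of_shiftBounded θ (shiftBounded_star_genV θ)
  | h1 => exact fun x hx => by rwa [one_mul]
  | hs c a h =>
    exact fun x hx => by rw [smul_mul_assoc]; exact (imageTensor θ I).smul_mem c (h x hx)
  | ha a b h h' => exact fun x hx => by rw [add_mul]; exact add_mem (h x hx) (h' x hx)
  | hm a b h h' => exact fun x hx => by rw [mul_assoc]; exact h _ (h' x hx)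

theorem mul_mem_imageTensor' (I : TwoSidedIdeal Aup) (a : Afree θ) :
    ∀ x ∈ imageTensor θ I, x * a ∈ imageTensor θ I := by
  induction a using Afree.induction with
  | hc =>
    have : {a : Afree θ | ∀ x ∈ imageTensor θ I, x * a ∈ imageTensor θ I} =
        ⋂ x ∈ imageTensor θ I, {a | x * a ∈ imageTensor θ I} := by
      ext; simp
    rw [this]
    exact isClosed_biInter fun x _ =>
      (isClosed_imageTensor θ I).preimage (continuous_const_mul x)
  | hu =>
    have := shiftBounded_star_genU θ
    exact fun x hx => by
      simpa using mul_star_mem_imageTensor_of_shiftBounded θ this hx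
  | hv =>
    have := shiftBounded_star_genV θ
    exact fun x hx => by
      simpa using mul_star_mem_imageTensor_of_shiftBounded θ this hx
  | hu' => exact fun x => mul_star_mem_imageTensor_of_shiftBounded θ (shiftBounded_genU θ)
  | hv' => exact fun x => mul_star_mem_imageTensor_of_shiftBounded θ (shiftBounded_genV θ)
  | h1 => exact fun x hx => by rwa [mul_one]
  | hs c a h =>
    exact fun x hx => by rw [mul_smul_comm]; exact (imageTensor θ I).smul_mem c (h x hx)
  | ha a b h h' => exact fun x hx => by rw [mul_add]; exact add_mem (h x hx) (h' x hx)
  | hm a b h h' => exact fun x hx => by rw [← mul_assoc]; exact h' _ (h x hx)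

/-- The image of `I ⊗ K` in the free twist, as a two-sided ideal. -/
def imageIdeal (I : TwoSidedIdeal Aup) : TwoSidedIdeal (Afree θ) :=
  TwoSidedIdeal.mk' (imageTensor θ I) (zero_mem _) (fun hx hy => add_mem hx hy)
    (fun hx => neg_mem hx) (fun {x y} hy => mul_mem_imageTensor θ I x y hy)
    (fun {x y} hx => mul_mem_imageTensor' θ I y x hx)

theorem coe_imageIdeal (I : TwoSidedIdeal Aup) :
    (imageIdeal θ I : Set (Afree θ)) = imageTensor θ I :=
  TwoSidedIdeal.coe_mk' _ _ _ _ _ _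

theorem mem_imageIdeal {I : TwoSidedIdeal Aup} {x : Afree θ} :
    x ∈ imageIdeal θ I ↔ ∃ t ∈ idealTensor I, canon θ t = x := by
  rw [← mem_imageTensor, ← SetLike.mem_coe, coe_imageIdeal, SetLike.mem_coe]

theorem corner_mem_imageIdeal {I : TwoSidedIdeal Aup} {b : Aup} (hb : b ∈ I) :
    corner θ b ∈ imageIdeal θ I := by
  rw [← SetLike.mem_coe, coe_imageIdeal]
  simpa [slot] using slot_mem_imageTensor θ hb 0 0

/-- The ideal of the free twist generated by `G` is the image of `⟨G'⟩ ⊗ K` when each of the two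
sets of generators lies in the other ideal. -/
theorem closedIdeal_eq_imageIdeal {G : Set (Afree θ)} {G' : Set Aup}
    (h : G ⊆ imageIdeal θ (closedIdeal G')) (h' : ∀ g ∈ G', corner θ g ∈ closedIdeal G) :
    closedIdeal G = imageIdeal θ (closedIdeal G') := by
  refine le_antisymm (closedIdeal_le ?_ h) ?_
  · rw [coe_imageIdeal]; exact isClosed_imageTensor θ _
  -- The preimage of ⟨G⟩ under `corner` is a closed ideal of B containing G', hence ⟨G'⟩.
  -- Multiplying by powers of w and w* then puts every matrix slot over ⟨G'⟩ into ⟨G⟩.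
  let L : TwoSidedIdeal Aup := TwoSidedIdeal.mk' {b | corner θ b ∈ closedIdeal G}
    (by simp [(closedIdeal G).zero_mem])
    (fun {x y} hx hy => by simpa using (closedIdeal G).add_mem hx hy)
    (fun {x} hx => by simpa using (closedIdeal G).neg_mem hx)
    (fun {x y} hy => by simpa using (closedIdeal G).mul_mem_left _ _ hy)
    (fun {x y} hx => by simpa using (closedIdeal G).mul_mem_right _ _ hx)
  have hL : (L : Set Aup) = corner θ ⁻¹' (closedIdeal G : Set (Afree θ)) :=
    TwoSidedIdeal.coe_mk' _ _ _ _ _ _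
  have hle : closedIdeal G' ≤ L := by
    refine closedIdeal_le ?_ fun g hg => ?_
    · rw [hL]
      exact (isClosed_closedIdeal G).preimage (continuous_starHom (corner θ))
    · rw [hL]; exact h' g hg
  let M : Submodule ℂ (Afree θ) :=
    { carrier := closedIdeal G
      add_mem' := fun hx hy => (closedIdeal G).add_mem hx hy
      zero_mem' := (closedIdeal G).zero_mem
      smul_mem' := fun c x hx => ideal_smul_mem _ c hx }
  have hM : imageTensor θ (closedIdeal G') ≤ M :=
    imageTensor_le θ (isClosed_closedIdeal G) fun b hb i j => by
      have hb' : corner θ b ∈ closedIdeal G := by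
        have : b ∈ (L : Set Aup) := hle hb
        rwa [hL] at this
      exact (closedIdeal G).mul_mem_right _ _ ((closedIdeal G).mul_mem_left _ _ hb')
  intro x hx
  have : x ∈ (imageIdeal θ (closedIdeal G') : Set (Afree θ)) := hx
  rw [coe_imageIdeal] at this
  exact hM this

theorem defect_genU : defect (genU θ) = corner θ (upU * upP * star upU) := by
  rw [(twistPair_gen θ).defect_u_eq, map_mul, map_mul, map_star, corner_upU, corner_upP]

theorem defect_mul_defect_gen : defect (genU θ) * defect (genV θ) =
    corner θ (upU * upP * star upU * (1 - upP)) := by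
  rw [defect_genU, ← corner_compl, ← map_mul]

theorem commutator_gen :
    star (genU θ) * genV θ - starRingEnd ℂ (lam θ) • (genV θ * star (genU θ)) =
      corner θ ((1 - upP) * star upU * (upP * star upU)) := by
  rw [(twistPair_gen θ).commutator_eq, map_mul, map_mul, map_mul, map_star, corner_compl,
    corner_upU, corner_upP]

/-- The ideal generated by 1 is all of B, so this identifies J with the range of `canon`. One
inclusion uses that both defects lie in the corner, the other that P lies in J by its first
splitting. -/
theorem defectTwoSided_eq : defectTwoSided θ = imageIdeal θ (closedIdeal {1}) := by
  have h1 : ∀ b : Aup, b ∈ closedIdeal ({1} : Set Aup) := fun b => by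
    have := (closedIdeal ({1} : Set Aup)).mul_mem_left b 1 (subset_closedIdeal _ rfl)
    rwa [mul_one] at this
  refine closedIdeal_eq_imageIdeal θ ?_ ?_
  · rintro _ (rfl | rfl)
    · change defect (genU θ) ∈ imageIdeal θ _
      rw [defect_genU]; exact corner_mem_imageIdeal θ (h1 _)
    · change defect (genV θ) ∈ imageIdeal θ _
      rw [← corner_compl]; exact corner_mem_imageIdeal θ (h1 _)
  · rintro _ rfl
    rw [corner_one, defect_prod_eq]
    exact TwoSidedIdeal.add_mem _ (subset_closedIdeal _ (Or.inl rfl))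
      (TwoSidedIdeal.mul_mem_right _ _ _
        (TwoSidedIdeal.mul_mem_left _ _ _ (subset_closedIdeal _ (Or.inr rfl))))

theorem mem_defectIdeal {x : Afree θ} : x ∈ defectIdeal θ ↔ ∃ t, canon θ t = x := by
  have e : x ∈ defectIdeal θ ↔ x ∈ defectTwoSided θ := Iff.rfl
  rw [e, defectTwoSided_eq, mem_imageIdeal]
  refine ⟨fun ⟨t, _, h⟩ => ⟨t, h⟩, fun ⟨t, h⟩ => ⟨t, ?_, h⟩⟩
  refine CTensor.mem_of_tmul _ (isClosed_idealTensor _) (fun b T => tmul_mem_idealTensor ?_ T) t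
  have := (closedIdeal ({1} : Set Aup)).mul_mem_left b 1 (subset_closedIdeal _ rfl)
  rwa [mul_one] at this

/-- The isomorphism of `(C(S¹) * ℂ²) ⊗ K` with the defect ideal. -/
def canonEquiv : CTensor Aup Compacts ≃⋆ₐ[ℂ] defectIdeal θ :=
  StarAlgEquiv.ofBijective
    (NonUnitalStarAlgHom.codRestrict (canon θ) (defectIdeal θ) fun t => (mem_defectIdeal θ).2 ⟨t, rfl⟩)
    ⟨fun s t h => canon_injective θ (congrArg Subtype.val h), fun x => by
      obtain ⟨t, ht⟩ := (mem_defectIdeal θ).1 x.2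
      exact ⟨t, Subtype.ext ht⟩⟩

theorem canon_tmul_upU (i : ℕ) : canon θ (CTensor.tmul upU (matUnit i)) =
    (genU θ * genV θ) ^ i * uBar θ := by
  rw [matUnit_eq, canon_unitCompact, slot, pow_zero, mul_one, corner_upU]; rfl

theorem canon_tmul_upP (i : ℕ) : canon θ (CTensor.tmul upP (matUnit i)) =
    (genU θ * genV θ) ^ i * pBar θ := by
  rw [matUnit_eq, canon_unitCompact, slot, pow_zero, mul_one, corner_upP]; rfl

theorem isCanonical_canonEquiv : IsCanonical (canonEquiv θ).symm := fun i =>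
  ⟨canon_tmul_upU θ i, canon_tmul_upP θ i⟩

/-! ### Uniqueness of the canonical isomorphism -/

theorem CTensor.tmul_unitCompact_eq {B : Type} [CStarAlgebra B] (b : B) (i j : ℕ) :
    CTensor.tmul b (unitCompact i j) = CTensor.tmul 1 (unitCompact i 0) *
      CTensor.cornerHom B b * star (CTensor.tmul 1 (unitCompact j 0)) := by
  have e : CTensor.cornerHom B b = CTensor.tmul b (unitCompact 0 0) := rfl
  rw [CTensor.star_tmul, star_unitCompact, e, CTensor.tmul_unitCompact_mul, if_pos rfl,
    CTensor.tmul_unitCompact_mul, if_pos rfl, one_mul, star_one, mul_one]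

theorem CTensor.starHom_ext {B A : Type} [CStarAlgebra B] [NonUnitalCStarAlgebra A]
    {f g : CTensor B Compacts →⋆ₙₐ[ℂ] A}
    (h : ∀ b i j, f (CTensor.tmul b (unitCompact i j)) = g (CTensor.tmul b (unitCompact i j)))
    (t : CTensor B Compacts) : f t = g t := by
  let M : Submodule ℂ (CTensor B Compacts) :=
    { carrier := {t | f t = g t}
      add_mem' := fun {s t} hs ht => by
        change f (s + t) = g (s + t)
        rw [map_add, map_add, show f s = g s from hs, show f t = g t from ht]
      zero_mem' := by change f 0 = g 0; rw [map_zero, map_zero]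
      smul_mem' := fun c s hs => by
        change f (c • s) = g (c • s)
        rw [map_smul, map_smul, show f s = g s from hs] }
  exact CTensor.mem_of_unitCompact M (isClosed_eq (continuous_starHom f) (continuous_starHom g)) h t

theorem Aup.starHom_ext {A : Type} [NonUnitalCStarAlgebra A] {f g : Aup →⋆ₙₐ[ℂ] A}
    (hu : f upU = g upU) (hp : f upP = g upP) (h1 : f 1 = g 1) (b : Aup) : f b = g b := by
  induction b using Aup.induction with
  | hc => exact isClosed_eq (continuous_starHom f) (continuous_starHom g)
  | hu => exact hu
  | hp => exact hp
  | h1 => exact h1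
  | hs c a h => rw [map_smul, map_smul, h]
  | ha a b h h' => rw [map_add, map_add, h, h']
  | hm a b h h' => rw [map_mul, map_mul, h, h']
  | hst a h => rw [map_star, map_star, h]

/-- Unitarity of ū recovers the matrix units, on which nothing is prescribed directly, from the
prescribed elements ū ⊗ x_i. -/
theorem CTensor.tmul_one_eq (i : ℕ) :
    (CTensor.tmul 1 (unitCompact i 0) : CTensor Aup Compacts) =
      CTensor.tmul upU (matUnit i) * star (CTensor.tmul upU (matUnit 0)) := by
  rw [CTensor.star_tmul, matUnit_eq, matUnit_eq, star_unitCompact,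
    CTensor.tmul_unitCompact_mul, if_pos rfl, unitaryProj_up.mul_star]

theorem starHom_mul_star {D A : Type} [NonUnitalCStarAlgebra D] [NonUnitalCStarAlgebra A]
    {f g : D →⋆ₙₐ[ℂ] A} {x y : D} (hx : f x = g x) (hy : f y = g y) :
    f (x * star y) = g (x * star y) := by
  rw [map_mul, map_mul, map_star, map_star, hx, hy]

/-- A star homomorphism on `(C(S¹) * ℂ²) ⊗ K` is determined by the images of `ū ⊗ x_i` and
`p̄ ⊗ x_i`. -/
theorem starHom_ext {A : Type} [NonUnitalCStarAlgebra A] {f g : CTensor Aup Compacts →⋆ₙₐ[ℂ] A}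
    (hu : ∀ i, f (CTensor.tmul upU (matUnit i)) = g (CTensor.tmul upU (matUnit i)))
    (hp : ∀ i, f (CTensor.tmul upP (matUnit i)) = g (CTensor.tmul upP (matUnit i)))
    (t : CTensor Aup Compacts) : f t = g t := by
  have h1 : ∀ i, f (CTensor.tmul 1 (unitCompact i 0)) = g (CTensor.tmul 1 (unitCompact i 0)) :=
    fun i => (congrArg f (CTensor.tmul_one_eq i)).trans
      ((starHom_mul_star (hu i) (hu 0)).trans (congrArg g (CTensor.tmul_one_eq i)).symm)
  have h2 : ∀ b, f.comp (CTensor.cornerHom Aup) b = g.comp (CTensor.cornerHom Aup) b :=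
    Aup.starHom_ext (hu 0) (hp 0) (h1 0)
  refine CTensor.starHom_ext (fun b i j => ?_) t
  have h3 : f (CTensor.cornerHom Aup b) = g (CTensor.cornerHom Aup b) := h2 b
  rw [CTensor.tmul_unitCompact_eq, map_mul f, map_mul f, map_mul g, map_mul g, map_star f,
    map_star g, h1, h1, h3]

variable {θ}

/-- Both sides are star homomorphisms on B ⊗ K agreeing on a generating set. Hence the
correspondence of ideals need only be checked for `canon`. -/
theorem IsCanonical.symm_apply {Φ : defectIdeal θ ≃⋆ₐ[ℂ] CTensor Aup Compacts}
    (hΦ : IsCanonical Φ) (t : CTensor Aup Compacts) : (Φ.symm t : Afree θ) = canon θ t := by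
  let f : CTensor Aup Compacts →⋆ₙₐ[ℂ] Afree θ :=
    { toFun := fun t => (Φ.symm t : Afree θ)
      map_smul' := fun c t => by rw [map_smul]; rfl
      map_zero' := by rw [map_zero]; rfl
      map_add' := fun s t => by rw [map_add]; rfl
      map_mul' := fun s t => by rw [map_mul]; rfl
      map_star' := fun t => by rw [map_star]; rfl }
  exact starHom_ext (f := f) (g := canon θ) (fun i => (hΦ i).1.trans (canon_tmul_upU θ i).symm)
    (fun i => (hΦ i).2.trans (canon_tmul_upP θ i).symm) t

theorem IsCanonical.corresponds {Φ : defectIdeal θ ≃⋆ₐ[ℂ] CTensor Aup Compacts}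
    (hΦ : IsCanonical Φ) {G : Set (Afree θ)} {G' : Set Aup}
    (h : G ⊆ imageIdeal θ (closedIdeal G')) (h' : ∀ g ∈ G', corner θ g ∈ closedIdeal G) :
    Corresponds Φ (closedIdeal G) (closedIdeal G') := by
  rw [Corresponds, closedIdeal_eq_imageIdeal θ h h']
  refine ⟨fun x hx => ?_, fun x => ?_⟩
  · obtain ⟨t, _, ht⟩ := (mem_imageIdeal θ).1 hx
    exact (mem_defectIdeal θ).2 ⟨t, ht⟩
  · have hx : canon θ (Φ x) = x := by rw [← hΦ.symm_apply, StarAlgEquiv.symm_apply_apply]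
    rw [mem_imageIdeal]
    refine ⟨fun ⟨t, ht, e⟩ => ?_, fun ht => ⟨Φ x, ht, hx⟩⟩
    rwa [← canon_injective θ (e.trans hx.symm)]

end Canonical

/-! ### Comparison of generators of ideals -/

section Generators

theorem star_up : star (upP * upU * (1 - upP)) = (1 - upP) * star upU * upP := by
  rw [star_mul, star_mul, star_sub, star_one, unitaryProj_up.star_p, mul_assoc]

theorem star_up' : star ((1 - upP) * upU * upP) = upP * star upU * (1 - upP) := by
  rw [star_mul, star_mul, star_sub, star_one, unitaryProj_up.star_p, mul_assoc]

/-- The element is (p̄ū(1-p̄))* ū*, an adjoint times a unitary. Likewise ūp̄ū*(1-p̄) = ū((1-p̄)ūp̄)*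
in the next lemma. -/
theorem commutator_mem {I : TwoSidedIdeal Aup} (hI : IsClosed (I : Set Aup))
    (h : upP * upU * (1 - upP) ∈ I) : (1 - upP) * star upU * (upP * star upU) ∈ I := by
  have := I.mul_mem_right _ (star upU) (star_mem_of_isClosed I hI h)
  rwa [star_up, mul_assoc _ upP] at this

theorem product_mem {I : TwoSidedIdeal Aup} (hI : IsClosed (I : Set Aup))
    (h : (1 - upP) * upU * upP ∈ I) : upU * upP * star upU * (1 - upP) ∈ I := by
  have := I.mul_mem_left upU _ (star_mem_of_isClosed I hI h)
  rwa [star_up', ← mul_assoc, ← mul_assoc] at this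

variable {θ : ℝ}

/-- Converse direction: multiplication by the image of ū removes the factor ū*, and an adjoint
finishes. -/
theorem corner_mem_of_commutator_mem {I : TwoSidedIdeal (Afree θ)}
    (hI : IsClosed (I : Set (Afree θ)))
    (h : corner θ ((1 - upP) * star upU * (upP * star upU)) ∈ I) :
    corner θ (upP * upU * (1 - upP)) ∈ I := by
  have h1 := star_mem_of_isClosed I hI (I.mul_mem_right _ (corner θ upU) h)
  rwa [← map_mul, ← map_star, mul_assoc, mul_assoc upP, unitaryProj_up.star_mul, mul_one,
    ← star_up, star_star] at h1

theorem corner_mem_of_product_mem {I : TwoSidedIdeal (Afree θ)}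
    (hI : IsClosed (I : Set (Afree θ)))
    (h : corner θ (upU * upP * star upU * (1 - upP)) ∈ I) :
    corner θ ((1 - upP) * upU * upP) ∈ I := by
  have h1 := star_mem_of_isClosed I hI (I.mul_mem_left (corner θ (star upU)) _ h)
  rwa [← map_mul, ← map_star, mul_assoc upU, mul_assoc upU, ← mul_assoc (star upU),
    unitaryProj_up.star_mul, one_mul, ← star_up', star_star] at h1

/-- Relative to p̄ the commutator is off-diagonal. Its two blocks are, up to sign, those of ū, and
they generate the same ideal as the commutator itself. -/
theorem compress_commutator : upP * (upU * upP - upP * upU) * (1 - upP) =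
    -(upP * upU * (1 - upP)) := by
  have h := unitaryProj_up.mul_p
  have h' : upP * (1 - upP) = 0 := by rw [mul_sub, mul_one, h, sub_self]
  rw [mul_sub upP, sub_mul _ _ (1 - upP), ← mul_assoc upP upP, h, ← mul_assoc, mul_assoc _ upP (1 - upP), h',
    mul_zero, zero_sub]

theorem compress_commutator' : (1 - upP) * (upU * upP - upP * upU) * upP =
    (1 - upP) * upU * upP := by
  have h := unitaryProj_up.mul_p
  have h' : (1 - upP) * upP = 0 := by rw [sub_mul, one_mul, h, sub_self]
  rw [mul_sub, sub_mul, ← mul_assoc (1 - upP) upP, h', zero_mul, zero_mul, sub_zero, ← mul_assoc,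
    mul_assoc _ upP upP, h]

theorem commutator_decomp : upU * upP - upP * upU =
    (1 - upP) * upU * upP - upP * upU * (1 - upP) := by
  noncomm_ring

end Generators

end
end FreeTwist
open FreeTwist

theorem mainTheorem12 (θ : ℝ) (hθ : Irrational θ) :
    (∃ Φ : defectIdeal θ ≃⋆ₐ[ℂ] CTensor Aup Compacts, IsCanonical Φ) ∧
    ∀ Φ : defectIdeal θ ≃⋆ₐ[ℂ] CTensor Aup Compacts, IsCanonical Φ →
      Corresponds Φ
        (closedIdeal {1 - genU θ * star (genU θ)})
        (closedIdeal {upP}) ∧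
      Corresponds Φ
        (closedIdeal {1 - genV θ * star (genV θ)})
        (closedIdeal {1 - upP}) ∧
      Corresponds Φ
        (closedIdeal
          {star (genU θ) * genV θ - starRingEnd ℂ (lam θ) • (genV θ * star (genU θ))})
        (closedIdeal {upP * upU * (1 - upP)}) ∧
      Corresponds Φ
        (closedIdeal {(1 - genU θ * star (genU θ)) * (1 - genV θ * star (genV θ))})
        (closedIdeal {(1 - upP) * upU * upP}) ∧
      Corresponds Φ
        (closedIdeal
          {star (genU θ) * genV θ - starRingEnd ℂ (lam θ) • (genV θ * star (genU θ)),
           (1 - genU θ * star (genU θ)) * (1 - genV θ * star (genV θ))})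
        (closedIdeal {upU * upP - upP * upU}) := by
  refine ⟨⟨_, isCanonical_canonEquiv θ⟩, fun Φ hΦ => ?_⟩
  have eU : 1 - genU θ * star (genU θ) = corner θ (upU * upP * star upU) := defect_genU θ
  have eV : 1 - genV θ * star (genV θ) = corner θ (1 - upP) := (corner_compl θ).symm
  have eP : (1 - genU θ * star (genU θ)) * (1 - genV θ * star (genV θ)) =
      corner θ (upU * upP * star upU * (1 - upP)) := defect_mul_defect_gen θ
  -- All generators in A now come from B through `corner`, so each correspondence amounts to two
  -- memberships.
  rw [eP, commutator_gen]
  refine ⟨hΦ.corresponds ?_ ?_, hΦ.corresponds ?_ ?_, hΦ.corresponds ?_ ?_, hΦ.corresponds ?_ ?_,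
    hΦ.corresponds ?_ ?_⟩
  · rintro _ rfl
    -- In B the generator is ūp̄ū*, visibly in the ideal of p̄.
    rw [eU]
    exact corner_mem_imageIdeal θ (TwoSidedIdeal.mul_mem_right _ _ _
      (TwoSidedIdeal.mul_mem_left _ _ _ (subset_closedIdeal _ rfl)))
  · rintro _ rfl
    -- Conversely the image of p̄ is v(1-uu*)v*, so it lies in the ideal of 1-uu*.
    rw [corner_upP]
    exact TwoSidedIdeal.mul_mem_right _ _ _
      (TwoSidedIdeal.mul_mem_left _ _ _ (subset_closedIdeal _ rfl))
  · rintro _ rfl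
    rw [eV]
    exact corner_mem_imageIdeal θ (subset_closedIdeal _ rfl)
  · rintro _ rfl
    rw [← eV]
    exact subset_closedIdeal _ rfl
  · rintro _ rfl
    exact corner_mem_imageIdeal θ (commutator_mem (isClosed_closedIdeal _)
      (subset_closedIdeal _ rfl))
  · rintro _ rfl
    exact corner_mem_of_commutator_mem (isClosed_closedIdeal _) (subset_closedIdeal _ rfl)
  · rintro _ rfl
    exact corner_mem_imageIdeal θ (product_mem (isClosed_closedIdeal _)
      (subset_closedIdeal _ rfl))
  · rintro _ rfl
    exact corner_mem_of_product_mem (isClosed_closedIdeal _) (subset_closedIdeal _ rfl)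
  · have hs : upU * upP - upP * upU ∈ closedIdeal {upU * upP - upP * upU} :=
      subset_closedIdeal _ rfl
    rintro _ (rfl | rfl)
    · refine corner_mem_imageIdeal θ (commutator_mem (isClosed_closedIdeal _) ?_)
      have := TwoSidedIdeal.neg_mem _ (TwoSidedIdeal.mul_mem_right _ _ (1 - upP)
        (TwoSidedIdeal.mul_mem_left _ upP _ hs))
      rwa [compress_commutator, neg_neg] at this
    · refine corner_mem_imageIdeal θ (product_mem (isClosed_closedIdeal _) ?_)
      have := TwoSidedIdeal.mul_mem_right _ _ upP
        (TwoSidedIdeal.mul_mem_left _ (1 - upP) _ hs)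
      rwa [compress_commutator'] at this
  · rintro _ rfl
    rw [commutator_decomp, map_sub]
    exact TwoSidedIdeal.sub_mem _
      (corner_mem_of_product_mem (isClosed_closedIdeal _) (subset_closedIdeal _ (Or.inr rfl)))
      (corner_mem_of_commutator_mem (isClosed_closedIdeal _) (subset_closedIdeal _ (Or.inl rfl)))
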